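/- Conventions. $\lambda\in\mathbb N$ is the security parameter; $f:\mathbb N\to\mathbb R$ is negligible, written $\mathrm{negl}(\lambda)$, if $\lambda^c f(\lambda)\to 0$ for every $c\in\mathbb N$. A QPT algorithm is a family of quantum circuits $(C_\lambda)_\lambda$ (unitary gates from a fixed finite universal set acting on the input qubits and on ancillas initialised to $|0\rangle$, followed by discarding qubits; classical inputs and outputs are computational-basis states and measurement outcomes) of size polynomial in $\lambda$ whose descriptions are computed from $1^\lambda$ in classical polynomial time. A QPT adversary is non-uniform: a family of circuits of size polynomial in $\lambda$ that also receives polynomial-size advice depending only on $\lambda$. The advice is throughout either a classical string or throughout an arbitrary quantum state; the theorem holds in each of the two cases. A quantum pseudo one-time pad (QPOTP) scheme with key length $\kappa=\kappa(\lambda)$ and message length $\ell=\ell(\lambda)$, where $\kappa(\lambda)<\ell(\lambda)$ for all $\lambda$, is a triple of QPT algorithms: $\mathsf{KeyGen}(1^\lambda)\to sk\in\{0,1\}^\kappa$; $\mathsf{Enc}(sk,x)\to ct$, which maps $x\in\{0,1\}^\ell$ to a (possibly mixed) state of $\ell n$ qubits for some $n=n(\lambda)$; and $\mathsf{Dec}(sk,ct)\to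 x'\in\{0,1\}^\ell$, such that the following hold. (Correctness) For any messages $x=x(\lambda)\in\{0,1\}^\ell$, $$\Pr[x\gets\mathsf{Dec}(sk,ct): sk\gets\mathsf{KeyGen}(1^\lambda),\ ct\gets\mathsf{Enc}(sk,x)]\ge 1-\mathrm{negl}(\lambda).$$ (Security) For any messages $x_0=x_0(\lambda)$, $x_1=x_1(\lambda)$ in $\{0,1\}^\ell$, any QPT adversary $\mathcal A$ and any polynomial $t$, $$\bigl|\Pr[1\gets\mathcal A(ct_0^{\otimes t})]-\Pr[1\gets\mathcal A(ct_1^{\otimes t})]\bigr|\le\mathrm{negl}(\lambda),$$ where in each probability $sk\gets\mathsf{KeyGen}(1^\lambda)$ and $ct_b\gets\mathsf{Enc}(sk,x_b)$. A one-way state generator (OWSG) is a triple of QPT algorithms: $\mathsf{KeyGen}(1^\lambda)\to k\in\{0,1\}^{\kappa'}$; $\mathsf{StateGen}(k)\to\phi_k$, a (possibly mixed) state of $m$ qubits; and $\mathsf{Ver}(k',\phi_k)\to\top/\bot$, for some $\kappa'=\kappa'(\lambda)$ and $m=m(\lambda)$, such that the following hold. (Correctness) $$\Pr[\top\gets\mathsf{Ver}(k,\phi_k):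 k\gets\mathsf{KeyGen}(1^\lambda),\ \phi_k\gets\mathsf{StateGen}(k)]\ge 1-\mathrm{negl}(\lambda).$$ (Security) For any QPT adversary $\mathcal A$ and any polynomial $t$, $$\Pr[\top\gets\mathsf{Ver}(k',\phi_k): k\gets\mathsf{KeyGen}(1^\lambda),\ \phi_k\gets\mathsf{StateGen}(k),\ k'\gets\mathcal A(\phi_k^{\otimes t})]\le\mathrm{negl}(\lambda).$$ Theorem. If QPOTP schemes (with $\kappa<\ell$) exist, then OWSGs exist. -/

import Mathlib

namespace QCrypto

noncomputable section

open scoped ComplexOrder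

/-! ### Quantum circuits on qubits -/

/-- Bit strings of length `a`, the computational basis of `a` qubits. -/
abbrev Bits (a : ℕ) : Type := Fin a → Bool

/-- Operators on `a` qubits (density operators in particular), in the computational basis. -/
abbrev Op (a : ℕ) : Type := Matrix (Bits a) (Bits a) ℂ

/-- The projector onto the computational basis vector `x`. -/
def ketbra {a : ℕ} (x : Bits a) : Op a := Matrix.single x x 1

/-- The tensor product of two operators; the qubits of the first factor come first. -/
def tensor {a b : ℕ} (ρ : Op a) (σ : Op b) : Op (a + b) := fun x y =>
  ρ (fun i => x (Fin.castAdd b i)) (fun i => y (Fin.castAdd b i)) *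
    σ (fun j => x (Fin.natAdd a j)) (fun j => y (Fin.natAdd a j))

/-- The tensor power: `t` copies of `ρ`, one block of `a` qubits after the other. -/
def tensorPow {a : ℕ} (t : ℕ) (ρ : Op a) : Op (t * a) := fun x y =>
  ∏ i : Fin t, ρ (fun j => x (finProdFinEquiv (i, j))) (fun j => y (finProdFinEquiv (i, j)))

/-- A (possibly mixed) quantum state. -/
def IsState {a : ℕ} (ρ : Op a) : Prop := ρ.PosSemidef ∧ ρ.trace = 1

/-- Elementary gates on the wires `ι`: the universal set Hadamard, `T`, CNOT,
together with NOT and Toffoli (which that set generates exactly). -/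
inductive Gate (ι : Type) : Type
  | H (i : ι) : Gate ι
  | T (i : ι) : Gate ι
  | X (i : ι) : Gate ι
  | CNOT (c t : ι) (h : c ≠ t) : Gate ι
  | Toffoli (c d t : ι) (hcd : c ≠ d) (hct : c ≠ t) (hdt : d ≠ t) : Gate ι

/-- The unitary matrix of a gate on the whole register. -/
def Gate.mat {ι : Type} [Fintype ι] [DecidableEq ι] :
    Gate ι → Matrix (ι → Bool) (ι → Bool) ℂ
  | .H i => Matrix.of fun x y =>
      if ∀ j, j ≠ i → x j = y j then
        (if x i && y i then -1 else 1) * ((Real.sqrt 2 : ℝ) : ℂ)⁻¹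
      else 0
  | .T i => Matrix.diagonal fun x =>
      if x i then Complex.exp (Complex.I * (Real.pi / 4)) else 1
  | .X i => Matrix.of fun x y => if x = Function.update y i (!y i) then 1 else 0
  | .CNOT c t _ => Matrix.of fun x y =>
      if x = Function.update y t (xor (y t) (y c)) then 1 else 0
  | .Toffoli c d t _ _ _ => Matrix.of fun x y =>
      if x = Function.update y t (xor (y t) (y c && y d)) then 1 else 0

/-- A quantum circuit from `a` qubits to `b` qubits, on `width` wires. The input occupies the
first `a` wires, the other wires are ancillas initialised to `|0⟩`; at the end the first `b`
wires are the output and the others are discarded. -/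
structure Circuit (a b : ℕ) where
  width : ℕ
  in_le : a ≤ width
  out_le : b ≤ width
  gates : List (Gate (Fin width))

namespace Circuit

variable {a b : ℕ}

/-- Number of wires plus number of gates. -/
def size (C : Circuit a b) : ℕ := C.width + C.gates.length

/-- The input operator with all ancillas in state `|0⟩`. -/
def prepare (C : Circuit a b) (ρ : Op a) : Op C.width := fun x y =>
  if (∀ i : Fin C.width, a ≤ i.val → x i = false ∧ y i = false) then
    ρ (fun i => x (Fin.castLE C.in_le i)) (fun i => y (Fin.castLE C.in_le i))
  else 0

/-- Apply the gates in order, the head of the list first. -/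
def evolve (C : Circuit a b) (σ : Op C.width) : Op C.width :=
  C.gates.foldl (fun τ g => g.mat * τ * g.mat.conjTranspose) σ

/-- Partial trace over all wires except the first `b`. -/
def traceOut (C : Circuit a b) (σ : Op C.width) : Op b := fun u v =>
  ∑ x : Bits C.width, ∑ y : Bits C.width,
    if (∀ i, x (Fin.castLE C.out_le i) = u i) ∧ (∀ i, y (Fin.castLE C.out_le i) = v i) ∧
        (∀ i : Fin C.width, b ≤ i.val → x i = y i) then σ x y else 0

/-- The quantum operation implemented by the circuit. -/
def run (C : Circuit a b) (ρ : Op a) : Op b := C.traceOut (C.evolve (C.prepare ρ))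

/-- Probability that measuring the output on input `ρ` in the computational basis gives `y`. -/
def prob (C : Circuit a b) (ρ : Op a) (y : Bits b) : ℝ := (C.run ρ y y).re

end Circuit

/-- Probability that a circuit without input outputs `y`. -/
def Circuit.sample {b : ℕ} (C : Circuit 0 b) (y : Bits b) : ℝ := C.prob (ketbra Fin.elim0) y

/-- Probability that a circuit with a one-bit output outputs `1` (that is, `⊤`). -/
def Circuit.accept {a : ℕ} (C : Circuit a 1) (ρ : Op a) : ℝ := C.prob ρ (fun _ => true)

/-! ### Classical polynomial time

Structured random access programs: registers and arrays of natural numbers (finitely many of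
which occur in a program), unit-cost addition and truncated subtraction, indexed memory access. -/

structure Store where
  reg : ℕ → ℕ
  mem : ℕ → ℕ → ℕ

inductive Cmd : Type
  | const (d n : ℕ) : Cmd
  | add (d a b : ℕ) : Cmd
  | sub (d a b : ℕ) : Cmd
  | load (d arr a : ℕ) : Cmd
  | store (arr a s : ℕ) : Cmd
  | seq (P Q : Cmd) : Cmd
  | ite (r : ℕ) (P Q : Cmd) : Cmd
  | loop (r : ℕ) (P : Cmd) : Cmd

/-- Assign `v` to the register `d`. -/
def Store.setReg (s : Store) (d v : ℕ) : Store := ⟨Function.update s.reg d v, s.mem⟩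

/-- Assign `v` to the cell `i` of the array `arr`. -/
def Store.setMem (s : Store) (arr i v : ℕ) : Store :=
  ⟨s.reg, Function.update s.mem arr (Function.update (s.mem arr) i v)⟩

/-- `Exec P s t s'`: started in `s`, the program `P` halts after exactly `t` steps in `s'`.
`ite r P Q` runs `P` if register `r` is nonzero and `Q` otherwise; `loop r P` repeats `P` while
register `r` is nonzero. -/
inductive Exec : Cmd → Store → ℕ → Store → Prop
  | const (d n : ℕ) (s : Store) : Exec (.const d n) s 1 (s.setReg d n)
  | add (d a b : ℕ) (s : Store) : Exec (.add d a b) s 1 (s.setReg d (s.reg a + s.reg b))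
  | sub (d a b : ℕ) (s : Store) : Exec (.sub d a b) s 1 (s.setReg d (s.reg a - s.reg b))
  | load (d arr a : ℕ) (s : Store) :
      Exec (.load d arr a) s 1 (s.setReg d (s.mem arr (s.reg a)))
  | store (arr a r : ℕ) (s : Store) :
      Exec (.store arr a r) s 1 (s.setMem arr (s.reg a) (s.reg r))
  | seq {P Q : Cmd} {s s' s'' : Store} {t t' : ℕ} :
      Exec P s t s' → Exec Q s' t' s'' → Exec (.seq P Q) s (t + t') s''
  | ite_true {r : ℕ} {P Q : Cmd} {s s' : Store} {t : ℕ} :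
      s.reg r ≠ 0 → Exec P s t s' → Exec (.ite r P Q) s (t + 1) s'
  | ite_false {r : ℕ} {P Q : Cmd} {s s' : Store} {t : ℕ} :
      s.reg r = 0 → Exec Q s t s' → Exec (.ite r P Q) s (t + 1) s'
  | loop_done {r : ℕ} {P : Cmd} {s : Store} :
      s.reg r = 0 → Exec (.loop r P) s 1 s
  | loop_step {r : ℕ} {P : Cmd} {s s' s'' : Store} {t t' : ℕ} :
      s.reg r ≠ 0 → Exec P s t s' → Exec (.loop r P) s' t' s'' →
        Exec (.loop r P) s (t + t' + 1) s''

/-- Initially register `0` holds the input and everything else is `0`. -/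
def Store.init (n : ℕ) : Store := ⟨fun r => if r = 0 then n else 0, fun _ _ => 0⟩

/-- The output is the list in array `0`, whose length is in register `0`. -/
def Store.output (s : Store) : List ℕ := (List.range (s.reg 0)).map (s.mem 0)

/-- `f` is computed on `1ⁿ` in time polynomial in `n`. -/
def PolyTime (f : ℕ → List ℕ) : Prop :=
  ∃ (P : Cmd) (p : Polynomial ℕ), ∀ n, ∃ (t : ℕ) (s : Store),
    t ≤ p.eval n ∧ Exec P (Store.init n) t s ∧ s.output = f n

/-- `f` is bounded by a polynomial. -/
def PolyBounded (f : ℕ → ℕ) : Prop := ∃ p : Polynomial ℕ, ∀ n, f n ≤ p.eval n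

/-! ### Quantum polynomial time -/

/-- The description of a gate: its type followed by its wires. -/
def Gate.encode {w : ℕ} : Gate (Fin w) → List ℕ
  | .H i => [0, i, 0, 0]
  | .T i => [1, i, 0, 0]
  | .X i => [2, i, 0, 0]
  | .CNOT c t _ => [3, c, t, 0]
  | .Toffoli c d t _ _ _ => [4, c, d, t]

/-- The classical description of a circuit. -/
def Circuit.encode {a b : ℕ} (C : Circuit a b) : List ℕ :=
  a :: b :: C.width :: C.gates.flatMap Gate.encode

/-- A (uniform) QPT algorithm: a family of quantum circuits of polynomial size whose
descriptions are computed from `1ⁿ` in classical polynomial time. -/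
def IsQPT {a b : ℕ → ℕ} (C : ∀ n, Circuit (a n) (b n)) : Prop :=
  PolyBounded (fun n => (C n).size) ∧ PolyTime (fun n => (C n).encode)

/-- The kind of advice that non-uniform adversaries receive. -/
inductive AdviceKind : Type
  | classical
  | quantum

/-- Classical advice is a bit string, quantum advice an arbitrary mixed state. -/
def AdviceKind.Allows : AdviceKind → {a : ℕ} → Op a → Prop
  | .classical, _, ρ => ∃ x, ρ = ketbra x
  | .quantum, _, ρ => IsState ρ

/-- A non-uniform QPT adversary with `a n` input and `b n` output qubits: a family of quantum
circuits of polynomial size, with advice (of polynomial length) depending on `n` only. -/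
structure Adversary (K : AdviceKind) (a b : ℕ → ℕ) where
  adviceLen : ℕ → ℕ
  advice : ∀ n, Op (adviceLen n)
  advice_allowed : ∀ n, K.Allows (advice n)
  circuit : ∀ n, Circuit (a n + adviceLen n) (b n)
  poly : PolyBounded fun n => (circuit n).size

/-- Probability that the adversary outputs `y` on input `ρ`, at security parameter `n`. -/
def Adversary.prob {K : AdviceKind} {a b : ℕ → ℕ} (A : Adversary K a b) (n : ℕ)
    (ρ : Op (a n)) (y : Bits (b n)) : ℝ :=
  (A.circuit n).prob (tensor ρ (A.advice n)) y

/-- Negligible functions of the security parameter. -/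
def Negligible (f : ℕ → ℝ) : Prop :=
  Asymptotics.SuperpolynomialDecay Filter.atTop (fun n : ℕ => (n : ℝ)) f

/-! ### One-way state generators -/

/-- The algorithms of a one-way state generator, with key length `κ` and `m`-qubit states. -/
structure StateGenerator where
  κ : ℕ → ℕ
  m : ℕ → ℕ
  keyGen : ∀ n, Circuit 0 (κ n)
  stateGen : ∀ n, Circuit (κ n) (m n)
  ver : ∀ n, Circuit (κ n + m n) 1
  keyGen_qpt : IsQPT keyGen
  stateGen_qpt : IsQPT stateGen
  ver_qpt : IsQPT ver

namespace StateGenerator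

/-- The state `φ_k`. -/
def state (G : StateGenerator) (n : ℕ) (k : Bits (G.κ n)) : Op (G.m n) :=
  (G.stateGen n).run (ketbra k)

/-- `Pr[⊤ ← Ver(k', φ_k)]`. -/
def verProb (G : StateGenerator) (n : ℕ) (k' k : Bits (G.κ n)) : ℝ :=
  (G.ver n).accept (tensor (ketbra k') (G.state n k))

/-- `Pr[⊤ ← Ver(k, φ_k) : k ← KeyGen]`. -/
def correctProb (G : StateGenerator) (n : ℕ) : ℝ :=
  ∑ k, (G.keyGen n).sample k * G.verProb n k k

/-- `Pr[⊤ ← Ver(k', φ_k) : k ← KeyGen, k' ← A(φ_k^{⊗t})]`. -/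
def attackProb (G : StateGenerator) {K : AdviceKind} (t : Polynomial ℕ)
    (A : Adversary K (fun n => t.eval n * G.m n) G.κ) (n : ℕ) : ℝ :=
  ∑ k, (G.keyGen n).sample k *
    ∑ k', A.prob n (tensorPow (t.eval n) (G.state n k)) k' * G.verProb n k' k

def Correct (G : StateGenerator) : Prop := Negligible fun n => 1 - G.correctProb n

def Secure (G : StateGenerator) (K : AdviceKind) : Prop :=
  ∀ (t : Polynomial ℕ) (A : Adversary K (fun n => t.eval n * G.m n) G.κ),
    Negligible (G.attackProb t A)

end StateGenerator

/-- One-way state generators exist. -/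
def OWSGExist (K : AdviceKind) : Prop :=
  ∃ G : StateGenerator, G.Correct ∧ G.Secure K

/-! ### Quantum pseudo one-time pads -/

/-- The algorithms of a quantum pseudo one-time pad, with key length `κ`, message length `ℓ`
and ciphertexts of `ℓ * w` qubits. -/
structure PseudoPad where
  κ : ℕ → ℕ
  ℓ : ℕ → ℕ
  w : ℕ → ℕ
  key_lt_message : ∀ n, κ n < ℓ n
  keyGen : ∀ n, Circuit 0 (κ n)
  enc : ∀ n, Circuit (κ n + ℓ n) (ℓ n * w n)
  dec : ∀ n, Circuit (κ n + ℓ n * w n) (ℓ n)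
  keyGen_qpt : IsQPT keyGen
  enc_qpt : IsQPT enc
  dec_qpt : IsQPT dec

namespace PseudoPad

/-- The ciphertext state `Enc(sk, x)`. -/
def ct (S : PseudoPad) (n : ℕ) (sk : Bits (S.κ n)) (x : Bits (S.ℓ n)) : Op (S.ℓ n * S.w n) :=
  (S.enc n).run (tensor (ketbra sk) (ketbra x))

/-- `Pr[x ← Dec(sk, ct) : sk ← KeyGen, ct ← Enc(sk, x)]`. -/
def correctProb (S : PseudoPad) (n : ℕ) (x : Bits (S.ℓ n)) : ℝ :=
  ∑ sk, (S.keyGen n).sample sk * (S.dec n).prob (tensor (ketbra sk) (S.ct n sk x)) x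

/-- `Pr[1 ← A(ct^{⊗t}) : sk ← KeyGen, ct ← Enc(sk, x)]`. -/
def acceptProb (S : PseudoPad) {K : AdviceKind} (t : Polynomial ℕ)
    (A : Adversary K (fun n => t.eval n * (S.ℓ n * S.w n)) (fun _ => 1))
    (n : ℕ) (x : Bits (S.ℓ n)) : ℝ :=
  ∑ sk, (S.keyGen n).sample sk *
    A.prob n (tensorPow (t.eval n) (S.ct n sk x)) (fun _ => true)

def Correct (S : PseudoPad) : Prop :=
  ∀ x : ∀ n, Bits (S.ℓ n), Negligible fun n => 1 - S.correctProb n (x n)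

def Secure (S : PseudoPad) (K : AdviceKind) : Prop :=
  ∀ (x₀ x₁ : ∀ n, Bits (S.ℓ n)) (t : Polynomial ℕ)
    (A : Adversary K (fun n => t.eval n * (S.ℓ n * S.w n)) (fun _ => 1)),
    Negligible fun n => |S.acceptProb t A n (x₀ n) - S.acceptProb t A n (x₁ n)|

end PseudoPad

/-- Quantum pseudo one-time pad schemes (with key length less than message length) exist. -/
def QPOTPExist (K : AdviceKind) : Prop :=
  ∃ S : PseudoPad, S.Correct ∧ S.Secure K

end

end QCrypto

namespace QCrypto

noncomputable section

open scoped ComplexOrder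

set_option linter.unusedSectionVars false

/-! ### Renaming the registers and arrays of a program -/

/-- Rename registers and arrays. -/
def Cmd.rename (f : ℕ → ℕ) : Cmd → Cmd
  | .const d n => .const (f d) n
  | .add d a b => .add (f d) (f a) (f b)
  | .sub d a b => .sub (f d) (f a) (f b)
  | .load d arr a => .load (f d) (f arr) (f a)
  | .store arr a s => .store (f arr) (f a) (f s)
  | .seq P Q => .seq (P.rename f) (Q.rename f)
  | .ite r P Q => .ite (f r) (P.rename f) (Q.rename f)
  | .loop r P => .loop (f r) (P.rename f)

/-- The store `S` contains a copy of `s` under the renaming `f`. -/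
def Store.Embeds (f : ℕ → ℕ) (s S : Store) : Prop :=
  (∀ r, S.reg (f r) = s.reg r) ∧ ∀ a, S.mem (f a) = s.mem a

/-- `S` and `S'` agree outside the range of `f`. -/
def Store.AgreeOff (f : ℕ → ℕ) (S S' : Store) : Prop :=
  (∀ r, r ∉ Set.range f → S'.reg r = S.reg r) ∧ ∀ a, a ∉ Set.range f → S'.mem a = S.mem a

theorem Store.AgreeOff.refl (f : ℕ → ℕ) (S : Store) : S.AgreeOff f S :=
  ⟨fun _ _ => rfl, fun _ _ => rfl⟩

theorem Store.AgreeOff.trans {f : ℕ → ℕ} {S S' S'' : Store} (h : S.AgreeOff f S')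
    (h' : S'.AgreeOff f S'') : S.AgreeOff f S'' :=
  ⟨fun r hr => (h'.1 r hr).trans (h.1 r hr), fun a ha => (h'.2 a ha).trans (h.2 a ha)⟩

theorem Store.Embeds.setReg {f : ℕ → ℕ} (hf : Function.Injective f) {s S : Store}
    (h : s.Embeds f S) (d v : ℕ) : (s.setReg d v).Embeds f (S.setReg (f d) v) := by
  refine ⟨fun r => ?_, h.2⟩
  by_cases hr : r = d
  · simp [Store.setReg, hr]
  · simp [Store.setReg, hr, hf.eq_iff, h.1 r]

theorem Store.AgreeOff.setReg (f : ℕ → ℕ) (S : Store) (d v : ℕ) :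
    S.AgreeOff f (S.setReg (f d) v) := by
  refine ⟨fun r hr => ?_, fun _ _ => rfl⟩
  have : r ≠ f d := fun h => hr ⟨d, h.symm⟩
  simp [Store.setReg, this]

theorem Exec.rename {f : ℕ → ℕ} (hf : Function.Injective f) {P : Cmd} {s s' : Store} {t : ℕ}
    (h : Exec P s t s') : ∀ S : Store, s.Embeds f S →
      ∃ S', Exec (P.rename f) S t S' ∧ s'.Embeds f S' ∧ S.AgreeOff f S' := by
  induction h with
  | const d n s =>
    exact fun S hS => ⟨_, .const _ _ _, hS.setReg hf d n, .setReg f S d n⟩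
  | add d a b s =>
    intro S hS
    refine ⟨_, .add _ _ _ _, ?_, .setReg f S d _⟩
    rw [hS.1, hS.1]
    exact hS.setReg hf d _
  | sub d a b s =>
    intro S hS
    refine ⟨_, .sub _ _ _ _, ?_, .setReg f S d _⟩
    rw [hS.1, hS.1]
    exact hS.setReg hf d _
  | load d arr a s =>
    intro S hS
    refine ⟨_, .load _ _ _ _, ?_, .setReg f S d _⟩
    rw [hS.1, hS.2]
    exact hS.setReg hf d _
  | store arr a r s =>
    intro S hS
    refine ⟨_, .store _ _ _ _, ⟨hS.1, fun b => ?_⟩, fun _ _ => rfl, fun b hb => ?_⟩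
    · by_cases hb : b = arr
      · simp [Store.setMem, hb, hS.1, hS.2]
      · simp [Store.setMem, hb, hf.eq_iff, hS.2]
    · have : b ≠ f arr := fun h => hb ⟨arr, h.symm⟩
      simp [Store.setMem, this]
  | seq _ _ ih ih' =>
    intro S hS
    obtain ⟨S', h1, h2, h3⟩ := ih S hS
    obtain ⟨S'', h1', h2', h3'⟩ := ih' S' h2
    exact ⟨S'', .seq h1 h1', h2', h3.trans h3'⟩
  | ite_true hr _ ih =>
    intro S hS
    obtain ⟨S', h1, h2, h3⟩ := ih S hS
    exact ⟨S', .ite_true (by rwa [hS.1]) h1, h2, h3⟩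
  | ite_false hr _ ih =>
    intro S hS
    obtain ⟨S', h1, h2, h3⟩ := ih S hS
    exact ⟨S', .ite_false (by rwa [hS.1]) h1, h2, h3⟩
  | loop_done hr =>
    exact fun S hS => ⟨S, .loop_done (by rwa [hS.1]), hS, .refl f S⟩
  | loop_step hr _ _ ih ih' =>
    intro S hS
    obtain ⟨S', h1, h2, h3⟩ := ih S hS
    obtain ⟨S'', h1', h2', h3'⟩ := ih' S' h2
    exact ⟨S'', .loop_step (by rwa [hS.1]) h1 h1', h2', h3.trans h3'⟩

/-! ### Generators: a small language for lists -/

/-- Arithmetic expressions over variables and a number of lists (called files). -/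
inductive Ex : Type
  | const (c : ℕ) : Ex
  | var (v : ℕ) : Ex
  | add (a b : Ex) : Ex
  | sub (a b : Ex) : Ex
  | mul (a b : Ex) : Ex
  | look (k : ℕ) (a : Ex) : Ex
  | len (k : ℕ) : Ex

def Ex.eval (F : ℕ → List ℕ) (env : ℕ → ℕ) : Ex → ℕ
  | .const c => c
  | .var v => env v
  | .add a b => a.eval F env + b.eval F env
  | .sub a b => a.eval F env - b.eval F env
  | .mul a b => a.eval F env * b.eval F env
  | .look k a => (F k).getD (a.eval F env) 0
  | .len k => (F k).length

/-- Generators of lists. -/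
inductive Gen : Type
  | emit (a : Ex) : Gen
  | seq (G H : Gen) : Gen
  | ite (a : Ex) (G H : Gen) : Gen
  | rep (v : ℕ) (a : Ex) (G : Gen) : Gen

def Gen.eval (F : ℕ → List ℕ) : Gen → (ℕ → ℕ) → List ℕ
  | .emit a, env => [a.eval F env]
  | .seq G H, env => G.eval F env ++ H.eval F env
  | .ite a G H, env => if a.eval F env ≠ 0 then G.eval F env else H.eval F env
  | .rep v a G, env =>
      (List.range (a.eval F env)).flatMap fun i => G.eval F (Function.update env v i)

/-- The registers used by compiled generators: temporaries, variables, a register that stays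
`0`; and the copies of the registers of the programs that compute the files. -/
abbrev tmp (d : ℕ) : ℕ := Nat.pair 1 d
abbrev vr (v : ℕ) : ℕ := Nat.pair 2 v
abbrev zr : ℕ := Nat.pair 0 1
abbrev fileReg (k r : ℕ) : ℕ := Nat.pair (3 + k) r

theorem zero_eq_pair : (0 : ℕ) = Nat.pair 0 0 := rfl

def Ex.compile : Ex → ℕ → Cmd
  | .const c, d => .const (tmp d) c
  | .var v, d => .add (tmp d) (vr v) zr
  | .add a b, d => .seq (a.compile d) (.seq (b.compile (d + 1))
      (.add (tmp d) (tmp d) (tmp (d + 1))))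
  | .sub a b, d => .seq (a.compile d) (.seq (b.compile (d + 1))
      (.sub (tmp d) (tmp d) (tmp (d + 1))))
  | .mul a b, d => .seq (a.compile d) (.seq (b.compile (d + 1))
      (.seq (.const (tmp (d + 2)) 0) (.seq (.const (tmp (d + 3)) 1)
        (.seq (.loop (tmp (d + 1)) (.seq (.add (tmp (d + 2)) (tmp (d + 2)) (tmp d))
          (.sub (tmp (d + 1)) (tmp (d + 1)) (tmp (d + 3)))))
          (.add (tmp d) (tmp (d + 2)) zr)))))
  | .look k a, d => .seq (a.compile d) (.seq (.sub (tmp (d + 1)) (fileReg k 0) (tmp d))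
      (.ite (tmp (d + 1)) (.load (tmp d) (fileReg k 0) (tmp d)) (.const (tmp d) 0)))
  | .len k, d => .add (tmp d) (fileReg k 0) zr

def Gen.compile : Gen → ℕ → Cmd
  | .emit a, d => .seq (a.compile d) (.seq (.store 0 0 (tmp d))
      (.seq (.const (tmp d) 1) (.add 0 0 (tmp d))))
  | .seq G H, d => .seq (G.compile d) (H.compile d)
  | .ite a G H, d => .seq (a.compile d) (.ite (tmp d) (G.compile d) (H.compile d))
  | .rep v a G, d => .seq (a.compile d) (.seq (.add (tmp (d + 1)) (vr v) zr)
      (.seq (.const (vr v) 0)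
        (.seq (.loop (tmp d) (.seq (G.compile (d + 2)) (.seq (.const (tmp (d + 2)) 1)
          (.seq (.add (vr v) (vr v) (tmp (d + 2))) (.sub (tmp d) (tmp d) (tmp (d + 2)))))))
          (.add (vr v) (tmp (d + 1)) zr))))

/-- The store holds the files and the values of the variables. -/
structure Store.Holds (F : ℕ → List ℕ) (env : ℕ → ℕ) (s : Store) : Prop where
  var : ∀ v, s.reg (vr v) = env v
  zero : s.reg zr = 0
  len : ∀ k, s.reg (fileReg k 0) = (F k).length
  file : ∀ k i, i < (F k).length → s.mem (fileReg k 0) i = (F k).getD i 0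

/-- `s` and `s'` agree except for temporaries from `d` on. -/
structure Store.Keeps (d : ℕ) (s s' : Store) : Prop where
  mem : s'.mem = s.mem
  reg : ∀ r, (∀ i, d ≤ i → r ≠ tmp i) → s'.reg r = s.reg r

theorem Store.Keeps.mono {d d' : ℕ} {s s' : Store} (h : s.Keeps d' s') (hd : d ≤ d') :
    s.Keeps d s' :=
  ⟨h.mem, fun r hr => h.reg r fun i hi => hr i (hd.trans hi)⟩

theorem Store.Keeps.trans {d : ℕ} {s s' s'' : Store} (h : s.Keeps d s')
    (h' : s'.Keeps d s'') : s.Keeps d s'' :=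
  ⟨h'.mem.trans h.mem, fun r hr => (h'.reg r hr).trans (h.reg r hr)⟩

theorem Store.keeps_setReg (s : Store) {d i : ℕ} (v : ℕ) (hi : d ≤ i) :
    s.Keeps d (s.setReg (tmp i) v) :=
  ⟨rfl, fun r hr => by simp [Store.setReg, hr i hi]⟩

theorem Store.Keeps.tmp {d i : ℕ} {s s' : Store} (h : s.Keeps d s') (hi : i < d) :
    s'.reg (tmp i) = s.reg (QCrypto.tmp i) :=
  h.reg _ fun j hj => by simp [Nat.pair_eq_pair]; omega

theorem Store.Holds.keeps {F : ℕ → List ℕ} {env : ℕ → ℕ} {d : ℕ} {s s' : Store}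
    (h : s.Holds F env) (hk : s.Keeps d s') : s'.Holds F env where
  var v := by rw [hk.reg _ (by simp [Nat.pair_eq_pair]), h.var]
  zero := by rw [hk.reg _ (by simp [Nat.pair_eq_pair]), h.zero]
  len k := by rw [hk.reg _ (by intro i _; simp [Nat.pair_eq_pair]; omega), h.len]
  file k i hi := by rw [hk.mem, h.file k i hi]

/-- Execution within a time bound. -/
def ExecWithin (P : Cmd) (s : Store) (T : ℕ) (s' : Store) : Prop := ∃ t ≤ T, Exec P s t s'

theorem ExecWithin.seq {P Q : Cmd} {s s' s'' : Store} {T T' : ℕ} (h : ExecWithin P s T s')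
    (h' : ExecWithin Q s' T' s'') : ExecWithin (.seq P Q) s (T + T') s'' := by
  obtain ⟨t, ht, h⟩ := h
  obtain ⟨t', ht', h'⟩ := h'
  exact ⟨t + t', by omega, .seq h h'⟩

theorem ExecWithin.mono {P : Cmd} {s s' : Store} {T T' : ℕ} (h : ExecWithin P s T s')
    (hT : T ≤ T') : ExecWithin P s T' s' := by
  obtain ⟨t, ht, h⟩ := h
  exact ⟨t, ht.trans hT, h⟩

theorem Exec.within {P : Cmd} {s s' : Store} {t : ℕ} (h : Exec P s t s') :
    ExecWithin P s t s' := ⟨t, le_rfl, h⟩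

/-- A loop whose counter decreases by one in each round. -/
theorem ExecWithin.loop {P : Cmd} {r T : ℕ} (I : ℕ → Store → Prop)
    (hr : ∀ m s, I m s → s.reg r = m)
    (hstep : ∀ m s, I (m + 1) s → ∃ s', ExecWithin P s T s' ∧ I m s') :
    ∀ m s, I m s → ∃ s', ExecWithin (.loop r P) s (m * (T + 1) + 1) s' ∧ I 0 s' := by
  intro m
  induction m with
  | zero => exact fun s hs => ⟨s, ⟨1, by omega, .loop_done (hr 0 s hs)⟩, hs⟩
  | succ m ih =>
    intro s hs
    obtain ⟨s', ⟨t, ht, h1⟩, hI⟩ := hstep m s hs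
    obtain ⟨s'', ⟨t', ht', h2⟩, hI'⟩ := ih s' hI
    refine ⟨s'', ⟨t + t' + 1, ?_, .loop_step (by rw [hr _ s hs]; omega) h1 h2⟩, hI'⟩
    nlinarith

/-- All values of variables, entries and lengths of files are at most `B`. -/
structure BoundedBy (F : ℕ → List ℕ) (env : ℕ → ℕ) (B : ℕ) : Prop where
  var : ∀ v, env v ≤ B
  len : ∀ k, (F k).length ≤ B
  file : ∀ k i, (F k).getD i 0 ≤ B

theorem Ex.exists_bound (e : Ex) : ∃ p : Polynomial ℕ, ∀ F env B, BoundedBy F env B →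
    e.eval F env ≤ p.eval B := by
  induction e with
  | const c => exact ⟨.C c, fun F env B _ => by simp [Ex.eval]⟩
  | var v => exact ⟨.X, fun F env B h => by simpa [Ex.eval] using h.var v⟩
  | add a b iha ihb =>
    obtain ⟨p, hp⟩ := iha
    obtain ⟨q, hq⟩ := ihb
    exact ⟨p + q, fun F env B h => by
      simpa [Ex.eval] using add_le_add (hp F env B h) (hq F env B h)⟩
  | sub a b iha ihb =>
    obtain ⟨p, hp⟩ := iha
    exact ⟨p, fun F env B h => (Nat.sub_le _ _).trans (hp F env B h)⟩
  | mul a b iha ihb =>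
    obtain ⟨p, hp⟩ := iha
    obtain ⟨q, hq⟩ := ihb
    exact ⟨p * q, fun F env B h => by
      simpa [Ex.eval] using Nat.mul_le_mul (hp F env B h) (hq F env B h)⟩
  | look k a _ => exact ⟨.X, fun F env B h => by simpa [Ex.eval] using h.file k _⟩
  | len k => exact ⟨.X, fun F env B h => by simpa [Ex.eval] using h.len k⟩

@[simp] theorem Store.setReg_reg (s : Store) (d v r : ℕ) :
    (s.setReg d v).reg r = if r = d then v else s.reg r := by
  simp [Store.setReg, Function.update_apply]

@[simp] theorem Store.setReg_mem (s : Store) (d v : ℕ) : (s.setReg d v).mem = s.mem := rfl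

theorem Ex.exec_compile (e : Ex) : ∃ p : Polynomial ℕ, ∀ F env B d s, BoundedBy F env B →
    s.Holds F env → ∃ s', ExecWithin (e.compile d) s (p.eval B) s' ∧ s.Keeps d s' ∧
      s'.reg (tmp d) = e.eval F env := by
  induction e with
  | const c =>
    refine ⟨1, fun F env B d s hB hs => ⟨_, (Exec.const _ _ _).within.mono (by simp),
      s.keeps_setReg _ le_rfl, by simp [Ex.eval]⟩⟩
  | var v =>
    refine ⟨1, fun F env B d s hB hs => ⟨_, (Exec.add _ _ _ _).within.mono (by simp),
      s.keeps_setReg _ le_rfl, by simp [Ex.eval, hs.var, hs.zero]⟩⟩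
  | len k =>
    refine ⟨1, fun F env B d s hB hs => ⟨_, (Exec.add _ _ _ _).within.mono (by simp),
      s.keeps_setReg _ le_rfl, by simp [Ex.eval, hs.len, hs.zero]⟩⟩
  | add a b iha ihb =>
    obtain ⟨p, hp⟩ := iha
    obtain ⟨q, hq⟩ := ihb
    refine ⟨p + (q + 1), fun F env B d s hB hs => ?_⟩
    obtain ⟨s1, h1, k1, v1⟩ := hp F env B d s hB hs
    obtain ⟨s2, h2, k2, v2⟩ := hq F env B (d + 1) s1 hB (hs.keeps k1)
    refine ⟨_, (h1.seq (h2.seq (Exec.add _ _ _ _).within)).mono (by simp),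
      k1.trans ((k2.mono (by omega)).trans (s2.keeps_setReg _ le_rfl)), ?_⟩
    simp [Ex.eval, v2, k2.tmp (Nat.lt_succ_self d), v1]
  | sub a b iha ihb =>
    obtain ⟨p, hp⟩ := iha
    obtain ⟨q, hq⟩ := ihb
    refine ⟨p + (q + 1), fun F env B d s hB hs => ?_⟩
    obtain ⟨s1, h1, k1, v1⟩ := hp F env B d s hB hs
    obtain ⟨s2, h2, k2, v2⟩ := hq F env B (d + 1) s1 hB (hs.keeps k1)
    refine ⟨_, (h1.seq (h2.seq (Exec.sub _ _ _ _).within)).mono (by simp),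
      k1.trans ((k2.mono (by omega)).trans (s2.keeps_setReg _ le_rfl)), ?_⟩
    simp [Ex.eval, v2, k2.tmp (Nat.lt_succ_self d), v1]
  | look k a iha =>
    obtain ⟨p, hp⟩ := iha
    refine ⟨p + (1 + 2), fun F env B d s hB hs => ?_⟩
    obtain ⟨s1, h1, k1, v1⟩ := hp F env B d s hB hs
    have hs1 := hs.keeps k1
    set s2 := s1.setReg (tmp (d + 1)) (s1.reg (fileReg k 0) - s1.reg (tmp d)) with hs2
    have k2 : s1.Keeps (d + 1) s2 := s1.keeps_setReg _ le_rfl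
    have hv : s2.reg (tmp (d + 1)) = (F k).length - a.eval F env := by
      simp [hs2, hs1.len, v1]
    have hd : s2.reg (tmp d) = a.eval F env := by rw [k2.tmp (Nat.lt_succ_self d), v1]
    have k12 : s.Keeps d s2 := k1.trans (k2.mono (by omega))
    by_cases hlt : a.eval F env < (F k).length
    · refine ⟨_, (h1.seq ((Exec.sub _ _ _ _).within.seq
        (Exec.ite_true (by rw [hv]; omega) (Exec.load _ _ _ _)).within)).mono (by simp),
        k12.trans (s2.keeps_setReg _ le_rfl), ?_⟩
      refine (Store.setReg_reg _ _ _ _).trans ?_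
      rw [if_pos rfl, hd, (hs.keeps k12).file k _ hlt, Ex.eval]
    · refine ⟨_, (h1.seq ((Exec.sub _ _ _ _).within.seq
        (Exec.ite_false (by rw [hv]; omega) (Exec.const _ _ _)).within)).mono (by simp),
        k12.trans (s2.keeps_setReg _ le_rfl), ?_⟩
      simp only [Store.setReg_reg, Ex.eval, if_true]
      rw [List.getD_eq_default _ _ (by omega)]
  | mul a b iha ihb =>
    obtain ⟨p, hp⟩ := iha
    obtain ⟨q, hq⟩ := ihb
    obtain ⟨m, hm⟩ := b.exists_bound
    refine ⟨p + (q + (1 + (1 + ((m * 3 + 1) + 1)))), fun F env B d s hB hs => ?_⟩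
    obtain ⟨s1, h1, k1, v1⟩ := hp F env B d s hB hs
    obtain ⟨s2, h2, k2, v2⟩ := hq F env B (d + 1) s1 hB (hs.keeps k1)
    set s3 := s2.setReg (tmp (d + 2)) 0 with hs3
    set s4 := s3.setReg (tmp (d + 3)) 1 with hs4
    have k4 : s.Keeps d s4 := k1.trans ((k2.mono (by omega)).trans
      ((s2.keeps_setReg _ (by omega)).trans (s3.keeps_setReg _ (by omega))))
    obtain ⟨s5, h5, i5⟩ := ExecWithin.loop (r := tmp (d + 1)) (T := 2)
      (P := .seq (.add (tmp (d + 2)) (tmp (d + 2)) (tmp d))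
          (.sub (tmp (d + 1)) (tmp (d + 1)) (tmp (d + 3))))
      (fun c x => s.Keeps d x ∧ x.reg (tmp (d + 1)) = c ∧ x.reg (tmp (d + 3)) = 1 ∧
        x.reg (tmp d) = a.eval F env ∧
        x.reg (tmp (d + 2)) + a.eval F env * c = a.eval F env * b.eval F env)
      (fun c x h => h.2.1) (by
        rintro c x ⟨hk, hc, ho, ha, hp⟩
        refine ⟨_, (Exec.add _ _ _ _).within.seq (Exec.sub _ _ _ _).within,
          hk.trans ((x.keeps_setReg _ (by omega)).trans (Store.keeps_setReg _ _ (by omega))),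
          ?_, ?_, ?_, ?_⟩
        · simp [Nat.pair_eq_pair, hc, ho]
        · simp [Nat.pair_eq_pair, ho]
        · simp [Nat.pair_eq_pair, ha]
        · simp [Nat.pair_eq_pair, ha, ← hp]; ring) (b.eval F env) s4 (by
        refine ⟨k4, ?_, ?_, ?_, ?_⟩
        · simp [hs4, hs3, Nat.pair_eq_pair, v2]
        · simp [hs4, hs3]
        · simp [hs4, hs3, Nat.pair_eq_pair, k2.tmp (Nat.lt_succ_self d), v1]
        · simp [hs4, hs3, Nat.pair_eq_pair])
    obtain ⟨k5, -, -, -, v5⟩ := i5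
    refine ⟨_, (h1.seq (h2.seq ((Exec.const _ _ _).within.seq ((Exec.const _ _ _).within.seq
      (h5.seq (Exec.add _ _ _ _).within))))).mono ?_, k5.trans (s5.keeps_setReg _ le_rfl), ?_⟩
    · have := hm F env B hB
      simp
      omega
    · simpa [Ex.eval, (hs.keeps k5).zero] using v5

/-- `s'` arises from `s` by appending `l` to the output (array `0`, length in register `0`);
temporaries from `d` on may change. -/
structure Store.Appends (d : ℕ) (l : List ℕ) (s s' : Store) : Prop where
  reg : ∀ r, r ≠ 0 → (∀ i, d ≤ i → r ≠ tmp i) → s'.reg r = s.reg r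
  mem : ∀ a, a ≠ 0 → s'.mem a = s.mem a
  out : s'.reg 0 = s.reg 0 + l.length
  old : ∀ i, i < s.reg 0 → s'.mem 0 i = s.mem 0 i
  new : ∀ i, i < l.length → s'.mem 0 (s.reg 0 + i) = l.getD i 0

theorem Store.Appends.trans {d : ℕ} {l l' : List ℕ} {s s' s'' : Store}
    (h : s.Appends d l s') (h' : s'.Appends d l' s'') : s.Appends d (l ++ l') s'' where
  reg r h0 hr := (h'.reg r h0 hr).trans (h.reg r h0 hr)
  mem a ha := (h'.mem a ha).trans (h.mem a ha)
  out := by rw [h'.out, h.out, List.length_append, add_assoc]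
  old i hi := (h'.old i (by rw [h.out]; omega)).trans (h.old i hi)
  new i hi := by
    by_cases hl : i < l.length
    · rw [h'.old _ (by rw [h.out]; omega), h.new i hl, List.getD_append _ _ _ _ hl]
    · obtain ⟨j, rfl⟩ := Nat.exists_eq_add_of_le (not_lt.mp hl)
      rw [← add_assoc, ← h.out, h'.new j (by simpa using hi),
        List.getD_append_right _ _ _ _ (by omega)]
      simp

theorem Store.Appends.mono {d d' : ℕ} {l : List ℕ} {s s' : Store} (h : s.Appends d' l s')
    (hd : d ≤ d') : s.Appends d l s' :=
  ⟨fun r h0 hr => h.reg r h0 fun i hi => hr i (hd.trans hi), h.mem, h.out, h.old, h.new⟩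

theorem tmp_ne_zero (i : ℕ) : tmp i ≠ 0 := by
  rw [zero_eq_pair]; simp [Nat.pair_eq_pair]

theorem vr_ne_zero (i : ℕ) : vr i ≠ 0 := by
  rw [zero_eq_pair]; simp [Nat.pair_eq_pair]

theorem fileReg_ne_zero (k i : ℕ) : fileReg k i ≠ 0 := by
  rw [zero_eq_pair]; simp [Nat.pair_eq_pair]

theorem zr_ne_zero : zr ≠ 0 := by
  rw [zero_eq_pair]; simp [Nat.pair_eq_pair]

theorem Store.Keeps.appends {d : ℕ} {s s' : Store} (h : s.Keeps d s') : s.Appends d [] s' where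
  reg r _ hr := h.reg r hr
  mem a _ := by rw [h.mem]
  out := by simpa using h.reg 0 fun i _ => (tmp_ne_zero i).symm
  old i _ := by rw [h.mem]
  new i hi := by simp at hi

theorem Store.Appends.tmp {d i : ℕ} {l : List ℕ} {s s' : Store} (h : s.Appends d l s')
    (hi : i < d) : s'.reg (tmp i) = s.reg (QCrypto.tmp i) :=
  h.reg _ (tmp_ne_zero i) fun j hj => by simp [Nat.pair_eq_pair]; omega

theorem Store.Holds.appends {F : ℕ → List ℕ} {env : ℕ → ℕ} {d : ℕ} {l : List ℕ} {s s' : Store}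
    (h : s.Holds F env) (hk : s.Appends d l s') : s'.Holds F env where
  var v := by rw [hk.reg _ (vr_ne_zero v) (by simp [Nat.pair_eq_pair]), h.var]
  zero := by rw [hk.reg _ zr_ne_zero (by simp [Nat.pair_eq_pair]), h.zero]
  len k := by
    rw [hk.reg _ (fileReg_ne_zero k 0) (by intro i _; simp [Nat.pair_eq_pair]; omega), h.len]
  file k i hi := by rw [hk.mem _ (fileReg_ne_zero k 0), h.file k i hi]

theorem Store.Appends.setVar {d : ℕ} {l : List ℕ} {s s' : Store} (h : s.Appends d l s')
    (v a : ℕ) : (s.setReg (vr v) a).Appends d l (s'.setReg (vr v) a) where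
  reg r h0 hr := by
    simp only [Store.setReg_reg]
    split_ifs
    · rfl
    · exact h.reg r h0 hr
  mem b hb := h.mem b hb
  out := by simpa [(vr_ne_zero v).symm] using h.out
  old i hi := h.old i (by simpa [(vr_ne_zero v).symm] using hi)
  new i hi := by simpa [(vr_ne_zero v).symm] using h.new i hi

theorem Store.setReg_setReg (s : Store) (r a b : ℕ) :
    (s.setReg r a).setReg r b = s.setReg r b := by
  simp [Store.setReg]

theorem Store.setReg_self (s : Store) (r : ℕ) : s.setReg r (s.reg r) = s := by
  simp [Store.setReg]

theorem Store.Holds.setVar {F : ℕ → List ℕ} {env : ℕ → ℕ} {s : Store} (h : s.Holds F env)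
    (v a : ℕ) : (s.setReg (vr v) a).Holds F (Function.update env v a) where
  var w := by
    by_cases hw : w = v
    · simp [hw]
    · simp [hw, Nat.pair_eq_pair, h.var]
  zero := by simp [Nat.pair_eq_pair, h.zero]
  len k := by
    have : (3 + k) ≠ 2 := by omega
    simp [Nat.pair_eq_pair, this, h.len]
  file k i hi := h.file k i hi

theorem BoundedBy.mono {F : ℕ → List ℕ} {env : ℕ → ℕ} {B B' : ℕ} (h : BoundedBy F env B)
    (hB : B ≤ B') : BoundedBy F env B' :=
  ⟨fun v => (h.var v).trans hB, fun k => (h.len k).trans hB, fun k i => (h.file k i).trans hB⟩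

theorem BoundedBy.update {F : ℕ → List ℕ} {env : ℕ → ℕ} {B : ℕ} (h : BoundedBy F env B)
    (v : ℕ) {a : ℕ} (ha : a ≤ B) : BoundedBy F (Function.update env v a) B := by
  refine ⟨fun w => ?_, h.len, h.file⟩
  by_cases hw : w = v
  · simpa [hw] using ha
  · simpa [hw] using h.var w

theorem Gen.exec_compile (G : Gen) : ∃ p : Polynomial ℕ, ∀ F env B d s, BoundedBy F env B →
    s.Holds F env → ∃ s', ExecWithin (G.compile d) s (p.eval B) s' ∧
      s.Appends d (G.eval F env) s' := by
  induction G with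
  | emit a =>
    obtain ⟨p, hp⟩ := a.exec_compile
    refine ⟨p + (1 + (1 + 1)), fun F env B d s hB hs => ?_⟩
    obtain ⟨s1, h1, k1, v1⟩ := hp F env B d s hB hs
    refine ⟨_, (h1.seq ((Exec.store _ _ _ _).within.seq ((Exec.const _ _ _).within.seq
      (Exec.add _ _ _ _).within))).mono (by simp), ?_⟩
    have h0 : (0 : ℕ) ≠ tmp d := (tmp_ne_zero d).symm
    refine List.nil_append (Gen.eval F (.emit a) env) ▸ k1.appends.trans
      ⟨fun r h0 hr => ?_, fun b hb => ?_, ?_, fun i hi => ?_, fun i hi => ?_⟩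
    · simp [h0, hr d le_rfl, Store.setMem]
    · simp [Store.setMem, hb]
    · simp [h0, Gen.eval, Store.setMem]
    · simp [Store.setMem, hi.ne]
    · have : i = 0 := by simpa [Gen.eval] using hi
      subst this
      simp [Store.setMem, v1, Gen.eval]
  | seq G H ihG ihH =>
    obtain ⟨p, hp⟩ := ihG
    obtain ⟨q, hq⟩ := ihH
    refine ⟨p + q, fun F env B d s hB hs => ?_⟩
    obtain ⟨s1, h1, k1⟩ := hp F env B d s hB hs
    obtain ⟨s2, h2, k2⟩ := hq F env B d s1 hB (hs.appends k1)
    exact ⟨s2, (h1.seq h2).mono (by simp), k1.trans k2⟩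
  | ite a G H ihG ihH =>
    obtain ⟨p, hp⟩ := ihG
    obtain ⟨q, hq⟩ := ihH
    obtain ⟨m, hm⟩ := a.exec_compile
    refine ⟨m + (p + q + 1), fun F env B d s hB hs => ?_⟩
    obtain ⟨s0, h0, k0, v0⟩ := hm F env B d s hB hs
    by_cases ha : a.eval F env = 0
    · obtain ⟨s1, ⟨t, ht, h1⟩, k1⟩ := hq F env B d s0 hB (hs.keeps k0)
      refine ⟨s1, (h0.seq (Exec.ite_false (by rw [v0, ha]) h1).within).mono ?_, ?_⟩
      · simp
        omega
      · simpa [Gen.eval, ha] using k0.appends.trans k1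
    · obtain ⟨s1, ⟨t, ht, h1⟩, k1⟩ := hp F env B d s0 hB (hs.keeps k0)
      refine ⟨s1, (h0.seq (Exec.ite_true (by rwa [v0]) h1).within).mono ?_, ?_⟩
      · simp
        omega
      · simpa [Gen.eval, ha] using k0.appends.trans k1
  | rep v a G ih =>
    obtain ⟨p, hp⟩ := ih
    obtain ⟨q, hq⟩ := a.exec_compile
    obtain ⟨m, hm⟩ := a.exists_bound
    refine ⟨q + (1 + (1 + ((m * (p.comp (.X + m) + (1 + (1 + 1)) + 1) + 1) + 1))),
      fun F env B d s hB hs => ?_⟩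
    obtain ⟨s1, h1, k1, v1⟩ := hq F env B d s hB hs
    have hN := hm F env B hB
    set N := a.eval F env with hNdef
    set s2 := s1.setReg (tmp (d + 1)) (s1.reg (vr v) + s1.reg zr) with hs2
    have k2 : s.Keeps d s2 := k1.trans (s1.keeps_setReg _ (by omega))
    have hsave : s2.reg (tmp (d + 1)) = env v := by
      simp [hs2, (hs.keeps k1).zero, (hs.keeps k1).var]
    have hcount : s2.reg (tmp d) = N := by simp [hs2, Nat.pair_eq_pair, v1]
    let pre : ℕ → List ℕ := fun i =>
      (List.range i).flatMap fun i => G.eval F (Function.update env v i)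
    have hpre : ∀ i, pre (i + 1) = pre i ++ G.eval F (Function.update env v i) := fun i => by
      simp [pre, List.range_succ]
    obtain ⟨s4, h4, -, e4, -, f4, a4⟩ := ExecWithin.loop (r := tmp d)
      (T := (p.comp (.X + m)).eval B + (1 + (1 + 1)))
      (P := .seq (G.compile (d + 2)) (.seq (.const (tmp (d + 2)) 1)
          (.seq (.add (vr v) (vr v) (tmp (d + 2))) (.sub (tmp d) (tmp d) (tmp (d + 2))))))
      (fun c x => x.reg (tmp d) = c ∧ x.reg (tmp (d + 1)) = env v ∧ c ≤ N ∧
        x.Holds F (Function.update env v (N - c)) ∧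
        (s2.setReg (vr v) (N - c)).Appends d (pre (N - c)) x)
      (fun c x h => h.1) (by
        rintro c x ⟨hc, he, hle, hh, ha⟩
        have hB' : BoundedBy F (Function.update env v (N - (c + 1))) (B + m.eval B) :=
          (hB.mono (by omega)).update v (by omega)
        obtain ⟨x1, e1, a1⟩ := hp F _ _ (d + 2) x hB' hh
        have hh1 := hh.appends a1
        refine ⟨_, (ExecWithin.mono e1 (by simp)).seq ((Exec.const _ _ _).within.seq
          ((Exec.add _ _ _ _).within.seq (Exec.sub _ _ _ _).within)), ?_⟩
        set x2 := x1.setReg (tmp (d + 2)) 1 with hx2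
        have k2' : x1.Keeps (d + 2) x2 := x1.keeps_setReg _ le_rfl
        have a2 := ha.trans ((a1.trans k2'.appends).mono (by omega : d ≤ d + 2))
        have hv2 : x2.reg (vr v) + x2.reg (tmp (d + 2)) = N - c := by
          rw [(hh1.keeps k2').var]
          simp [hx2]
          omega
        rw [hv2]
        have ht2 : x2.reg (tmp d) = c + 1 := by
          rw [k2'.tmp (by omega), a1.tmp (by omega), hc]
        set x3 := x2.setReg (vr v) (N - c) with hx3
        have hx3d : x3.reg (tmp d) - x3.reg (tmp (d + 2)) = c := by
          have h3 : x3.reg (tmp d) = c + 1 := by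
            rw [hx3, Store.setReg_reg, if_neg (by simp [Nat.pair_eq_pair]), ht2]
          rw [h3]
          simp [hx3, Nat.pair_eq_pair, hx2]
        rw [hx3d]
        have h3 : x3.Holds F (Function.update env v (N - c)) := by
          simpa using (hh1.keeps k2').setVar v (N - c)
        have k3 : x3.Keeps d (x3.setReg (tmp d) c) := x3.keeps_setReg _ le_rfl
        refine ⟨by simp, ?_, by omega, h3.keeps k3, ?_⟩
        · simp only [Store.setReg_reg, hx3]
          rw [if_neg (by simp [Nat.pair_eq_pair]), if_neg (by simp [Nat.pair_eq_pair]),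
            k2'.tmp (by omega), a1.tmp (by omega), he]
        · have := (a2.setVar v (N - c)).trans k3.appends
          rw [Store.setReg_setReg] at this
          rw [show N - c = N - (c + 1) + 1 by omega, hpre]
          rw [show N - c = N - (c + 1) + 1 by omega] at this
          simpa using this) N (s2.setReg (vr v) 0) (by
        refine ⟨by simp [Nat.pair_eq_pair, hcount], by simp [Nat.pair_eq_pair, hsave],
          le_rfl, by simpa using (hs.keeps k2).setVar v 0, ?_⟩
        simpa [pre] using (Store.Keeps.appends (d := d) ⟨rfl, fun _ _ => rfl⟩))
    refine ⟨_, (h1.seq ((Exec.add _ _ _ _).within.seq ((Exec.const _ _ _).within.seq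
      (h4.seq (Exec.add _ _ _ _).within)))).mono ?_, ?_⟩
    · simp only [Polynomial.eval_add, Polynomial.eval_one, Polynomial.eval_mul]
      gcongr
    · have := a4.setVar v (env v)
      rw [Store.setReg_setReg, ← (hs.keeps k2).var v, Store.setReg_self] at this
      rw [e4, f4.zero, add_zero, ← (hs.keeps k2).var v]
      simpa [Gen.eval, pre] using k2.appends.trans this

/-- Run the programs that compute the files numbered below `K` on the input in register `0`. -/
def loadFiles (P : ℕ → Cmd) : ℕ → Cmd
  | 0 => .const zr 0
  | K + 1 => .seq (loadFiles P K)
      (.seq (.add (fileReg K 0) 0 zr) ((P K).rename (fileReg K)))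

theorem fileReg_injective (k : ℕ) : Function.Injective (fileReg k) := fun a b h => by
  simpa [Nat.pair_eq_pair] using h

theorem exec_loadFiles (P : ℕ → Cmd) (p : ℕ → Polynomial ℕ) (F : ℕ → ℕ → List ℕ) (K : ℕ)
    (hP : ∀ k < K, ∀ n, ∃ (t : ℕ) (s : Store),
      t ≤ (p k).eval n ∧ Exec (P k) (Store.init n) t s ∧ s.output = F k n) (n : ℕ) :
    ∃ S, ExecWithin (loadFiles P K) (Store.init n)
        (1 + ∑ k ∈ Finset.range K, (1 + (p k).eval n)) S ∧
      (∀ k < K, S.reg (fileReg k 0) = (F k n).length ∧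
        ∀ i < (F k n).length, S.mem (fileReg k 0) i = (F k n).getD i 0) ∧
      (∀ r, (∀ k < K, ∀ i, r ≠ fileReg k i) →
        S.reg r = (Store.init n).reg r ∧ S.mem r = (Store.init n).mem r) := by
  induction K with
  | zero =>
    refine ⟨_, (Exec.const _ _ _).within.mono (by simp), by simp, fun r _ => ⟨?_, rfl⟩⟩
    by_cases h : r = zr
    · simp [h, Store.init, zr_ne_zero]
    · simp [h]
  | succ K ih =>
    obtain ⟨S, h1, h2, h3⟩ := ih fun k hk => hP k (by omega)
    obtain ⟨t, s, ht, hs, ho⟩ := hP K (by omega) n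
    set S1 := S.setReg (fileReg K 0) (S.reg 0 + S.reg zr) with hS1
    have hn : S.reg 0 + S.reg zr = n := by
      rw [(h3 0 fun k _ i => (fileReg_ne_zero k i).symm).1,
        (h3 zr fun k _ i => by simp [Nat.pair_eq_pair]; omega).1]
      simp [Store.init, zr_ne_zero]
    have hfr : ∀ r, ∀ k < K, ∀ i, fileReg K r ≠ fileReg k i := fun r k hk i => by
      simp [Nat.pair_eq_pair]; omega
    have hemb : (Store.init n).Embeds (fileReg K) S1 := by
      refine ⟨fun r => ?_, fun a => ?_⟩
      · rw [hS1, Store.setReg_reg, hn, (h3 _ (hfr r)).1]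
        simp [Store.init, fileReg_ne_zero, (fileReg_injective K).eq_iff, -Nat.pair_eq_pair]
      · rw [hS1, Store.setReg_mem, (h3 _ (hfr a)).2]
        rfl
    obtain ⟨S2, e2, m2, a2⟩ := hs.rename (fileReg_injective K) S1 hemb
    have hlen : s.reg 0 = (F K n).length := by simp [← ho, Store.output]
    refine ⟨S2, (h1.seq ((Exec.add _ _ _ _).within.seq (e2.within.mono ht))).mono ?_, ?_, ?_⟩
    · rw [Finset.sum_range_succ, add_assoc]
    · intro k hk
      rcases Nat.lt_succ_iff_lt_or_eq.mp hk with hk | rfl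
      · have hne : fileReg k 0 ∉ Set.range (fileReg K) := by
          rintro ⟨r, hr⟩
          exact hfr r k hk 0 hr
        rw [a2.1 _ hne, a2.2 _ hne, hS1, Store.setReg_reg, if_neg fun h => hfr 0 k hk 0 h.symm]
        exact h2 k hk
      · rw [m2.1, m2.2, hlen]
        refine ⟨rfl, fun i hi => ?_⟩
        rw [← ho, Store.output, List.getD_eq_getElem _ _ (by simpa [hlen] using hi)]
        simp
    · intro r hr
      have hne : r ∉ Set.range (fileReg K) := by
        rintro ⟨i, rfl⟩
        exact hr K (by omega) i rfl
      rw [a2.1 _ hne, a2.2 _ hne, hS1, Store.setReg_reg, if_neg (hr K (by omega) 0)]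
      exact h3 r fun k hk => hr k (by omega)

/-- Variable `0` of a generator is the input, the other variables are initially `0`. -/
def initEnv (n : ℕ) : ℕ → ℕ := fun v => if v = 0 then n else 0

/-- The list generated from files that are computed in polynomial time and have polynomially
bounded entries is computed in polynomial time. -/
theorem Gen.polyTime (G : Gen) (F : ℕ → ℕ → List ℕ) (K : ℕ) (hF : ∀ k < K, PolyTime (F k))
    (hK : ∀ k, K ≤ k → ∀ n, F k n = []) (q : Polynomial ℕ)
    (hlen : ∀ k n, (F k n).length ≤ q.eval n) (hent : ∀ k n, ∀ x ∈ F k n, x ≤ q.eval n) :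
    PolyTime fun n => G.eval (fun k => F k n) (initEnv n) := by
  have : Nonempty Cmd := ⟨.const 0 0⟩
  choose! P p hP using hF
  obtain ⟨g, hg⟩ := G.exec_compile
  refine ⟨.seq (loadFiles P K) (.seq (.add (vr 0) 0 zr) (.seq (.const 0 0) (G.compile 0))),
    1 + ∑ k ∈ Finset.range K, (1 + p k) + (1 + (1 + g.comp (q + .X))), fun n => ?_⟩
  obtain ⟨S, h1, h2, h3⟩ := exec_loadFiles P p F K hP n
  have hz : S.reg zr = 0 := by
    rw [(h3 zr fun k _ i => by simp [Nat.pair_eq_pair]; omega).1]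
    simp [Store.init, zr_ne_zero]
  have h0 : S.reg 0 = n := by
    rw [(h3 0 fun k _ i => (fileReg_ne_zero k i).symm).1]
    simp [Store.init]
  set S2 := (S.setReg (vr 0) (S.reg 0 + S.reg zr)).setReg 0 0 with hS2
  have hB : BoundedBy (fun k => F k n) (initEnv n) ((q + .X).eval n) := by
    refine ⟨fun v => ?_, fun k => ?_, fun k i => ?_⟩
    · simp only [initEnv, Polynomial.eval_add, Polynomial.eval_X]
      split_ifs <;> omega
    · simpa using (hlen k n).trans (Nat.le_add_right _ _)
    · by_cases hi : i < (F k n).length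
      · rw [List.getD_eq_getElem _ _ hi]
        simpa using (hent k n _ (List.getElem_mem hi)).trans (Nat.le_add_right _ _)
      · rw [List.getD_eq_default _ _ (by omega)]
        exact Nat.zero_le _
  have hne : ∀ k i v, fileReg k i ≠ vr v := fun k i v => by simp [Nat.pair_eq_pair]; omega
  have hH : S2.Holds (fun k => F k n) (initEnv n) := by
    refine ⟨fun v => ?_, ?_, fun k => ?_, fun k i hi => ?_⟩
    · rw [hS2, Store.setReg_reg, if_neg (vr_ne_zero v), Store.setReg_reg, h0, hz]
      by_cases hv : v = 0
      · simp [hv, initEnv]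
      · rw [if_neg (by simp [Nat.pair_eq_pair, hv]),
          (h3 _ fun k _ i => (hne k i v).symm).1]
        simp [initEnv, hv, Store.init, vr_ne_zero]
    · rw [hS2, Store.setReg_reg, if_neg zr_ne_zero, Store.setReg_reg,
        if_neg (by simp [Nat.pair_eq_pair]), hz]
    · rw [hS2, Store.setReg_reg, if_neg (fileReg_ne_zero k 0), Store.setReg_reg,
        if_neg (hne k 0 0)]
      by_cases hk : k < K
      · exact (h2 k hk).1
      · rw [(h3 _ fun k' hk' i => by simp [Nat.pair_eq_pair]; omega).1, hK k (by omega)]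
        simp [Store.init, fileReg_ne_zero]
    · have hk : k < K := by
        by_contra hk
        simp [hK k (by omega)] at hi
      exact (h2 k hk).2 i hi
  obtain ⟨S3, h4, h5⟩ := hg _ _ _ 0 S2 hB hH
  obtain ⟨t, ht, hex⟩ := h1.seq ((Exec.add (vr 0) 0 zr S).within.seq
    ((Exec.const 0 0 _).within.seq h4))
  refine ⟨t, S3, ht.trans ?_, hex, ?_⟩
  · simp [Polynomial.eval_finsetSum]
  · have hout := h5.out
    have hnew := h5.new
    have : S2.reg 0 = 0 := by simp [hS2]
    rw [this, zero_add] at hout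
    simp only [this, zero_add] at hnew
    refine List.ext_getElem (by simp [Store.output, hout]) fun i hi hi' => ?_
    rw [← List.getD_eq_getElem _ 0 hi', ← hnew i hi']
    simp [Store.output]

/-! ### Gate lists on arbitrary wires -/

/-- Operators on qubits labelled by `α`. -/
abbrev QOp (α : Type) : Type := Matrix (α → Bool) (α → Bool) ℂ

/-- Relabel the wires of a gate. -/
def Gate.map {ι κ : Type} (f : κ ↪ ι) : Gate κ → Gate ι
  | .H i => .H (f i)
  | .T i => .T (f i)
  | .X i => .X (f i)
  | .CNOT c t h => .CNOT (f c) (f t) (f.injective.ne h)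
  | .Toffoli c d t h h' h'' =>
    .Toffoli (f c) (f d) (f t) (f.injective.ne h) (f.injective.ne h') (f.injective.ne h'')

section

variable {ι κ μ : Type} [Fintype ι] [DecidableEq ι] [Fintype κ] [DecidableEq κ]
  [Fintype μ] [DecidableEq μ]

/-- Apply a list of gates, the head of the list first. -/
def evo (gs : List (Gate ι)) (σ : QOp ι) : QOp ι :=
  gs.foldl (fun τ g => g.mat * τ * g.mat.conjTranspose) σ

@[simp] theorem evo_nil (σ : QOp ι) : evo [] σ = σ := rfl

@[simp] theorem evo_cons (g : Gate ι) (gs : List (Gate ι)) (σ : QOp ι) :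
    evo (g :: gs) σ = evo gs (g.mat * σ * g.mat.conjTranspose) := rfl

theorem evo_append (gs hs : List (Gate ι)) (σ : QOp ι) :
    evo (gs ++ hs) σ = evo hs (evo gs σ) := by
  simp [evo, List.foldl_append]

theorem evo_smul (gs : List (Gate ι)) (c : ℂ) (σ : QOp ι) : evo gs (c • σ) = c • evo gs σ := by
  induction gs generalizing σ with
  | nil => rfl
  | cons g gs ih => simp [← ih]

theorem evo_zero (gs : List (Gate ι)) : evo gs (0 : QOp ι) = 0 := by
  simpa using evo_smul gs 0 0

theorem evo_add (gs : List (Gate ι)) (σ τ : QOp ι) : evo gs (σ + τ) = evo gs σ + evo gs τ := by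
  induction gs generalizing σ τ with
  | nil => rfl
  | cons g gs ih => simp [← ih, mul_add, add_mul]

theorem evo_sum {J : Type*} (gs : List (Gate ι)) (s : Finset J) (σ : J → QOp ι) :
    evo gs (∑ j ∈ s, σ j) = ∑ j ∈ s, evo gs (σ j) := by
  classical
  induction s using Finset.induction_on with
  | empty => simp [evo_zero]
  | insert j s hj ih => simp [Finset.sum_insert hj, evo_add, ih]

/-- The block of an operator where the wires outside the range of `f` are fixed to `x` and
`y`. -/
def slice (f : κ ↪ ι) (x y : ι → Bool) (σ : QOp ι) : QOp κ :=
  σ.submatrix (fun u => Function.extend f u x) fun v => Function.extend f v y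

open scoped Classical in
/-- The operator acting as `M` on the wires in the range of `f`. -/
def liftMat (f : κ ↪ ι) (M : QOp κ) : QOp ι := fun x y =>
  if ∀ i, i ∉ Set.range f → x i = y i then M (x ∘ f) (y ∘ f) else 0

theorem extend_comp (f : κ ↪ ι) (u : κ → Bool) (x : ι → Bool) :
    Function.extend f u x ∘ f = u := by
  ext k
  simp [f.injective.extend_apply]

theorem extend_off (f : κ ↪ ι) (u : κ → Bool) (x : ι → Bool) {i : ι} (hi : i ∉ Set.range f) :
    Function.extend f u x i = x i :=
  Function.extend_apply' _ _ _ fun ⟨k, hk⟩ => hi ⟨k, hk⟩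

theorem extend_self (f : κ ↪ ι) (x : ι → Bool) : Function.extend f (x ∘ f) x = x := by
  ext i
  by_cases hi : i ∈ Set.range f
  · obtain ⟨k, rfl⟩ := hi
    simp [f.injective.extend_apply]
  · exact extend_off f _ _ hi

theorem eq_extend (f : κ ↪ ι) {z x : ι → Bool} (h : ∀ i, i ∉ Set.range f → x i = z i) :
    Function.extend f (z ∘ f) x = z := by
  ext i
  by_cases hi : i ∈ Set.range f
  · obtain ⟨k, rfl⟩ := hi
    simp [f.injective.extend_apply]
  · rw [extend_off f _ _ hi, h i hi]

theorem extend_injective (f : κ ↪ ι) (x : ι → Bool) :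
    Function.Injective fun u : κ → Bool => Function.extend f u x := fun u v h => by
  rw [← extend_comp f u x, ← extend_comp f v x]
  exact congrArg (· ∘ f) h

theorem extend_extend (f : κ ↪ ι) (u v : κ → Bool) (x : ι → Bool) :
    Function.extend f u (Function.extend f v x) = Function.extend f u x := by
  ext i
  by_cases hi : i ∈ Set.range f
  · obtain ⟨k, rfl⟩ := hi
    simp [f.injective.extend_apply]
  · simp [extend_off f _ _ hi]

theorem liftMat_mul_apply (f : κ ↪ ι) (M : QOp κ) (σ : QOp ι) (u : κ → Bool)
    (x w : ι → Bool) : (liftMat f M * σ) (Function.extend f u x) w =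
      ∑ v, M u v * σ (Function.extend f v x) w := by
  rw [Matrix.mul_apply]
  refine (Fintype.sum_of_injective _ (extend_injective f x) _ _ (fun z hz => ?_)
    fun v => ?_).symm
  · rw [liftMat, if_neg, zero_mul]
    intro h
    refine hz ⟨z ∘ f, eq_extend f fun i hi => ?_⟩
    rw [← h i hi, extend_off f _ _ hi]
  · rw [liftMat, if_pos, extend_comp, extend_comp]
    intro i hi
    rw [extend_off f _ _ hi, extend_off f _ _ hi]

theorem slice_lift (f : κ ↪ ι) (M : QOp κ) (σ : QOp ι) (x y : ι → Bool) :
    slice f x y (liftMat f M * σ * (liftMat f M).conjTranspose) =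
      M * slice f x y σ * M.conjTranspose := by
  have key : ∀ τ : QOp ι, slice f x y (liftMat f M * τ) = M * slice f x y τ := fun τ => by
    ext u v
    rw [slice, Matrix.submatrix_apply, liftMat_mul_apply, Matrix.mul_apply]
    rfl
  have key' : ∀ τ : QOp ι, slice f x y (τ * (liftMat f M).conjTranspose) =
      slice f x y τ * M.conjTranspose := fun τ => by
    ext u v
    have := liftMat_mul_apply f M τ.conjTranspose v y (Function.extend f u x)
    rw [slice, Matrix.submatrix_apply, ← Matrix.conjTranspose_conjTranspose τ,
      ← Matrix.conjTranspose_mul, Matrix.conjTranspose_apply, this, Matrix.mul_apply]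
    simp [slice, mul_comm]
  rw [key', key]

theorem update_eq_iff_range (f : κ ↪ ι) (x y : ι → Bool) (t : κ) (b : Bool) :
    x = Function.update y (f t) b ↔
      (∀ i, i ∉ Set.range f → x i = y i) ∧ x ∘ f = Function.update (y ∘ f) t b := by
  constructor
  · rintro rfl
    refine ⟨fun i hi => Function.update_of_ne (fun h => hi ⟨t, h.symm⟩) _ _, ?_⟩
    ext k
    by_cases hk : k = t
    · simp [hk]
    · simp [hk]
  · rintro ⟨h1, h2⟩
    ext i
    by_cases hi : i ∈ Set.range f
    · obtain ⟨k, rfl⟩ := hi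
      have := congrFun h2 k
      by_cases hk : k = t
      · simpa [hk] using this
      · simpa [hk] using this
    · rw [h1 i hi, Function.update_of_ne fun h => hi ⟨t, h.symm⟩]

theorem Gate.mat_map (f : κ ↪ ι) (g : Gate κ) : (g.map f).mat = liftMat f g.mat := by
  ext x y
  cases g with
  | H i =>
    have : (∀ j, j ≠ f i → x j = y j) ↔
        (∀ j, j ∉ Set.range f → x j = y j) ∧ ∀ k, k ≠ i → x (f k) = y (f k) := by
      refine ⟨fun h => ⟨fun j hj => h j fun e => hj ⟨i, e.symm⟩,
        fun k hk => h _ (f.injective.ne hk)⟩, fun h j hj => ?_⟩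
      by_cases hr : j ∈ Set.range f
      · obtain ⟨k, rfl⟩ := hr
        exact h.2 k fun e => hj (e ▸ rfl)
      · exact h.1 j hr
    simp only [Gate.map, Gate.mat, liftMat, Matrix.of_apply, this, Function.comp_apply, ite_and]
  | T i =>
    simp only [Gate.map, Gate.mat, liftMat, Matrix.diagonal_apply]
    by_cases h : x = y
    · simp [h]
    · rw [if_neg h]
      by_cases h1 : ∀ j, j ∉ Set.range f → x j = y j
      · rw [if_pos h1, if_neg]
        intro h2
        refine h ?_
        rw [← extend_self f x, h2]
        exact eq_extend f h1
      · rw [if_neg h1]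
  | X i =>
    simp only [Gate.map, Gate.mat, liftMat, Matrix.of_apply, update_eq_iff_range,
      Function.comp_apply, ite_and]
  | CNOT c t h =>
    simp only [Gate.map, Gate.mat, liftMat, Matrix.of_apply, update_eq_iff_range,
      Function.comp_apply, ite_and]
  | Toffoli c d t h h' h'' =>
    simp only [Gate.map, Gate.mat, liftMat, Matrix.of_apply, update_eq_iff_range,
      Function.comp_apply, ite_and]

theorem slice_evo (f : κ ↪ ι) (gs : List (Gate κ)) (σ : QOp ι) (x y : ι → Bool) :
    slice f x y (evo (gs.map (Gate.map f)) σ) = evo gs (slice f x y σ) := by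
  induction gs generalizing σ with
  | nil => rfl
  | cons g gs ih => rw [List.map_cons, evo_cons, evo_cons, ih, Gate.mat_map, slice_lift]

/-- Gates on the wires in the range of `f` act on one factor of a product. -/
theorem evo_factor (f : κ ↪ ι) (gs : List (Gate κ)) (σ τ : QOp ι) (α : QOp κ)
    (hσ : ∀ x y, σ x y = α (x ∘ f) (y ∘ f) * τ x y)
    (hτ : ∀ x y u v, τ (Function.extend f u x) (Function.extend f v y) = τ x y)
    (x y : ι → Bool) :
    evo (gs.map (Gate.map f)) σ x y = evo gs α (x ∘ f) (y ∘ f) * τ x y := by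
  have h : slice f x y σ = τ x y • α := by
    ext u v
    simp [slice, hσ, hτ, extend_comp, mul_comm]
  have := congrFun (congrFun (slice_evo f gs σ x y) (x ∘ f)) (y ∘ f)
  rw [slice, Matrix.submatrix_apply, extend_self, extend_self, h, evo_smul] at this
  rw [this, Matrix.smul_apply, smul_eq_mul, mul_comm]

/-! ### Classical gates -/

/-- The gates that permute the computational basis. -/
def Gate.IsClassical : Gate ι → Prop
  | .H _ => False
  | .T _ => False
  | _ => True

/-- The action of a classical gate on basis vectors. -/
def Gate.act : Gate ι → (ι → Bool) → ι → Bool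
  | .X i, x => Function.update x i (!x i)
  | .CNOT c t _, x => Function.update x t (xor (x t) (x c))
  | .Toffoli c d t _ _ _, x => Function.update x t (xor (x t) (x c && x d))
  | _, x => x

theorem Gate.act_act (g : Gate ι) (x : ι → Bool) : g.act (g.act x) = x := by
  cases g with
  | H i => rfl
  | T i => rfl
  | X i => simp [Gate.act]
  | CNOT c t h => simp [Gate.act, h]
  | Toffoli c d t h h' h'' => simp [Gate.act, h', h'']

theorem Gate.IsClassical.mat {g : Gate ι} (hg : g.IsClassical) (x y : ι → Bool) :
    g.mat x y = if x = g.act y then 1 else 0 := by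
  cases g <;> first | exact hg.elim | rfl

theorem Gate.IsClassical.conj_apply {g : Gate ι} (hg : g.IsClassical) (σ : QOp ι)
    (x y : ι → Bool) :
    (g.mat * σ * g.mat.conjTranspose) x y = σ (g.act x) (g.act y) := by
  have hact : ∀ a b : ι → Bool, a = g.act b ↔ b = g.act a := fun a b =>
    ⟨fun h => by rw [h, g.act_act], fun h => by rw [h, g.act_act]⟩
  simp [Matrix.mul_apply, Matrix.conjTranspose_apply, hg.mat, hact x, hact y]

theorem evo_classical (gs : List (Gate ι)) (h : ∀ g ∈ gs, g.IsClassical) (σ : QOp ι)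
    (x y : ι → Bool) :
    evo gs σ x y = σ (gs.foldr Gate.act x) (gs.foldr Gate.act y) := by
  induction gs generalizing σ with
  | nil => rfl
  | cons g gs ih =>
    rw [evo_cons, ih fun g' hg' => h g' (List.mem_cons_of_mem _ hg'),
      (h g List.mem_cons_self).conj_apply]
    rfl

/-- Exchange two wires. -/
def swapGates {ι : Type} (p q : ι) (h : p ≠ q) : List (Gate ι) :=
  [.CNOT p q h, .CNOT q p h.symm, .CNOT p q h]

theorem evo_swapGates (p q : ι) (h : p ≠ q) (σ : QOp ι) (x y : ι → Bool) :
    evo (swapGates p q h) σ x y = σ (x ∘ Equiv.swap p q) (y ∘ Equiv.swap p q) := by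
  have key : ∀ x : ι → Bool, (swapGates p q h).foldr Gate.act x = x ∘ Equiv.swap p q := by
    intro x
    ext i
    by_cases h1 : i = p
    · subst h1
      simp only [swapGates, Gate.act, List.foldr_cons, List.foldr_nil, Function.comp_apply,
        Function.update_self, Equiv.swap_apply_left, Function.update_of_ne h.symm,
        Function.update_of_ne h]
      cases x i <;> cases x q <;> rfl
    · by_cases h2 : i = q
      · subst h2
        simp [swapGates, Gate.act, h, h.symm]
      · simp [swapGates, Gate.act, h1, h2, Equiv.swap_apply_of_ne_of_ne]
  rw [evo_classical _ (by simp [swapGates, Gate.IsClassical]), key, key]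

/-- The permutation exchanging `p j` and `q j` for the entries `j` of a list. -/
def swapPerm {J : Type} (p q : J → ι) : List J → Equiv.Perm ι
  | [] => 1
  | j :: l => swapPerm p q l * Equiv.swap (p j) (q j)

theorem evo_swaps {J : Type} (p q : J → ι) (h : ∀ j, p j ≠ q j) (l : List J) (σ : QOp ι)
    (x y : ι → Bool) :
    evo (l.flatMap fun j => swapGates (p j) (q j) (h j)) σ x y =
      σ (x ∘ swapPerm p q l) (y ∘ swapPerm p q l) := by
  induction l generalizing σ with
  | nil => rfl
  | cons j l ih =>
    rw [List.flatMap_cons, evo_append, ih, evo_swapGates]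
    rfl

theorem swapPerm_of_ne {J : Type} (p q : J → ι) (l : List J) (i : ι)
    (h : ∀ j ∈ l, i ≠ p j ∧ i ≠ q j) : swapPerm p q l i = i := by
  induction l with
  | nil => rfl
  | cons j l ih =>
    have := h j List.mem_cons_self
    rw [swapPerm, Equiv.Perm.mul_apply, Equiv.swap_apply_of_ne_of_ne this.1 this.2,
      ih fun k hk => h k (List.mem_cons_of_mem _ hk)]

theorem swapPerm_apply {J : Type} (p q : J ↪ ι) (h : ∀ j k, p j ≠ q k) {l : List J}
    (hl : l.Nodup) {j : J} (hj : j ∈ l) :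
    swapPerm p q l (p j) = q j ∧ swapPerm p q l (q j) = p j := by
  induction l with
  | nil => simp at hj
  | cons k l ih =>
    rw [List.nodup_cons] at hl
    simp only [swapPerm, Equiv.Perm.mul_apply]
    by_cases hjk : j = k
    · subst hjk
      have hne : ∀ i ∈ l, i ≠ j := fun i hi e => hl.1 (e ▸ hi)
      rw [Equiv.swap_apply_left, Equiv.swap_apply_right,
        swapPerm_of_ne _ _ _ _ fun i hi => ⟨(h i j).symm, q.injective.ne (hne i hi).symm⟩,
        swapPerm_of_ne _ _ _ _ fun i hi => ⟨p.injective.ne (hne i hi).symm, h j i⟩]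
      exact ⟨rfl, rfl⟩
    · rw [Equiv.swap_apply_of_ne_of_ne (p.injective.ne hjk) (h j k),
        Equiv.swap_apply_of_ne_of_ne (h k j).symm (q.injective.ne hjk)]
      exact ih hl.2 ((List.mem_cons.mp hj).resolve_left hjk)

theorem swapPerm_involutive {J : Type} (p q : J ↪ ι) (h : ∀ j k, p j ≠ q k) {l : List J}
    (hl : l.Nodup) (i : ι) : swapPerm p q l (swapPerm p q l i) = i := by
  by_cases hp : ∃ j ∈ l, i = p j
  · obtain ⟨j, hj, rfl⟩ := hp
    rw [(swapPerm_apply p q h hl hj).1, (swapPerm_apply p q h hl hj).2]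
  · by_cases hq : ∃ j ∈ l, i = q j
    · obtain ⟨j, hj, rfl⟩ := hq
      rw [(swapPerm_apply p q h hl hj).2, (swapPerm_apply p q h hl hj).1]
    · push Not at hp hq
      rw [swapPerm_of_ne _ _ _ _ fun j hj => ⟨hp j hj, hq j hj⟩,
        swapPerm_of_ne _ _ _ _ fun j hj => ⟨hp j hj, hq j hj⟩]

/-! ### Partial trace and preparation of ancillas -/

/-- Partial trace over all wires outside the range of `f`. -/
def ptr (f : κ ↪ ι) (σ : QOp ι) : QOp κ :=
  ∑ g : ι → Bool with ∀ k, g (f k) = false, slice f g g σ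

open scoped Classical in
/-- Put an operator on the wires in the range of `f`, all others being in state `|0⟩`. -/
def prep (f : κ ↪ ι) (ρ : QOp κ) : QOp ι := fun x y =>
  if ∀ i, i ∉ Set.range f → x i = false ∧ y i = false then ρ (x ∘ f) (y ∘ f) else 0

theorem ptr_apply (f : κ ↪ ι) (σ : QOp ι) (u v : κ → Bool) : ptr f σ u v =
    ∑ g : ι → Bool with ∀ k, g (f k) = false, σ (Function.extend f u g) (Function.extend f v g) := by
  simp [ptr, Matrix.sum_apply, slice]

theorem ptr_evo (f : κ ↪ ι) (gs : List (Gate κ)) (σ : QOp ι) :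
    ptr f (evo (gs.map (Gate.map f)) σ) = evo gs (ptr f σ) := by
  simp [ptr, slice_evo, evo_sum]

theorem extend_trans (f : κ ↪ μ) (g : μ ↪ ι) (u : κ → Bool) (x : ι → Bool) :
    Function.extend (f.trans g) u x = Function.extend g (Function.extend f u (x ∘ g)) x := by
  ext i
  by_cases hi : i ∈ Set.range g
  · obtain ⟨m, rfl⟩ := hi
    rw [g.injective.extend_apply]
    by_cases hm : m ∈ Set.range f
    · obtain ⟨k, rfl⟩ := hm
      rw [f.injective.extend_apply]
      exact (f.trans g).injective.extend_apply _ _ _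
    · rw [extend_off f _ _ hm, extend_off]
      · rfl
      · rintro ⟨k, hk⟩
        exact hm ⟨k, g.injective hk⟩
  · rw [extend_off g _ _ hi, extend_off]
    rintro ⟨k, rfl⟩
    exact hi ⟨f k, rfl⟩

theorem ptr_trans (f : κ ↪ μ) (g : μ ↪ ι) (σ : QOp ι) :
    ptr (f.trans g) σ = ptr f (ptr g σ) := by
  ext u v
  simp only [ptr_apply]
  rw [← Finset.sum_product']
  refine Finset.sum_nbij' (fun x => (x ∘ g, Function.extend g (fun _ => false) x))
    (fun p => Function.extend g p.1 p.2) ?_ ?_ ?_ ?_ ?_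
  · intro x hx
    simpa [g.injective.extend_apply] using hx
  · rintro ⟨h, x⟩ hp
    simpa [g.injective.extend_apply] using (Finset.mem_product.mp hp).1
  · intro x hx
    simp [extend_extend, extend_self]
  · rintro ⟨h, x⟩ hp
    have hx : ∀ m, x (g m) = false := by simpa using (Finset.mem_product.mp hp).2
    simp only [extend_comp, extend_extend, Prod.mk.injEq, true_and]
    rw [← extend_self g x]
    simp only [extend_extend]
    congr 1
    ext m
    simp [hx]
  · intro x hx
    simp only [extend_trans, extend_extend]

theorem prep_trans (f : κ ↪ μ) (g : μ ↪ ι) (ρ : QOp κ) :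
    prep (f.trans g) ρ = prep g (prep f ρ) := by
  ext x y
  simp only [prep, Function.comp_apply]
  by_cases h : ∀ i, i ∉ Set.range (f.trans g) → x i = false ∧ y i = false
  · rw [if_pos h, if_pos, if_pos]
    · rfl
    · intro m hm
      refine h _ ?_
      rintro ⟨k, hk⟩
      exact hm ⟨k, g.injective hk⟩
    · intro i hi
      refine h _ ?_
      rintro ⟨k, rfl⟩
      exact hi ⟨f k, rfl⟩
  · rw [if_neg h]
    split_ifs with h1 h2
    · refine absurd (fun i hi => ?_) h
      by_cases hg : i ∈ Set.range g
      · obtain ⟨m, rfl⟩ := hg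
        refine h2 m ?_
        rintro ⟨k, rfl⟩
        exact hi ⟨k, rfl⟩
      · exact h1 i hg
    · rfl
    · rfl

theorem evo_prep (f : κ ↪ ι) (gs : List (Gate κ)) (ρ : QOp κ) :
    evo (gs.map (Gate.map f)) (prep f ρ) = prep f (evo gs ρ) := by
  classical
  ext x y
  rw [evo_factor f gs _ (fun x y => if ∀ i, i ∉ Set.range f → x i = false ∧ y i = false
    then 1 else 0) ρ]
  · simp [prep]
  · intro x y
    simp [prep]
  · intro x y u v
    refine if_congr ?_ rfl rfl
    refine forall₂_congr fun i hi => ?_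
    rw [extend_off f _ _ hi, extend_off f _ _ hi]

/-- Tracing out the wires of an operator prepared along `fP`, except those seen by `fQ`. -/
theorem ptr_prep_glue {α ιP ιQ : Type} [Fintype α] [DecidableEq α] [Fintype ιP]
    [DecidableEq ιP] [Fintype ιQ] [DecidableEq ιQ] (fP : ιP ↪ ι) (fQ : ιQ ↪ ι) (out : α ↪ ιP)
    (inp : α ↪ ιQ) (h1 : ∀ k, fQ (inp k) = fP (out k))
    (h2 : ∀ j, j ∉ Set.range inp → fQ j ∉ Set.range fP) (τ : QOp ιP) :
    ptr fQ (prep fP τ) = prep inp (ptr out τ) := by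
  classical
  have h3 : ∀ l, l ∉ Set.range out → fP l ∉ Set.range fQ := by
    rintro l hl ⟨j, hj⟩
    by_cases hjr : j ∈ Set.range inp
    · obtain ⟨k, rfl⟩ := hjr
      exact hl ⟨k, fP.injective ((h1 k).symm.trans hj)⟩
    · exact h2 j hjr ⟨l, hj.symm⟩
  have hcomp : ∀ (u : ιQ → Bool) (G : ι → Bool), (Function.extend fQ u G) ∘ fP =
      Function.extend out (u ∘ inp) (G ∘ fP) := by
    intro u G
    ext l
    by_cases hl : l ∈ Set.range out
    · obtain ⟨k, rfl⟩ := hl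
      rw [Function.comp_apply, ← h1, fQ.injective.extend_apply, out.injective.extend_apply]
      rfl
    · rw [Function.comp_apply, extend_off fQ _ _ (h3 l hl), extend_off out _ _ hl]
      rfl
  ext u v
  rw [ptr_apply]
  simp only [prep, hcomp]
  by_cases huv : ∀ j, j ∉ Set.range inp → u j = false ∧ v j = false
  · rw [if_pos huv, ptr_apply]
    have hcond : ∀ G : ι → Bool, (∀ i, i ∉ Set.range fP → Function.extend fQ u G i = false ∧
        Function.extend fQ v G i = false) ↔
        ∀ i, i ∉ Set.range fP → i ∉ Set.range fQ → G i = false := by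
      refine fun G => ⟨fun h i hP hQ => ?_, fun h i hP => ?_⟩
      · have := (h i hP).1
        rwa [extend_off fQ _ _ hQ] at this
      · by_cases hQ : i ∈ Set.range fQ
        · obtain ⟨j, rfl⟩ := hQ
          simp only [fQ.injective.extend_apply]
          refine huv j ?_
          rintro ⟨k, rfl⟩
          exact hP ⟨out k, (h1 k).symm⟩
        · rw [extend_off fQ _ _ hQ, extend_off fQ _ _ hQ]
          exact ⟨h i hP hQ, h i hP hQ⟩
    simp only [hcond]
    rw [← Finset.sum_filter, Finset.filter_filter]
    refine Finset.sum_nbij' (fun G => G ∘ fP)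
      (fun g => Function.extend fP g fun _ => false) ?_ ?_ ?_ ?_ ?_
    · intro G hG
      simp only [Finset.mem_filter, Finset.mem_univ, true_and, Function.comp_apply] at hG ⊢
      intro k
      rw [← h1]
      exact hG.1 _
    · intro g hg
      simp only [Finset.mem_filter, Finset.mem_univ, true_and] at hg ⊢
      refine ⟨fun j => ?_, fun i hP hQ => extend_off fP _ _ hP⟩
      by_cases hj : j ∈ Set.range inp
      · obtain ⟨k, rfl⟩ := hj
        rw [h1, fP.injective.extend_apply, hg]
      · exact extend_off fP _ _ (h2 j hj)
    · intro G hG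
      simp only [Finset.mem_filter, Finset.mem_univ, true_and] at hG
      refine eq_extend fP fun i hP => ?_
      by_cases hQ : i ∈ Set.range fQ
      · obtain ⟨j, rfl⟩ := hQ
        exact (hG.1 j).symm
      · exact (hG.2 i hP hQ).symm
    · intro g hg
      exact extend_comp fP _ _
    · intro G hG
      rfl
  · rw [if_neg huv]
    refine Finset.sum_eq_zero fun G _ => if_neg fun h => huv fun j hj => ?_
    simpa [fQ.injective.extend_apply] using h (fQ j) (h2 j hj)

theorem ptr_refl (σ : QOp κ) : ptr (Function.Embedding.refl κ) σ = σ := by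
  ext u v
  rw [ptr_apply, Finset.sum_eq_single_of_mem (fun _ => false) (by simp)]
  · congr 1
    · exact extend_comp (Function.Embedding.refl κ) u fun _ => false
    · exact extend_comp (Function.Embedding.refl κ) v fun _ => false
  · intro g hg hne
    refine absurd ?_ hne
    ext k
    simpa using (Finset.mem_filter.mp hg).2 k

theorem prep_refl (σ : QOp κ) : prep (Function.Embedding.refl κ) σ = σ := by
  ext u v
  simp only [prep]
  rw [if_pos fun i hi => absurd ⟨i, rfl⟩ hi]
  rfl

theorem ptr_prep (f : κ ↪ ι) (τ : QOp κ) : ptr f (prep f τ) = τ := by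
  rw [ptr_prep_glue f f (.refl κ) (.refl κ) (fun _ => rfl)
    (fun j hj => absurd ⟨j, rfl⟩ hj), ptr_refl, prep_refl]

/-- Permute the wires of an operator. -/
def permute (π : Equiv.Perm ι) (σ : QOp ι) : QOp ι := fun x y => σ (x ∘ π) (y ∘ π)

theorem permute_prep (π : Equiv.Perm ι) (hπ : ∀ i, π (π i) = i) (f : κ ↪ ι) (ρ : QOp κ) :
    permute π (prep f ρ) = prep (f.trans π.toEmbedding) ρ := by
  classical
  ext x y
  simp only [permute, prep]
  refine if_congr ?_ rfl rfl
  refine ⟨fun h i hi => ?_, fun h i hi => ?_⟩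
  · have := h (π i) fun ⟨k, hk⟩ => hi ⟨k, by simp [hk, hπ]⟩
    simpa [hπ] using this
  · exact h (π i) fun ⟨k, hk⟩ => hi ⟨k, π.injective hk⟩

theorem ptr_permute (π : Equiv.Perm ι) (hπ : ∀ i, π (π i) = i) (f : κ ↪ ι) (σ : QOp ι) :
    ptr f (permute π σ) = ptr (f.trans π.toEmbedding) σ := by
  have key : ∀ (u : κ → Bool) (g : ι → Bool), Function.extend f u g ∘ π =
      Function.extend (f.trans π.toEmbedding) u (g ∘ π) := by
    intro u g
    ext i
    by_cases hi : π i ∈ Set.range f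
    · obtain ⟨k, hk⟩ := hi
      have : i = (f.trans π.toEmbedding) k := by simp [hk, hπ]
      rw [Function.comp_apply, ← hk, f.injective.extend_apply, this,
        (f.trans π.toEmbedding).injective.extend_apply]
    · rw [Function.comp_apply, extend_off f _ _ hi, extend_off]
      · rfl
      · rintro ⟨k, rfl⟩
        exact hi ⟨k, by simp [hπ]⟩
  ext u v
  rw [ptr_apply, ptr_apply]
  simp only [permute, key]
  refine Finset.sum_nbij' (fun g => g ∘ π) (fun g => g ∘ π) ?_ ?_ ?_ ?_ ?_
  · intro g hg
    simpa [hπ] using hg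
  · intro g hg
    simpa using hg
  · intro g _
    ext i
    simp [hπ]
  · intro g _
    ext i
    simp [hπ]
  · intro g _
    rfl

end

/-! ### Networks: circuits with arbitrary input and output wires -/

/-- A list of gates on the wires `ι`, with inputs labelled by `α` and outputs by `β`. -/
structure Net (ι α β : Type) where
  gates : List (Gate ι)
  inp : α ↪ ι
  out : β ↪ ι

section

variable {ι κ μ α β γ δ G : Type} [Fintype ι] [DecidableEq ι] [Fintype κ] [DecidableEq κ]
  [Fintype μ] [DecidableEq μ] [Fintype α] [DecidableEq α] [Fintype β] [DecidableEq β]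
  [Fintype γ] [DecidableEq γ] [Fintype δ] [DecidableEq δ] [Fintype G] [DecidableEq G]

/-- The quantum operation implemented by a network. -/
def Net.run (N : Net ι α β) (ρ : QOp α) : QOp β := ptr N.out (evo N.gates (prep N.inp ρ))

/-- Use only some of the inputs and outputs. -/
def Net.restrict (N : Net ι α β) (f : γ ↪ α) (g : δ ↪ β) : Net ι γ δ :=
  ⟨N.gates, f.trans N.inp, g.trans N.out⟩

theorem Net.run_restrict (N : Net ι α β) (f : γ ↪ α) (g : δ ↪ β) (ρ : QOp γ) :
    (N.restrict f g).run ρ = ptr g (N.run (prep f ρ)) := by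
  simp only [Net.run, Net.restrict, prep_trans, ptr_trans]

/-- Compose two networks embedded into common wires. -/
def Net.glue (P : Net κ α β) (Q : Net μ β γ) (fP : κ ↪ ι) (fQ : μ ↪ ι) : Net ι α γ :=
  ⟨P.gates.map (Gate.map fP) ++ Q.gates.map (Gate.map fQ), P.inp.trans fP, Q.out.trans fQ⟩

theorem Net.run_glue (P : Net κ α β) (Q : Net μ β γ) (fP : κ ↪ ι) (fQ : μ ↪ ι)
    (h1 : ∀ k, fQ (Q.inp k) = fP (P.out k))
    (h2 : ∀ j, j ∉ Set.range Q.inp → fQ j ∉ Set.range fP) (ρ : QOp α) :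
    (P.glue Q fP fQ).run ρ = Q.run (P.run ρ) := by
  simp only [Net.run, Net.glue]
  rw [evo_append, ptr_trans, ptr_evo, prep_trans, evo_prep, ptr_prep_glue fP fQ P.out Q.inp h1 h2]

/-- Tensor product of a family of operators. -/
def tens (ρ : G → QOp α) : QOp (G × α) := fun x y =>
  ∏ g, ρ g (fun a => x (g, a)) fun a => y (g, a)

/-- Tensor product of two operators. -/
def tens₂ (ρ : QOp α) (σ : QOp β) : QOp (α ⊕ β) := fun x y =>
  ρ (x ∘ Sum.inl) (y ∘ Sum.inl) * σ (x ∘ Sum.inr) (y ∘ Sum.inr)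

/-- The embedding of a product given by a family of embeddings. -/
def prodEmb (f : G → α ↪ ι) : G × α ↪ G × ι :=
  ⟨fun p => (p.1, f p.1 p.2), fun p q h => by
    obtain ⟨g, a⟩ := p
    obtain ⟨g', a'⟩ := q
    simp only [Prod.mk.injEq] at h
    obtain ⟨rfl, h⟩ := h
    rw [(f g).injective h]⟩

theorem prodEmb_apply (f : G → α ↪ ι) (g : G) (a : α) : prodEmb f (g, a) = (g, f g a) := rfl

theorem mem_range_prodEmb (f : G → α ↪ ι) (g : G) (i : ι) :
    (g, i) ∈ Set.range (prodEmb f) ↔ i ∈ Set.range (f g) := by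
  constructor
  · rintro ⟨⟨g', a⟩, h⟩
    simp only [prodEmb_apply, Prod.mk.injEq] at h
    obtain ⟨rfl, h⟩ := h
    exact ⟨a, h⟩
  · rintro ⟨a, rfl⟩
    exact ⟨(g, a), rfl⟩

theorem extend_prodEmb (f : G → α ↪ ι) (u : G × α → Bool) (x : G × ι → Bool) (g : G) :
    (fun i => Function.extend (prodEmb f) u x (g, i)) =
      Function.extend (f g) (fun a => u (g, a)) fun i => x (g, i) := by
  ext i
  by_cases hi : i ∈ Set.range (f g)
  · obtain ⟨a, rfl⟩ := hi
    rw [(f g).injective.extend_apply]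
    exact (prodEmb f).injective.extend_apply u x (g, a)
  · rw [extend_off (f g) _ _ hi, extend_off]
    rwa [mem_range_prodEmb]

theorem evo_tens (gs : G → List (Gate ι)) (l : List G) (hl : l.Nodup) (ρ : G → QOp ι) :
    evo (l.flatMap fun g => (gs g).map (Gate.map (Function.Embedding.sectR g ι))) (tens ρ) =
      tens fun g => if g ∈ l then evo (gs g) (ρ g) else ρ g := by
  induction l generalizing ρ with
  | nil => simp
  | cons g l ih =>
    rw [List.nodup_cons] at hl
    have hstep : evo ((gs g).map (Gate.map (Function.Embedding.sectR g ι))) (tens ρ) =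
        tens (Function.update ρ g (evo (gs g) (ρ g))) := by
      ext x y
      rw [evo_factor _ _ _ (fun x y => ∏ g' ∈ Finset.univ.erase g,
        ρ g' (fun a => x (g', a)) fun a => y (g', a)) (ρ g)]
      · rw [tens, ← Finset.mul_prod_erase _ _ (Finset.mem_univ g)]
        congr 1
        · simp [Function.comp_def]
        · refine Finset.prod_congr rfl fun g' hg' => ?_
          rw [Function.update_of_ne (Finset.ne_of_mem_erase hg')]
      · intro x y
        rw [tens, ← Finset.mul_prod_erase _ _ (Finset.mem_univ g)]
        rfl
      · intro x y u v
        refine Finset.prod_congr rfl fun g' hg' => ?_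
        have hne := Finset.ne_of_mem_erase hg'
        have : ∀ a, (g', a) ∉ Set.range (Function.Embedding.sectR g ι) := by
          rintro a ⟨i, hi⟩
          exact hne (congrArg Prod.fst hi).symm
        congr 1 <;> · ext a; exact extend_off _ _ _ (this a)
    rw [List.flatMap_cons, evo_append, hstep, ih hl.2]
    congr 1
    ext1 g'
    by_cases h : g' = g
    · subst h
      simp [hl.1]
    · simp [h]

theorem prep_tens (f : G → α ↪ ι) (ρ : G → QOp α) :
    prep (prodEmb f) (tens ρ) = tens fun g => prep (f g) (ρ g) := by
  classical
  ext x y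
  simp only [tens, prep]
  by_cases h : ∀ g i, i ∉ Set.range (f g) → x (g, i) = false ∧ y (g, i) = false
  · rw [if_pos]
    · exact Finset.prod_congr rfl fun g _ => (if_pos (h g)).symm
    · rintro ⟨g, i⟩ hi
      exact h g i (by rwa [mem_range_prodEmb] at hi)
  · rw [if_neg fun h' => h fun g i hi => h' (g, i) (by rwa [mem_range_prodEmb])]
    obtain ⟨g, hg⟩ := not_forall.mp h
    exact (Finset.prod_eq_zero (Finset.mem_univ g) (if_neg hg)).symm

theorem ptr_tens (f : G → α ↪ ι) (σ : G → QOp ι) :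
    ptr (prodEmb f) (tens σ) = tens fun g => ptr (f g) (σ g) := by
  ext u v
  simp only [tens, ptr_apply, extend_prodEmb]
  rw [Finset.prod_univ_sum]
  refine Finset.sum_nbij' (fun x g i => x (g, i)) (fun x p => x p.1 p.2) ?_ ?_ ?_ ?_ ?_
  · intro x hx
    simp only [Finset.mem_filter, Finset.mem_univ, true_and] at hx
    simp only [Fintype.mem_piFinset, Finset.mem_filter, Finset.mem_univ, true_and]
    exact fun g a => hx (g, a)
  · intro x hx
    simp only [Fintype.mem_piFinset, Finset.mem_filter, Finset.mem_univ, true_and] at hx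
    simp only [Finset.mem_filter, Finset.mem_univ, true_and]
    exact fun p => hx p.1 p.2
  · intro x _
    rfl
  · intro x _
    rfl
  · intro x _
    rfl

/-- A family of networks side by side. -/
def Net.power (l : List G) (N : G → Net ι α β) : Net (G × ι) (G × α) (G × β) :=
  ⟨l.flatMap fun g => (N g).gates.map (Gate.map (Function.Embedding.sectR g ι)),
    prodEmb fun g => (N g).inp, prodEmb fun g => (N g).out⟩

theorem Net.run_power (l : List G) (hl : l.Nodup) (hl' : ∀ g, g ∈ l) (N : G → Net ι α β)
    (ρ : G → QOp α) : (Net.power l N).run (tens ρ) = tens fun g => (N g).run (ρ g) := by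
  rw [Net.run, Net.power, prep_tens, evo_tens _ _ hl, ptr_tens]
  simp [hl', Net.run]

theorem extend_sumMap (f : α ↪ ι) (g : β ↪ κ) (u : α ⊕ β → Bool) (x : ι ⊕ κ → Bool) :
    Function.extend (f.sumMap g) u x ∘ Sum.inl = Function.extend f (u ∘ Sum.inl) (x ∘ Sum.inl) ∧
    Function.extend (f.sumMap g) u x ∘ Sum.inr =
      Function.extend g (u ∘ Sum.inr) (x ∘ Sum.inr) := by
  constructor
  · ext i
    by_cases hi : i ∈ Set.range f
    · obtain ⟨a, rfl⟩ := hi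
      rw [f.injective.extend_apply]
      exact (f.sumMap g).injective.extend_apply u x (Sum.inl a)
    · rw [extend_off f _ _ hi]
      refine extend_off (f.sumMap g) u x ?_
      rintro ⟨a | b, hab⟩
      · exact hi ⟨a, Sum.inl_injective hab⟩
      · simp at hab
  · ext i
    by_cases hi : i ∈ Set.range g
    · obtain ⟨a, rfl⟩ := hi
      rw [g.injective.extend_apply]
      exact (f.sumMap g).injective.extend_apply u x (Sum.inr a)
    · rw [extend_off g _ _ hi]
      refine extend_off (f.sumMap g) u x ?_
      rintro ⟨a | b, hab⟩
      · simp at hab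
      · exact hi ⟨b, Sum.inr_injective hab⟩

theorem evo_tens₂_inl (gs : List (Gate ι)) (ρ : QOp ι) (σ : QOp κ) :
    evo (gs.map (Gate.map (Function.Embedding.inl (β := κ)))) (tens₂ ρ σ) =
      tens₂ (evo gs ρ) σ := by
  ext x y
  refine evo_factor .inl gs (tens₂ ρ σ) (fun x y => σ (x ∘ Sum.inr) (y ∘ Sum.inr)) ρ
    (fun _ _ => rfl) (fun x y u v => ?_) x y
  congr 1 <;> · ext k; exact extend_off .inl _ _ (by rintro ⟨i, hi⟩; simp at hi)

theorem evo_tens₂_inr (gs : List (Gate κ)) (ρ : QOp ι) (σ : QOp κ) :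
    evo (gs.map (Gate.map (Function.Embedding.inr (α := ι)))) (tens₂ ρ σ) =
      tens₂ ρ (evo gs σ) := by
  ext x y
  refine (evo_factor .inr gs (tens₂ ρ σ) (fun x y => ρ (x ∘ Sum.inl) (y ∘ Sum.inl)) σ
    (fun _ _ => mul_comm _ _) (fun x y u v => ?_) x y).trans (mul_comm _ _)
  congr 1 <;> · ext k; exact extend_off .inr _ _ (by rintro ⟨i, hi⟩; simp at hi)

theorem prep_tens₂ (f : α ↪ ι) (g : β ↪ κ) (ρ : QOp α) (σ : QOp β) :
    prep (f.sumMap g) (tens₂ ρ σ) = tens₂ (prep f ρ) (prep g σ) := by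
  classical
  ext x y
  simp only [tens₂, prep]
  rw [ite_zero_mul_ite_zero]
  refine if_congr ?_ rfl rfl
  have hl : ∀ i, (Sum.inl i : ι ⊕ κ) ∈ Set.range (f.sumMap g) ↔ i ∈ Set.range f := fun i => by
    simp [Function.Embedding.sumMap]
  have hr : ∀ i, (Sum.inr i : ι ⊕ κ) ∈ Set.range (f.sumMap g) ↔ i ∈ Set.range g := fun i => by
    simp [Function.Embedding.sumMap]
  constructor
  · exact fun h => ⟨fun i hi => h _ (by rwa [hl]), fun i hi => h _ (by rwa [hr])⟩
  · rintro h (i | i) hi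
    · exact h.1 i (by rwa [hl] at hi)
    · exact h.2 i (by rwa [hr] at hi)

theorem ptr_tens₂ (f : α ↪ ι) (g : β ↪ κ) (ρ : QOp ι) (σ : QOp κ) :
    ptr (f.sumMap g) (tens₂ ρ σ) = tens₂ (ptr f ρ) (ptr g σ) := by
  ext u v
  simp only [tens₂, ptr_apply, (extend_sumMap f g _ _).1, (extend_sumMap f g _ _).2]
  rw [Finset.sum_mul_sum, ← Finset.sum_product']
  refine Finset.sum_nbij' (fun x => (x ∘ Sum.inl, x ∘ Sum.inr))
    (fun p => Sum.elim p.1 p.2) ?_ ?_ ?_ ?_ ?_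
  · intro x hx
    simp only [Finset.mem_filter, Finset.mem_univ, true_and] at hx
    simp only [Finset.mem_product, Finset.mem_filter, Finset.mem_univ, true_and]
    exact ⟨fun a => hx (Sum.inl a), fun b => hx (Sum.inr b)⟩
  · rintro ⟨x, y⟩ h
    simp only [Finset.mem_product, Finset.mem_filter, Finset.mem_univ, true_and] at h
    simp only [Finset.mem_filter, Finset.mem_univ, true_and]
    rintro (a | b)
    · exact h.1 a
    · exact h.2 b
  · intro x _
    simp
  · rintro ⟨x, y⟩ _
    simp
  · intro x _
    rfl

/-- Two networks side by side. -/
def Net.par (N : Net ι α β) (M : Net κ γ δ) : Net (ι ⊕ κ) (α ⊕ γ) (β ⊕ δ) :=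
  ⟨N.gates.map (Gate.map .inl) ++ M.gates.map (Gate.map .inr), N.inp.sumMap M.inp,
    N.out.sumMap M.out⟩

theorem Net.run_par (N : Net ι α β) (M : Net κ γ δ) (ρ : QOp α) (σ : QOp γ) :
    (N.par M).run (tens₂ ρ σ) = tens₂ (N.run ρ) (M.run σ) := by
  rw [Net.run, Net.par, prep_tens₂, evo_append, evo_tens₂_inl, evo_tens₂_inr, ptr_tens₂]
  rfl

/-! ### States -/

/-- A mixed state of qubits labelled by `α`. -/
def IsQState (ρ : QOp α) : Prop := ρ.PosSemidef ∧ ρ.trace = 1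

theorem trace_eq_ptr (σ : QOp ι) :
    σ.trace = ptr (Function.Embedding.ofIsEmpty (α := Empty)) σ Empty.elim Empty.elim := by
  rw [ptr_apply, Matrix.trace]
  simp only [IsEmpty.forall_iff, Finset.filter_true]
  refine Finset.sum_congr rfl fun x _ => ?_
  have : ∀ u : Empty → Bool,
      Function.extend (Function.Embedding.ofIsEmpty (α := Empty) (β := ι)) u x = x := fun u => by
    ext i
    exact extend_off _ _ _ (by rintro ⟨k, _⟩; exact k.elim)
  rw [this]
  rfl

theorem trace_ptr (f : κ ↪ ι) (σ : QOp ι) : (ptr f σ).trace = σ.trace := by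
  rw [trace_eq_ptr, trace_eq_ptr, ← ptr_trans]
  congr 2
  ext x
  exact x.elim

theorem trace_prep (f : κ ↪ ι) (ρ : QOp κ) : (prep f ρ).trace = ρ.trace := by
  rw [← trace_ptr f, ptr_prep]

theorem hadamard_unitary :
    (Gate.H () : Gate Unit).mat.conjTranspose * (Gate.H () : Gate Unit).mat = 1 := by
  have hs : ((Real.sqrt 2 : ℝ) : ℂ)⁻¹ * ((Real.sqrt 2 : ℝ) : ℂ)⁻¹ = 1 / 2 := by
    rw [← mul_inv, ← Complex.ofReal_mul, Real.mul_self_sqrt (by norm_num)]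
    norm_num
  have hu : (Finset.univ : Finset (Unit → Bool)) = {fun _ => false, fun _ => true} := by
    decide
  have hne : (fun _ => false : Unit → Bool) ≠ fun _ => true := fun h => by
    simpa using congrFun h ()
  ext x y
  have hx : x = fun _ => x () := rfl
  have hy : y = fun _ => y () := rfl
  rw [Matrix.mul_apply, hu, Finset.sum_pair hne, hx, hy]
  cases x () <;> cases y () <;>
    simp [Gate.mat, Matrix.conjTranspose_apply, hs, hne, hne.symm] <;> norm_num

theorem trace_gate (g : Gate ι) (σ : QOp ι) :
    (g.mat * σ * g.mat.conjTranspose).trace = σ.trace := by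
  have hclass : g.IsClassical → (g.mat * σ * g.mat.conjTranspose).trace = σ.trace := fun h => by
    simp only [Matrix.trace, Matrix.diag_apply, h.conj_apply]
    exact Equiv.sum_comp (Function.Involutive.toPerm g.act g.act_act) fun x => σ x x
  cases g with
  | H i =>
    have h := ptr_evo (⟨fun _ => i, fun _ _ _ => rfl⟩ : Unit ↪ ι) [Gate.H ()] σ
    have h' := congrArg Matrix.trace h
    rw [trace_ptr, evo_cons, evo_nil, Matrix.trace_mul_cycle, hadamard_unitary, one_mul,
      trace_ptr] at h'
    exact h'
  | T i =>
    rw [Matrix.trace_mul_cycle]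
    have : (Gate.T i).mat.conjTranspose * (Gate.T i).mat = (1 : QOp ι) := by
      simp only [Gate.mat, Matrix.diagonal_conjTranspose, Matrix.diagonal_mul_diagonal]
      rw [← Matrix.diagonal_one]
      congr 1
      ext x
      by_cases hx : x i
      · simp [hx, ← Complex.exp_conj, ← Complex.exp_add, Complex.conj_ofNat]
      · simp [hx]
    rw [this, one_mul]
  | X i => exact hclass trivial
  | CNOT c t h => exact hclass trivial
  | Toffoli c d t h h' h'' => exact hclass trivial

theorem trace_evo (gs : List (Gate ι)) (σ : QOp ι) : (evo gs σ).trace = σ.trace := by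
  induction gs generalizing σ with
  | nil => rfl
  | cons g gs ih => rw [evo_cons, ih, trace_gate]

theorem posSemidef_evo (gs : List (Gate ι)) {σ : QOp ι} (h : σ.PosSemidef) :
    (evo gs σ).PosSemidef := by
  induction gs generalizing σ with
  | nil => exact h
  | cons g gs ih => exact ih (h.mul_mul_conjTranspose_same _)

theorem posSemidef_ptr (f : κ ↪ ι) {σ : QOp ι} (h : σ.PosSemidef) : (ptr f σ).PosSemidef :=
  Matrix.posSemidef_sum _ fun _ _ => h.submatrix _

theorem posSemidef_prep (f : κ ↪ ι) {ρ : QOp κ} (h : ρ.PosSemidef) : (prep f ρ).PosSemidef := by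
  classical
  let w : (ι → Bool) → ℂ := fun x => if ∀ i, i ∉ Set.range f → x i = false then 1 else 0
  have : prep f ρ = (ρ.submatrix (· ∘ f) (· ∘ f)).hadamard (Matrix.vecMulVec w (star w)) := by
    ext x y
    simp only [prep, Matrix.hadamard_apply, Matrix.submatrix_apply, Matrix.vecMulVec_apply, w,
      Pi.star_apply, forall_and]
    split_ifs <;> simp_all
  rw [this]
  exact (h.submatrix _).hadamard (Matrix.posSemidef_vecMulVec_self_star w)

theorem IsQState.run {ρ : QOp α} (h : IsQState ρ) (N : Net ι α β) : IsQState (N.run ρ) :=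
  ⟨posSemidef_ptr _ (posSemidef_evo _ (posSemidef_prep _ h.1)), by
    rw [Net.run, trace_ptr, trace_evo, trace_prep, h.2]⟩

theorem IsQState.ptr {ρ : QOp ι} (h : IsQState ρ) (f : α ↪ ι) : IsQState (ptr f ρ) :=
  ⟨posSemidef_ptr _ h.1, by rw [trace_ptr, h.2]⟩

theorem IsQState.tens₂ {ρ : QOp α} {σ : QOp β} (h : IsQState ρ) (h' : IsQState σ) :
    IsQState (tens₂ ρ σ) := by
  refine ⟨(h.1.submatrix (· ∘ Sum.inl)).hadamard (h'.1.submatrix (· ∘ Sum.inr)), ?_⟩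
  rw [← one_mul (1 : ℂ)]
  nth_rewrite 1 [← h.2]
  rw [← h'.2, Matrix.trace, Matrix.trace, Matrix.trace, Finset.sum_mul_sum,
    ← Finset.sum_product']
  exact Fintype.sum_equiv (Equiv.sumArrowEquivProdArrow α β Bool) _ _ fun x => rfl

theorem IsQState.tens {ρ : G → QOp α} (h : ∀ g, IsQState (ρ g)) : IsQState (tens ρ) := by
  constructor
  · have : ∀ s : Finset G, Matrix.PosSemidef (fun x y : G × α → Bool =>
        ∏ g ∈ s, ρ g (fun a => x (g, a)) fun a => y (g, a)) := by
      intro s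
      induction s using Finset.induction_on with
      | empty =>
        have := Matrix.posSemidef_vecMulVec_self_star (fun _ : G × α → Bool => (1 : ℂ))
        have heq : (fun x y : G × α → Bool => ∏ g ∈ (∅ : Finset G),
            ρ g (fun a => x (g, a)) fun a => y (g, a)) =
            Matrix.vecMulVec (fun _ => (1 : ℂ)) (star fun _ => (1 : ℂ)) := by
          ext x y
          simp [Matrix.vecMulVec_apply]
        exact heq ▸ this
      | insert g s hg ih =>
        simp only [Finset.prod_insert hg]
        exact ((h g).1.submatrix fun x : G × α → Bool => fun a => x (g, a)).hadamard ih
    exact this Finset.univ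
  · have h1 : ∏ g, (ρ g).trace = 1 := Finset.prod_eq_one fun g _ => (h g).2
    rw [← h1]
    simp only [Matrix.trace, Matrix.diag_apply]
    rw [Finset.prod_univ_sum, Fintype.piFinset_univ]
    exact Fintype.sum_equiv (Equiv.curry G α Bool) _ _ fun x => rfl

theorem IsQState.apply_self {ρ : QOp α} (h : IsQState ρ) (x : α → Bool) :
    ρ x x = ((ρ x x).re : ℂ) := by
  have := h.1.diag_nonneg (i := x)
  rw [Complex.le_def] at this
  exact Complex.ext rfl (by simpa using this.2.symm)

theorem IsQState.re_nonneg {ρ : QOp α} (h : IsQState ρ) (x : α → Bool) : 0 ≤ (ρ x x).re := by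
  have := h.1.diag_nonneg (i := x)
  rw [Complex.le_def] at this
  exact this.1

theorem IsQState.sum_re {ρ : QOp α} (h : IsQState ρ) : ∑ x, (ρ x x).re = 1 := by
  rw [← Complex.re_sum]
  have := h.2
  rw [Matrix.trace] at this
  simpa using congrArg Complex.re this

theorem isQState_single (x : α → Bool) : IsQState (Matrix.single x x 1 : QOp α) := by
  constructor
  · have := Matrix.posSemidef_vecMulVec_self_star (Pi.single x 1 : (α → Bool) → ℂ)
    convert this using 1
    ext y z
    simp only [Matrix.single_apply, Matrix.vecMulVec_apply, Pi.single_apply, Pi.star_apply,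
      eq_comm (a := x)]
    split_ifs <;> simp_all
  · simp [Matrix.trace_single_eq_same]

end

/-! ### Circuits and networks -/

/-- A circuit as a network. -/
def Circuit.net {a b : ℕ} (C : Circuit a b) : Net (Fin C.width) (Fin a) (Fin b) :=
  ⟨C.gates, Fin.castLEEmb C.in_le, Fin.castLEEmb C.out_le⟩

theorem mem_range_castLEEmb {a w : ℕ} (h : a ≤ w) (i : Fin w) :
    i ∈ Set.range (Fin.castLEEmb h) ↔ i.val < a := by
  constructor
  · rintro ⟨k, rfl⟩
    exact k.isLt
  · exact fun hi => ⟨⟨i, hi⟩, rfl⟩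

section

variable {ι κ α β : Type} [Fintype ι] [DecidableEq ι] [Fintype κ] [DecidableEq κ]
  [Fintype α] [DecidableEq α] [Fintype β] [DecidableEq β]

theorem ptr_eq_sum (f : κ ↪ ι) (σ : QOp ι) (u v : κ → Bool) :
    ptr f σ u v = ∑ x : ι → Bool, if x ∘ f = u then σ x (Function.extend f v x) else 0 := by
  rw [ptr_apply, ← Finset.sum_filter]
  refine Finset.sum_nbij' (fun g => Function.extend f u g)
    (fun x => Function.extend f (fun _ => false) x) ?_ ?_ ?_ ?_ ?_
  · intro g _
    simp [extend_comp]
  · intro x _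
    simp [f.injective.extend_apply]
  · intro g hg
    simp only [Finset.mem_filter, Finset.mem_univ, true_and] at hg
    simp only [extend_extend]
    nth_rewrite 2 [← extend_self f g]
    congr 1
    ext k
    simp [hg]
  · intro x hx
    simp only [Finset.mem_filter, Finset.mem_univ, true_and] at hx
    simp only [extend_extend]
    rw [← hx, extend_self]
  · intro g _
    rw [extend_extend]

theorem ptr_diag (f : κ ↪ ι) (σ : QOp ι) (u : κ → Bool) :
    ptr f σ u u = ∑ x : ι → Bool, if x ∘ f = u then σ x x else 0 := by
  rw [ptr_eq_sum]
  refine Finset.sum_congr rfl fun x _ => ?_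
  split_ifs with h
  · rw [← h, extend_self]
  · rfl

theorem Circuit.run_eq {a b : ℕ} (C : Circuit a b) (ρ : Op a) : C.run ρ = C.net.run ρ := by
  have hprep : C.prepare ρ = prep (Fin.castLEEmb C.in_le) ρ := by
    ext x y
    simp only [Circuit.prepare, prep]
    have hc : (∀ i : Fin C.width, a ≤ i.val → x i = false ∧ y i = false) ↔
        ∀ i, i ∉ Set.range (Fin.castLEEmb C.in_le) → x i = false ∧ y i = false :=
      forall_congr' fun i => by rw [mem_range_castLEEmb, not_lt]
    by_cases h : ∀ i : Fin C.width, a ≤ i.val → x i = false ∧ y i = false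
    · rw [if_pos h, if_pos (hc.mp h)]
      rfl
    · rw [if_neg h, if_neg fun h' => h (hc.mpr h')]
  rw [Circuit.run, Net.run, hprep]
  change C.traceOut (evo C.gates (prep (Fin.castLEEmb C.in_le) ρ)) =
    ptr (Fin.castLEEmb C.out_le) (evo C.gates (prep (Fin.castLEEmb C.in_le) ρ))
  generalize evo C.gates (prep (Fin.castLEEmb C.in_le) ρ) = σ
  ext u v
  rw [ptr_eq_sum, Circuit.traceOut]
  refine Finset.sum_congr rfl fun x _ => ?_
  have hu : (∀ i, x (Fin.castLE C.out_le i) = u i) ↔ x ∘ Fin.castLEEmb C.out_le = u :=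
    ⟨fun h => funext h, fun h i => congrFun h i⟩
  by_cases h : x ∘ Fin.castLEEmb C.out_le = u
  · rw [if_pos h, Finset.sum_eq_single (Function.extend (Fin.castLEEmb C.out_le) v x)]
    · refine if_pos ⟨hu.mpr h, fun i => ?_, fun i hi => ?_⟩
      · exact (Fin.castLEEmb C.out_le).injective.extend_apply v x i
      · rw [extend_off]
        rwa [mem_range_castLEEmb, not_lt]
    · rintro y - hy
      refine if_neg ?_
      rintro ⟨-, h1, h2⟩
      refine hy ?_
      have : v = y ∘ Fin.castLEEmb C.out_le := funext fun i => (h1 i).symm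
      rw [this]
      refine (eq_extend _ fun i hi => h2 i ?_).symm
      rwa [mem_range_castLEEmb, not_lt] at hi
    · simp
  · rw [if_neg h]
    refine Finset.sum_eq_zero fun y _ => if_neg fun h' => h (hu.mp h'.1)

/-- A network as a circuit: the wires of the network are numbered by `e` and come after a
block that contains the input and output wires; the lists determine the order in which the
inputs are moved into the network and the outputs out of it. -/
def Net.realize {a b W : ℕ} (N : Net ι (Fin a) (Fin b)) (e : ι ↪ Fin W) : Circuit a b where
  width := a + b + W
  in_le := by omega
  out_le := by omega
  gates :=
    ((List.finRange a).flatMap fun p =>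
      swapGates (Fin.castLE (by omega) p) (Fin.natAdd (a + b) (e (N.inp p))) fun h => by
        have := congrArg Fin.val h
        simp at this
        omega) ++
    N.gates.map (Gate.map (e.trans (Fin.natAddEmb (a + b)))) ++
    ((List.finRange b).flatMap fun p =>
      swapGates (Fin.castLE (by omega) p) (Fin.natAdd (a + b) (e (N.out p))) fun h => by
        have := congrArg Fin.val h
        simp at this
        omega)

theorem Net.run_realize {a b W : ℕ} (N : Net ι (Fin a) (Fin b)) (e : ι ↪ Fin W) (ρ : Op a) :
    (N.realize e).run ρ = N.run ρ := by
  rw [Circuit.run_eq]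
  set w : ι ↪ Fin (a + b + W) := e.trans (Fin.natAddEmb (a + b)) with hw
  have key : ∀ {c : ℕ} (hc : c ≤ a + b + W) (hc' : c ≤ a + b) (f : Fin c ↪ ι),
      ∃ π : Equiv.Perm (Fin (a + b + W)), (∀ i, π (π i) = i) ∧
        (Fin.castLEEmb hc).trans π.toEmbedding = f.trans w ∧
        ∀ (h : ∀ p : Fin c, Fin.castLE hc p ≠ Fin.natAdd (a + b) (e (f p)))
          (σ : QOp (Fin (a + b + W))), evo ((List.finRange c).flatMap fun p =>
          swapGates (Fin.castLE hc p) (Fin.natAdd (a + b) (e (f p))) (h p)) σ =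
            permute π σ := by
    intro c hc hc' f
    have hne : ∀ j k, Fin.castLEEmb hc j ≠ (f.trans w) k := by
      intro j k h
      have := congrArg Fin.val h
      simp [hw] at this
      omega
    refine ⟨swapPerm (Fin.castLEEmb hc) (f.trans w) (List.finRange c),
      swapPerm_involutive _ _ hne (List.nodup_finRange c), ?_, fun h σ => ?_⟩
    · ext1 p
      exact (swapPerm_apply _ _ hne (List.nodup_finRange c) (List.mem_finRange p)).1
    · ext x y
      exact evo_swaps (Fin.castLEEmb hc) (f.trans w) h _ σ x y
  obtain ⟨π, hπ, hinp, hev⟩ := key (c := a) (by omega) (by omega) N.inp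
  obtain ⟨π', hπ', hout, hev'⟩ := key (c := b) (by omega) (by omega) N.out
  have : ∀ (h : a ≤ a + b + W) (h' : b ≤ a + b + W) (gs : List (Gate (Fin (a + b + W)))),
      gs = (N.realize e).gates → ptr (Fin.castLEEmb h') (evo gs (prep (Fin.castLEEmb h) ρ)) =
        N.run ρ := by
    rintro h h' gs rfl
    simp only [Net.realize]
    rw [evo_append, evo_append, hev, hev', ptr_permute π' hπ', hout,
      permute_prep π hπ, hinp, prep_trans, evo_prep, ptr_trans, ptr_prep]
    rfl
  exact this _ _ _ rfl

theorem Net.size_realize {a b W : ℕ} (N : Net ι (Fin a) (Fin b)) (e : ι ↪ Fin W) :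
    (N.realize e).size = 4 * a + 4 * b + W + N.gates.length := by
  simp [Circuit.size, Net.realize, swapGates, List.length_flatMap]
  omega

end

/-! ### Descriptions -/

/-- The description of a gate whose wires are numbered by `f`. -/
def Gate.code {ι : Type} (f : ι → ℕ) : Gate ι → List ℕ
  | .H i => [0, f i, 0, 0]
  | .T i => [1, f i, 0, 0]
  | .X i => [2, f i, 0, 0]
  | .CNOT c t _ => [3, f c, f t, 0]
  | .Toffoli c d t _ _ _ => [4, f c, f d, f t]

theorem Gate.encode_map {ι : Type} {W : ℕ} (f : ι ↪ Fin W) (g : Gate ι) :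
    (g.map f).encode = g.code fun i => (f i).val := by
  cases g <;> rfl

theorem Gate.code_map {ι κ : Type} (f : ι ↪ κ) (e : κ → ℕ) (g : Gate ι) :
    (g.map f).code e = g.code fun i => e (f i) := by
  cases g <;> rfl

/-- The description of an exchange of wires. -/
def swapCode (p q : ℕ) : List ℕ := [3, p, q, 0, 3, q, p, 0, 3, p, q, 0]

theorem Net.encode_realize {ι : Type} {a b W : ℕ} (N : Net ι (Fin a) (Fin b)) (e : ι ↪ Fin W) :
    (N.realize e).encode = a :: b :: (a + b + W) ::
      (((List.finRange a).flatMap fun p => swapCode p.val (a + b + e (N.inp p))) ++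
        (N.gates.flatMap (Gate.code fun i => a + b + e i)) ++
        (List.finRange b).flatMap fun p => swapCode p.val (a + b + e (N.out p))) := by
  have : ∀ g : Gate ι, (g.map (e.trans (Fin.natAddEmb (a + b)))).encode =
      g.code fun i => a + b + e i := fun g => Gate.encode_map _ g
  simp only [Circuit.encode, Net.realize, List.flatMap_append, List.flatMap_assoc,
    List.flatMap_map, this]
  rfl

/-! ### The networks of the state generator -/

section

variable {ι κ α β G : Type} [Fintype ι] [DecidableEq ι] [Fintype κ] [DecidableEq κ]
  [Fintype α] [DecidableEq α] [Fintype β] [DecidableEq β] [Fintype G] [DecidableEq G]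

theorem ptr_equiv (e : κ ≃ ι) (σ : QOp ι) (u v : κ → Bool) :
    ptr e.toEmbedding σ u v = σ (u ∘ e.symm) (v ∘ e.symm) := by
  have h : ∀ (u : κ → Bool) (x : ι → Bool), Function.extend e.toEmbedding u x = u ∘ e.symm := by
    intro u x
    ext i
    obtain ⟨k, rfl⟩ := e.surjective i
    rw [Function.comp_apply, e.symm_apply_apply]
    exact e.toEmbedding.injective.extend_apply u x k
  rw [ptr_apply, Finset.sum_eq_single_of_mem (fun _ => false) (by simp), h, h]
  intro g hg hne
  refine absurd ?_ hne
  ext i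
  obtain ⟨k, rfl⟩ := e.surjective i
  simpa using (Finset.mem_filter.mp hg).2 k

theorem prep_equiv (e : κ ≃ ι) (ρ : QOp κ) (x y : ι → Bool) :
    prep e.toEmbedding ρ x y = ρ (x ∘ e) (y ∘ e) := by
  rw [prep, if_pos fun i hi => absurd ⟨e.symm i, by simp⟩ hi]
  rfl

/-- `r` blocks, each with a first part of length `a` and a second part of length `b`. -/
def pairEquiv (r a b : ℕ) : Fin (r * (a + b)) ≃ Fin r × (Fin a ⊕ Fin b) :=
  finProdFinEquiv.symm.trans (Equiv.prodCongr (Equiv.refl _) finSumFinEquiv.symm)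

def fstPart {r a b : ℕ} (y : Bits (r * (a + b))) (i : Fin r) : Bits a :=
  fun j => y ((pairEquiv r a b).symm (i, Sum.inl j))

def sndPart {r a b : ℕ} (y : Bits (r * (a + b))) (i : Fin r) : Bits b :=
  fun j => y ((pairEquiv r a b).symm (i, Sum.inr j))

/-- A string is determined by its parts. -/
def partsEquiv (r a b : ℕ) : Bits (r * (a + b)) ≃ (Fin r → Bits a) × (Fin r → Bits b) where
  toFun y := (fstPart y, sndPart y)
  invFun p := fun q => Sum.elim (p.1 (pairEquiv r a b q).1) (p.2 (pairEquiv r a b q).1)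
    (pairEquiv r a b q).2
  left_inv y := by
    ext q
    obtain ⟨⟨i, j | j⟩, rfl⟩ := (pairEquiv r a b).symm.surjective q <;> simp [fstPart, sndPart]
  right_inv p := by
    ext i j <;> simp [fstPart, sndPart]

theorem tensor_eq_ptr {a b : ℕ} (ρ : Op a) (σ : Op b) :
    ptr finSumFinEquiv.symm.toEmbedding (tens₂ ρ σ) = tensor ρ σ := by
  ext x y
  rw [ptr_equiv]
  simp [tensor, tens₂, Function.comp_def]

theorem tensorPow_eq_ptr {a : ℕ} (t : ℕ) (ρ : Op a) :
    ptr finProdFinEquiv.symm.toEmbedding (tens fun _ : Fin t => ρ) = tensorPow t ρ := by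
  ext x y
  rw [ptr_equiv]
  simp [tensorPow, tens]

theorem IsQState.tensor {a b : ℕ} {ρ : Op a} {σ : Op b} (h : IsQState ρ) (h' : IsQState σ) :
    IsQState (tensor ρ σ) := by
  rw [← tensor_eq_ptr]
  exact (h.tens₂ h').ptr _

theorem IsQState.tensorPow {a : ℕ} {ρ : Op a} (h : IsQState ρ) (t : ℕ) :
    IsQState (tensorPow t ρ) := by
  rw [← tensorPow_eq_ptr]
  exact (IsQState.tens fun _ => h).ptr _

theorem isQState_ketbra {a : ℕ} (x : Bits a) : IsQState (ketbra x) := isQState_single x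

theorem IsQState.circuit {a b : ℕ} {ρ : Op a} (h : IsQState ρ) (C : Circuit a b) :
    IsQState (C.run ρ) := by
  rw [C.run_eq]
  exact h.run _

/-! #### Uniformly random bits -/

/-- The operator with all entries `1`. -/
def oneOp (α : Type) : QOp α := fun _ _ => 1

/-- A single uniformly random bit. -/
def coinNet : Net Unit Empty Unit := ⟨[.H ()], .ofIsEmpty, .refl _⟩

theorem run_coinNet (y : Unit → Bool) : coinNet.run (oneOp Empty) y y = 1 / 2 := by
  have hs : ((Real.sqrt 2 : ℝ) : ℂ)⁻¹ * ((Real.sqrt 2 : ℝ) : ℂ)⁻¹ = 1 / 2 := by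
    rw [← mul_inv, ← Complex.ofReal_mul, Real.mul_self_sqrt (by norm_num)]
    norm_num
  have hu : (Finset.univ : Finset (Unit → Bool)) = {fun _ => false, fun _ => true} := by
    decide
  have hne : (fun _ => false : Unit → Bool) ≠ fun _ => true := fun h => by
    simpa using congrFun h ()
  have hy : y = fun _ => y () := rfl
  simp only [coinNet, Net.run]
  rw [ptr_refl, evo_cons, evo_nil, Matrix.mul_apply, hu, Finset.sum_pair hne,
    Matrix.mul_apply, Matrix.mul_apply, hu, Finset.sum_pair hne, Finset.sum_pair hne, hy]
  cases y () <;> simp [Gate.mat, prep, oneOp, hs]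

/-- Uniformly random bits. -/
def coinsNet (ℓ : ℕ) : Net (Fin ℓ × Unit) Empty (Fin ℓ) :=
  (Net.power (List.finRange ℓ) fun _ => coinNet).restrict .ofIsEmpty
    (Equiv.prodPUnit (Fin ℓ)).symm.toEmbedding

theorem prep_of_isEmpty [IsEmpty α] [IsEmpty β] (f : α ↪ β) :
    prep f (oneOp α) = oneOp β := by
  ext x y
  exact if_pos fun i => isEmptyElim i

theorem run_coinsNet (ℓ : ℕ) (y : Bits ℓ) :
    (coinsNet ℓ).run (oneOp Empty) y y = (1 / 2) ^ ℓ := by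
  rw [coinsNet, Net.run_restrict, prep_of_isEmpty]
  have : oneOp (Fin ℓ × Empty) = tens fun _ => oneOp Empty := by
    ext x y
    simp [tens, oneOp]
  rw [this, Net.run_power _ (List.nodup_finRange ℓ) (List.mem_finRange), ptr_equiv, tens]
  simp [run_coinNet]

/-- Keys: `r` keys of the given scheme, each with a uniformly random message. -/
def keyNet {κ : ℕ} (kg : Circuit 0 κ) (r ℓ : ℕ) :
    Net (Fin r × (Fin kg.width ⊕ Fin ℓ × Unit)) (Fin 0) (Fin (r * (κ + ℓ))) :=
  (Net.power (List.finRange r) fun _ => kg.net.par (coinsNet ℓ)).restrict .ofIsEmpty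
    (pairEquiv r κ ℓ).toEmbedding

theorem run_keyNet {κ : ℕ} (kg : Circuit 0 κ) (r ℓ : ℕ) (y : Bits (r * (κ + ℓ))) :
    (keyNet kg r ℓ).run (ketbra Fin.elim0) y y =
      ∏ i, kg.run (ketbra Fin.elim0) (fstPart y i) (fstPart y i) * (1 / 2) ^ ℓ := by
  have h0 : ketbra Fin.elim0 = oneOp (Fin 0) := by
    ext x y
    simp [ketbra, oneOp, Subsingleton.elim (Fin.elim0 : Bits 0) x,
      Subsingleton.elim x y]
  rw [keyNet, Net.run_restrict, h0, prep_of_isEmpty]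
  have : oneOp (Fin r × (Fin 0 ⊕ Empty)) =
      tens fun _ => tens₂ (oneOp (Fin 0)) (oneOp Empty) := by
    ext x y
    simp [tens, tens₂, oneOp]
  rw [this, Net.run_power _ (List.nodup_finRange r) (List.mem_finRange), ptr_equiv, tens]
  refine Finset.prod_congr rfl fun i _ => ?_
  rw [Net.run_par, tens₂, kg.run_eq]
  congr 1
  exact run_coinsNet ℓ _

/-! #### Generating states -/

/-- Encrypt and keep a copy of the message. -/
def encNet {κ ℓ m : ℕ} (enc : Circuit (κ + ℓ) m) :
    Net (Fin enc.width ⊕ Fin ℓ) (Fin (κ + ℓ)) (Fin m ⊕ Fin ℓ) :=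
  ⟨((List.finRange ℓ).map fun j =>
      .CNOT (.inl (Fin.castLE enc.in_le (Fin.natAdd κ j))) (.inr j) Sum.inl_ne_inr) ++
    enc.gates.map (Gate.map .inl), (Fin.castLEEmb enc.in_le).trans .inl,
    (Fin.castLEEmb enc.out_le).sumMap (.refl _)⟩

theorem prep_single (f : κ ↪ ι) (x : κ → Bool) : prep f (Matrix.single x x 1) =
    Matrix.single (Function.extend f x fun _ => false) (Function.extend f x fun _ => false) 1 := by
  classical
  have key : ∀ y : ι → Bool, Function.extend f x (fun _ => false) = y ↔
      x = y ∘ f ∧ ∀ i, i ∉ Set.range f → y i = false := by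
    intro y
    constructor
    · rintro rfl
      exact ⟨(extend_comp f _ _).symm, fun i hi => extend_off f _ _ hi⟩
    · rintro ⟨rfl, h⟩
      exact eq_extend f fun i hi => (h i hi).symm
  ext y z
  simp only [prep, Matrix.single_apply, key, forall_and]
  rw [← ite_and]
  exact if_congr (by tauto) rfl rfl

theorem evo_classical_single (gs : List (Gate ι)) (h : ∀ g ∈ gs, g.IsClassical)
    (x y : ι → Bool) (hy : gs.foldr Gate.act y = x) :
    evo gs (Matrix.single x x 1) = Matrix.single y y 1 := by
  have hinj : Function.Injective fun z : ι → Bool => gs.foldr Gate.act z := by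
    clear hy h
    induction gs with
    | nil => exact fun a b hab => hab
    | cons g gs ih => exact (Function.Involutive.injective g.act_act).comp ih
  have key : ∀ z, x = gs.foldr Gate.act z ↔ y = z := fun z => by
    rw [← hy]
    exact hinj.eq_iff
  ext z w
  rw [evo_classical gs h]
  simp only [Matrix.single_apply, key]

theorem tens₂_single (x : α → Bool) (y : β → Bool) :
    tens₂ (Matrix.single x x 1) (Matrix.single y y 1) =
      Matrix.single (Sum.elim x y) (Sum.elim x y) 1 := by
  have key : ∀ z : α ⊕ β → Bool, Sum.elim x y = z ↔ x = z ∘ Sum.inl ∧ y = z ∘ Sum.inr := by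
    intro z
    constructor
    · rintro rfl
      simp
    · rintro ⟨rfl, rfl⟩
      simp
  ext z w
  simp only [tens₂, Matrix.single_apply, key]
  rw [ite_zero_mul_ite_zero, mul_one]
  exact if_congr and_and_and_comm rfl rfl

theorem run_encNet {κ ℓ m : ℕ} (enc : Circuit (κ + ℓ) m) (z : Bits (κ + ℓ)) :
    (encNet enc).run (ketbra z) =
      tens₂ (enc.run (ketbra z)) (ketbra fun j => z (Fin.natAdd κ j)) := by
  set x : Bits ℓ := fun j => z (Fin.natAdd κ j) with hx
  set w : Bits enc.width := Function.extend (Fin.castLEEmb enc.in_le) z fun _ => false with hw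
  have hprep : prep (encNet enc).inp (ketbra z) =
      Matrix.single (Sum.elim w fun _ => false) (Sum.elim w fun _ => false) 1 := by
    rw [ketbra, prep_single]
    have : Function.extend (encNet enc).inp z (fun _ => false) = Sum.elim w fun _ => false := by
      refine (extend_trans (Fin.castLEEmb enc.in_le) .inl z fun _ => false).trans ?_
      ext (i | j)
      · exact Function.Embedding.inl.injective.extend_apply _ _ i
      · exact extend_off .inl _ _ (by simp)
    rw [this]
  have hfold : ∀ l : List (Fin ℓ), l.Nodup → (l.map fun j => (.CNOT
      (.inl (Fin.castLE enc.in_le (Fin.natAdd κ j))) (.inr j) Sum.inl_ne_inr :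
        Gate (Fin enc.width ⊕ Fin ℓ))).foldr Gate.act (Sum.elim w x) =
      Sum.elim w fun j => if j ∈ l then false else x j := by
    intro l hl
    induction l with
    | nil => simp
    | cons j l ih =>
      rw [List.nodup_cons] at hl
      rw [List.map_cons, List.foldr_cons, ih hl.2]
      have hwj : w (Fin.castLE enc.in_le (Fin.natAdd κ j)) = x j :=
        (Fin.castLEEmb enc.in_le).injective.extend_apply z _ (Fin.natAdd κ j)
      ext (i | k)
      · simp [Gate.act]
      · by_cases hk : k = j
        · subst hk
          simp [Gate.act, hl.1, hwj]
        · simp [Gate.act, hk]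
  rw [Net.run, hprep, encNet, evo_append,
    evo_classical_single _ (by simp [Gate.IsClassical]) _ (Sum.elim w x)
      (by rw [hfold _ (List.nodup_finRange ℓ)]; simp), ← tens₂_single, evo_tens₂_inl, ptr_tens₂,
    ptr_refl, enc.run_eq, Net.run, ketbra, Circuit.net, prep_single]
  rfl

/-- Encrypt `r` messages with independent keys. -/
def stateNet {κ ℓ m : ℕ} (enc : Circuit (κ + ℓ) m) (r : ℕ) :
    Net (Fin r × (Fin enc.width ⊕ Fin ℓ)) (Fin (r * (κ + ℓ))) (Fin (r * (m + ℓ))) :=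
  (Net.power (List.finRange r) fun _ => encNet enc).restrict
    finProdFinEquiv.symm.toEmbedding (pairEquiv r m ℓ).toEmbedding

/-- The state consisting of `r` pairs of a state `ρ i` and a string `X i`. -/
def pairState {r m ℓ : ℕ} (ρ : Fin r → Op m) (X : Fin r → Bits ℓ) : Op (r * (m + ℓ)) :=
  fun x y => ∏ i, ρ i (fstPart x i) (fstPart y i) * ketbra (X i) (sndPart x i) (sndPart y i)

theorem pairState_eq_ptr {r m ℓ : ℕ} (ρ : Fin r → Op m) (X : Fin r → Bits ℓ) :
    pairState ρ X = ptr (pairEquiv r m ℓ).toEmbedding (tens fun i => tens₂ (ρ i) (ketbra (X i))) := by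
  ext x y
  rw [ptr_equiv]
  rfl

theorem isQState_pairState {r m ℓ : ℕ} {ρ : Fin r → Op m} (h : ∀ i, IsQState (ρ i))
    (X : Fin r → Bits ℓ) : IsQState (pairState ρ X) := by
  rw [pairState_eq_ptr]
  exact (IsQState.tens fun i => (h i).tens₂ (isQState_ketbra _)).ptr _

theorem tensor_ketbra {a b : ℕ} (z : Bits (a + b)) :
    tensor (ketbra fun i => z (Fin.castAdd b i)) (ketbra fun j => z (Fin.natAdd a j)) =
      ketbra z := by
  have key : ∀ x : Bits (a + b), z = x ↔ (fun i => z (Fin.castAdd b i)) =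
      (fun i => x (Fin.castAdd b i)) ∧ (fun j => z (Fin.natAdd a j)) =
        fun j => x (Fin.natAdd a j) := by
    intro x
    refine ⟨fun h => by simp [h], fun h => ?_⟩
    ext i
    refine Fin.addCases (fun i => ?_) (fun j => ?_) i
    · exact congrFun h.1 i
    · exact congrFun h.2 j
  ext x y
  simp only [tensor, ketbra, Matrix.single_apply, key x, key y]
  rw [ite_zero_mul_ite_zero, mul_one]
  exact if_congr and_and_and_comm rfl rfl

theorem run_stateNet {κ ℓ m : ℕ} (enc : Circuit (κ + ℓ) m) (r : ℕ) (y : Bits (r * (κ + ℓ))) :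
    (stateNet enc r).run (ketbra y) =
      pairState (fun i => enc.run (tensor (ketbra (fstPart y i)) (ketbra (sndPart y i))))
        (sndPart y) := by
  have hprep : prep (finProdFinEquiv (m := r) (n := κ + ℓ)).symm.toEmbedding (ketbra y) =
      tens fun i => ketbra fun j => y (finProdFinEquiv (i, j)) := by
    have key : ∀ x : Fin r × Fin (κ + ℓ) → Bool, (y = x ∘ finProdFinEquiv.symm) ↔
        ∀ i, (fun j => y (finProdFinEquiv (i, j))) = fun j => x (i, j) := by
      intro x
      refine ⟨fun h i => by simp [h], fun h => ?_⟩
      ext q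
      obtain ⟨⟨i, j⟩, rfl⟩ := finProdFinEquiv.surjective q
      simpa using congrFun (h i) j
    ext x z
    rw [prep_equiv]
    simp only [ketbra, tens, Matrix.single_apply, key]
    by_cases hxz : (∀ i, (fun j => y (finProdFinEquiv (i, j))) = fun j => x (i, j)) ∧
        ∀ i, (fun j => y (finProdFinEquiv (i, j))) = fun j => z (i, j)
    · rw [if_pos hxz]
      exact (Finset.prod_eq_one fun i _ => if_pos ⟨hxz.1 i, hxz.2 i⟩).symm
    · rw [if_neg hxz]
      rw [← forall_and] at hxz
      obtain ⟨i, hi⟩ := not_forall.mp hxz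
      exact (Finset.prod_eq_zero (Finset.mem_univ i) (if_neg hi)).symm
  rw [stateNet, Net.run_restrict, hprep, Net.run_power _ (List.nodup_finRange r)
    (List.mem_finRange), pairState_eq_ptr]
  congr 2
  ext1 i
  rw [run_encNet, ← tensor_ketbra fun j => y (finProdFinEquiv (i, j))]
  rfl

end

section

/-! #### Verification -/

/-- Decrypt and compare with the given message: the output is the string of all `1` if and only
if the two agree. The second half of the key is not used. -/
def decNet {κ ℓ m : ℕ} (dec : Circuit (κ + m) ℓ) :
    Net (Fin dec.width ⊕ (Fin ℓ ⊕ Fin ℓ)) ((Fin κ ⊕ Fin ℓ) ⊕ (Fin m ⊕ Fin ℓ)) (Fin ℓ) where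
  gates := dec.gates.map (Gate.map .inl) ++ (List.finRange ℓ).flatMap fun j =>
    [.CNOT (.inl (Fin.castLE dec.out_le j)) (.inr (.inl j)) Sum.inl_ne_inr, .X (.inr (.inl j))]
  inp := ⟨Sum.elim
      (Sum.elim (fun j => .inl (Fin.castLE dec.in_le (Fin.castAdd m j))) fun j => .inr (.inr j))
      (Sum.elim (fun j => .inl (Fin.castLE dec.in_le (Fin.natAdd κ j))) fun j => .inr (.inl j)), by
    rintro ((a | a) | (a | a)) ((b | b) | (b | b)) h <;>
      simp [Fin.ext_iff] at h ⊢ <;> omega⟩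
  out := ⟨fun j => .inr (.inl j), fun a b h => by simpa using h⟩

theorem decNet_foldr {κ ℓ m : ℕ} (dec : Circuit (κ + m) ℓ) (l : List (Fin ℓ)) (hl : l.Nodup)
    (z : Fin dec.width ⊕ (Fin ℓ ⊕ Fin ℓ) → Bool) :
    (l.flatMap fun j => [.CNOT (.inl (Fin.castLE dec.out_le j)) (.inr (.inl j)) Sum.inl_ne_inr,
      (.X (.inr (.inl j)) : Gate (Fin dec.width ⊕ (Fin ℓ ⊕ Fin ℓ)))]).foldr Gate.act z =
    Sum.elim (fun i => z (.inl i)) (Sum.elim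
      (fun j => if j ∈ l then xor (!z (.inr (.inl j))) (z (.inl (Fin.castLE dec.out_le j)))
        else z (.inr (.inl j))) fun j => z (.inr (.inr j))) := by
  induction l with
  | nil =>
    ext (i | (i | i)) <;> rfl
  | cons j l ih =>
    rw [List.nodup_cons] at hl
    rw [List.flatMap_cons, List.foldr_append, ih hl.2]
    simp only [List.foldr_cons, List.foldr_nil, Gate.act]
    ext (i | (k | k))
    · rw [Function.update_of_ne Sum.inl_ne_inr, Function.update_of_ne Sum.inl_ne_inr]
      rfl
    · by_cases hk : k = j
      · subst hk
        rw [Function.update_self, Function.update_self,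
          Function.update_of_ne Sum.inl_ne_inr]
        simp only [Sum.elim_inr, Sum.elim_inl, hl.1, if_false, List.mem_cons_self, if_true]
      · have h1 : (Sum.inr (Sum.inl k) : Fin dec.width ⊕ (Fin ℓ ⊕ Fin ℓ)) ≠ .inr (.inl j) :=
          fun h => hk (Sum.inl_injective (Sum.inr_injective h))
        rw [Function.update_of_ne h1, Function.update_of_ne h1]
        simp only [Sum.elim_inr, Sum.elim_inl, List.mem_cons, hk, false_or]
    · have h1 : (Sum.inr (Sum.inr k) : Fin dec.width ⊕ (Fin ℓ ⊕ Fin ℓ)) ≠ .inr (.inl j) :=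
        fun h => Sum.inr_ne_inl (Sum.inr_injective h)
      rw [Function.update_of_ne h1, Function.update_of_ne h1]
      rfl

theorem decNet_classical {κ ℓ m : ℕ} (dec : Circuit (κ + m) ℓ) (l : List (Fin ℓ)) :
    ∀ g ∈ l.flatMap fun j => [.CNOT (.inl (Fin.castLE dec.out_le j)) (.inr (.inl j))
      Sum.inl_ne_inr, (.X (.inr (.inl j)) : Gate (Fin dec.width ⊕ (Fin ℓ ⊕ Fin ℓ)))],
      g.IsClassical := by
  intro g hg
  obtain ⟨j, -, hj⟩ := List.mem_flatMap.mp hg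
  rcases List.mem_pair.mp hj with rfl | rfl <;> trivial

theorem prep_decNet {κ ℓ m : ℕ} (dec : Circuit (κ + m) ℓ) (k : Bits κ) (x' x : Bits ℓ)
    (ρ : Op m) :
    prep (decNet dec).inp (tens₂ (tens₂ (ketbra k) (ketbra x')) (tens₂ ρ (ketbra x))) =
      tens₂ (prep dec.net.inp (tensor (ketbra k) ρ)) (tens₂ (ketbra x) (ketbra x')) := by
  classical
  ext y z
  have hr : (∀ i, i ∉ Set.range (decNet dec).inp → y i = false ∧ z i = false) ↔
      ∀ i, i ∉ Set.range dec.net.inp → (y ∘ Sum.inl) i = false ∧ (z ∘ Sum.inl) i = false := by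
    constructor
    · intro h i hi
      refine h _ ?_
      rintro ⟨(a | a) | (a | a), ha⟩
      · exact hi ⟨_, Sum.inl_injective ha⟩
      · exact (Sum.inr_ne_inl ha).elim
      · exact hi ⟨_, Sum.inl_injective ha⟩
      · exact (Sum.inr_ne_inl ha).elim
    · rintro h (i | (i | i)) hi
      · refine h i ?_
        rintro ⟨a, rfl⟩
        refine hi ?_
        refine Fin.addCases (fun a => ?_) (fun a => ?_) a
        · exact ⟨.inl (.inl a), rfl⟩
        · exact ⟨.inr (.inl a), rfl⟩
      · exact absurd ⟨.inr (.inr i), rfl⟩ hi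
      · exact absurd ⟨.inl (.inr i), rfl⟩ hi
  simp only [prep, hr, tens₂]
  by_cases h : ∀ i, i ∉ Set.range dec.net.inp →
      (y ∘ Sum.inl) i = false ∧ (z ∘ Sum.inl) i = false
  · rw [if_pos h, if_pos h, tensor]
    have e1 : ∀ y : Fin dec.width ⊕ (Fin ℓ ⊕ Fin ℓ) → Bool,
      ((y ∘ (decNet dec).inp) ∘ Sum.inl) ∘ Sum.inr = (y ∘ Sum.inr) ∘ Sum.inr := fun _ => rfl
    have e2 : ∀ y : Fin dec.width ⊕ (Fin ℓ ⊕ Fin ℓ) → Bool,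
      ((y ∘ (decNet dec).inp) ∘ Sum.inr) ∘ Sum.inr = (y ∘ Sum.inr) ∘ Sum.inl := fun _ => rfl
    rw [e1, e1, e2, e2]
    have e3 : ∀ y : Fin dec.width ⊕ (Fin ℓ ⊕ Fin ℓ) → Bool,
      ((y ∘ (decNet dec).inp) ∘ Sum.inl) ∘ Sum.inl =
        fun i => ((y ∘ Sum.inl) ∘ dec.net.inp) (Fin.castAdd m i) := fun _ => rfl
    have e4 : ∀ y : Fin dec.width ⊕ (Fin ℓ ⊕ Fin ℓ) → Bool,
      ((y ∘ (decNet dec).inp) ∘ Sum.inr) ∘ Sum.inl =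
        fun i => ((y ∘ Sum.inl) ∘ dec.net.inp) (Fin.natAdd κ i) := fun _ => rfl
    rw [e3, e3, e4, e4]
    ring
  · rw [if_neg h, if_neg h, zero_mul]

theorem run_decNet {κ ℓ m : ℕ} (dec : Circuit (κ + m) ℓ) (k : Bits κ) (x' x : Bits ℓ)
    (ρ : Op m) :
    (decNet dec).run (tens₂ (tens₂ (ketbra k) (ketbra x')) (tens₂ ρ (ketbra x)))
      (fun _ => true) (fun _ => true) = dec.run (tensor (ketbra k) ρ) x x := by
  rw [Net.run, prep_decNet, decNet, evo_append, evo_tens₂_inl, dec.run_eq, Net.run, ptr_diag,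
    ptr_diag]
  change _ = ∑ z : Fin dec.width → Bool, if z ∘ dec.net.out = x then
    evo dec.gates (prep dec.net.inp (tensor (ketbra k) ρ)) z z else 0
  generalize evo dec.gates (prep dec.net.inp (tensor (ketbra k) ρ)) = σ
  refine (Fintype.sum_of_injective (fun z : Fin dec.width → Bool =>
    Sum.elim z (Sum.elim (fun _ => true) x')) (fun a b hab => ?_) _ _ (fun y hy => ?_)
    fun z => ?_).symm
  · exact congrArg (fun f => f ∘ Sum.inl) hab
  · split_ifs with h
    · rw [evo_classical _ (decNet_classical dec _), decNet_foldr dec _ (List.nodup_finRange ℓ)]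
      have : x' ≠ fun j => y (.inr (.inr j)) := by
        intro hx
        refine hy ⟨fun i => y (.inl i), ?_⟩
        ext (i | (i | i))
        · rfl
        · exact (congrFun h i).symm
        · exact congrFun hx i
      have hz : (ketbra x' : Op ℓ) (fun j => y (.inr (.inr j))) (fun j => y (.inr (.inr j))) = 0 := by
        simp [ketbra, this]
      simp only [tens₂]
      refine mul_eq_zero_of_right _ (mul_eq_zero_of_right _ ?_)
      exact hz
    · rfl
  · have h1 : (Sum.elim z (Sum.elim (fun _ => true) x')) ∘
        (decNet dec).out = fun _ => true := rfl
    refine Eq.trans ?_ (if_pos h1).symm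
    rw [evo_classical _ (decNet_classical dec _), decNet_foldr dec _ (List.nodup_finRange ℓ)]
    simp only [tens₂]
    have h2 : (Sum.elim (fun i => (Sum.elim z (Sum.elim (fun _ => true) x') :
        Fin dec.width ⊕ (Fin ℓ ⊕ Fin ℓ) → Bool) (.inl i)) (Sum.elim
      (fun j => if j ∈ List.finRange ℓ then xor (!(Sum.elim z (Sum.elim (fun _ => true) x') :
        Fin dec.width ⊕ (Fin ℓ ⊕ Fin ℓ) → Bool) (.inr (.inl j))) ((Sum.elim z
          (Sum.elim (fun _ => true) x') : Fin dec.width ⊕ (Fin ℓ ⊕ Fin ℓ) → Bool)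
            (.inl (Fin.castLE dec.out_le j)))
        else (Sum.elim z (Sum.elim (fun _ => true) x') :
        Fin dec.width ⊕ (Fin ℓ ⊕ Fin ℓ) → Bool) (.inr (.inl j))) fun j =>
          (Sum.elim z (Sum.elim (fun _ => true) x') :
        Fin dec.width ⊕ (Fin ℓ ⊕ Fin ℓ) → Bool) (.inr (.inr j)))) =
        Sum.elim z (Sum.elim (z ∘ dec.net.out) x') := by
      ext (i | (i | i))
      · rfl
      · simp [Circuit.net]
      · rfl
    rw [h2]
    simp only [Sum.elim_comp_inl, Sum.elim_comp_inr, ketbra, Matrix.single_apply, and_self,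
      if_true, mul_one, eq_comm (a := x), mul_ite, mul_zero]

/-- The conjunction of `N` bits. -/
def andNet (N : ℕ) : Net (Fin N ⊕ Fin (N + 1)) (Fin N) (Fin 1) :=
  ⟨.X (.inr 0) :: (List.finRange N).map fun q =>
      .Toffoli (.inl q) (.inr q.castSucc) (.inr q.succ) Sum.inl_ne_inr Sum.inl_ne_inr
        (fun h => (Fin.castSucc_lt_succ (i := q)).ne (Sum.inr_injective h)),
    .inl, ⟨fun _ => .inr (Fin.last N), fun _ _ _ => Subsingleton.elim _ _⟩⟩

/-- The content of the wires of the conjunction network at the end. -/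
def andTrace {N : ℕ} (x : Bits N) : Fin N ⊕ Fin (N + 1) → Bool :=
  Sum.elim x fun q => decide (∀ j : Fin N, j.val < q.val → x j = true)

theorem andTrace_succ {N : ℕ} (x : Bits N) (q : Fin N) :
    andTrace x (.inr q.succ) = (x q && andTrace x (.inr q.castSucc)) := by
  rw [Bool.eq_iff_iff]
  simp only [andTrace, Sum.elim_inr, Fin.val_succ, Fin.val_castSucc, decide_eq_true_eq,
    Bool.and_eq_true]
  refine ⟨fun h => ⟨h q (by omega), fun j hj => h j (by omega)⟩, fun h j hj => ?_⟩
  rcases Nat.lt_succ_iff_lt_or_eq.mp hj with hj | hj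
  · exact h.2 j hj
  · rw [Fin.ext hj]
    exact h.1

theorem andNet_foldr {N : ℕ} (x : Bits N) (l : List (Fin N)) (hl : l.Pairwise (· < ·)) :
    (l.map fun q => (.Toffoli (.inl q) (.inr q.castSucc) (.inr q.succ) Sum.inl_ne_inr
      Sum.inl_ne_inr (fun h => (Fin.castSucc_lt_succ (i := q)).ne (Sum.inr_injective h)) :
        Gate (Fin N ⊕ Fin (N + 1)))).foldr Gate.act (andTrace x) =
    Sum.elim x fun q => if ∃ j ∈ l, q = j.succ then false else andTrace x (.inr q) := by
  induction l with
  | nil =>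
    ext (i | i) <;> simp [andTrace]
  | cons q l ih =>
    rw [List.pairwise_cons] at hl
    rw [List.map_cons, List.foldr_cons, ih hl.2]
    ext (i | i)
    · simp [Gate.act]
    · by_cases hi : i = q.succ
      · subst hi
        have h1 : ¬∃ j ∈ l, q.succ = j.succ := by
          rintro ⟨j, hj, h⟩
          exact (hl.1 j hj).ne (Fin.succ_injective _ h)
        have h2 : ¬∃ j ∈ l, q.castSucc = j.succ := by
          rintro ⟨j, hj, h⟩
          have := hl.1 j hj
          have h' := congrArg Fin.val h
          simp at h'
          omega
        simp only [Gate.act, Sum.elim_inr, Sum.elim_inl, h1, h2, if_false, Function.update_self,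
          andTrace_succ, Bool.xor_self]
        simp
      · simp [Gate.act, hi]

theorem run_andNet (N : ℕ) (σ : Op N) : (andNet N).run σ (fun _ => true) (fun _ => true) =
    σ (fun _ => true) fun _ => true := by
  classical
  have hcl : ∀ g ∈ (andNet N).gates, g.IsClassical := by simp [andNet, Gate.IsClassical]
  have hF : ∀ x : Bits N, (andNet N).gates.foldr Gate.act (andTrace x) =
      Sum.elim x fun _ => false := by
    intro x
    rw [andNet, List.foldr_cons, andNet_foldr x _ (List.pairwise_lt_finRange N)]
    ext (i | i)
    · simp [Gate.act]
    · refine Fin.cases ?_ (fun j => ?_) i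
      · simp [Gate.act, andTrace, eq_comm (a := (0 : Fin (N + 1)))]
      · simp [Gate.act]
  have hinj : Function.Injective fun z => (andNet N).gates.foldr Gate.act z := by
    generalize (andNet N).gates = gs
    induction gs with
    | nil => exact fun a b hab => hab
    | cons g gs ih => exact (Function.Involutive.injective g.act_act).comp ih
  rw [Net.run, ptr_diag]
  simp only [evo_classical _ hcl]
  have : σ (fun _ => true) (fun _ => true) =
      ∑ x : Bits N, if (fun _ => true) = x then σ x x else 0 := by simp
  rw [this]
  refine (Fintype.sum_of_injective (fun x : Bits N => andTrace x) (fun a b hab => ?_) _ _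
    (fun z hz => ?_) fun x => ?_).symm
  · exact congrArg (fun f => f ∘ Sum.inl) hab
  · split_ifs with h
    · rw [prep, if_neg]
      intro h0
      refine hz ⟨(andNet N).gates.foldr Gate.act z ∘ Sum.inl, hinj ?_⟩
      simp only [hF]
      ext (i | i)
      · rfl
      · exact (h0 (.inr i) (by rintro ⟨k, hk⟩; simp [andNet] at hk)).1.symm
    · rfl
  · have h1 : (andTrace x ∘ (andNet N).out = fun _ => true) ↔ (fun _ => true) = x := by
      constructor
      · intro h
        have := congrFun h 0
        ext j
        exact ((of_decide_eq_true this : ∀ j : Fin N, j.val < N → x j = true) j j.isLt).symm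
      · rintro rfl
        ext
        simp [andNet, andTrace]
    have h2 : prep (andNet N).inp σ (Sum.elim x fun _ => false) (Sum.elim x fun _ => false) =
        σ x x := by
      refine if_pos ?_
      rintro (i | i) hi
      · exact absurd ⟨i, rfl⟩ hi
      · exact ⟨rfl, rfl⟩
    rw [hF, h2]
    exact (if_congr h1 rfl rfl).symm

/-- `r` keys followed by `r` states. -/
def verEquiv (r a b c : ℕ) : Fin (r * (a + b) + r * (c + b)) ≃
    Fin r × ((Fin a ⊕ Fin b) ⊕ (Fin c ⊕ Fin b)) :=
  (finSumFinEquiv.symm.trans (Equiv.sumCongr (pairEquiv r a b) (pairEquiv r c b))).trans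
    (Equiv.prodSumDistrib _ _ _).symm

/-- The embedding of the wires of the conjunction. -/
def verEmb {κ ℓ m : ℕ} (dec : Circuit (κ + m) ℓ) (r : ℕ) : Fin (r * ℓ) ⊕ Fin (r * ℓ + 1) ↪
    Fin r × (Fin dec.width ⊕ (Fin ℓ ⊕ Fin ℓ)) ⊕ Fin (r * ℓ + 1) :=
  (finProdFinEquiv.symm.toEmbedding.trans (prodEmb fun _ => (decNet dec).out)).sumMap (.refl _)

/-- Decrypt `r` ciphertexts and compare with the given messages. -/
def verNet {κ ℓ m : ℕ} (dec : Circuit (κ + m) ℓ) (r : ℕ) :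
    Net (Fin r × (Fin dec.width ⊕ (Fin ℓ ⊕ Fin ℓ)) ⊕ Fin (r * ℓ + 1))
      (Fin (r * (κ + ℓ) + r * (m + ℓ))) (Fin 1) :=
  ((Net.power (List.finRange r) fun _ => decNet dec).restrict (verEquiv r κ ℓ m).toEmbedding
    finProdFinEquiv.symm.toEmbedding).glue (andNet (r * ℓ)) .inl (verEmb dec r)

theorem run_verNet {κ ℓ m : ℕ} (dec : Circuit (κ + m) ℓ) (r : ℕ) (k : Bits (r * (κ + ℓ)))
    (ρ : Fin r → Op m) (X : Fin r → Bits ℓ) :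
    (verNet dec r).run (tensor (ketbra k) (pairState ρ X)) (fun _ => true) (fun _ => true) =
      ∏ i, dec.run (tensor (ketbra (fstPart k i)) (ρ i)) (X i) (X i) := by
  have hprep : prep (verEquiv r κ ℓ m).toEmbedding (tensor (ketbra k) (pairState ρ X)) =
      tens fun i => tens₂ (tens₂ (ketbra (fstPart k i)) (ketbra (sndPart k i)))
        (tens₂ (ρ i) (ketbra (X i))) := by
    have hk : ∀ z : Bits (r * (κ + ℓ)), k = z ↔
        ∀ i, fstPart k i = fstPart z i ∧ sndPart k i = sndPart z i := by
      intro z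
      refine ⟨fun h i => by simp [h], fun h => (partsEquiv r κ ℓ).injective ?_⟩
      exact Prod.ext (funext fun i => (h i).1) (funext fun i => (h i).2)
    have hket : ∀ y z : Bits (r * (κ + ℓ)), ketbra k y z =
        ∏ i, ketbra (fstPart k i) (fstPart y i) (fstPart z i) *
          ketbra (sndPart k i) (sndPart y i) (sndPart z i) := by
      intro y z
      simp only [ketbra, Matrix.single_apply, hk y, hk z, ite_zero_mul_ite_zero, mul_one]
      rw [Finset.prod_ite_zero]
      simp only [Finset.prod_const_one, Finset.mem_univ, true_imp_iff, ← forall_and]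
      exact if_congr (forall_congr' fun i => and_and_and_comm) rfl rfl
    ext y z
    rw [prep_equiv, tensor, hket, pairState, ← Finset.prod_mul_distrib]
    refine Finset.prod_congr rfl fun i _ => ?_
    have e1 : ∀ y : Fin r × ((Fin κ ⊕ Fin ℓ) ⊕ (Fin m ⊕ Fin ℓ)) → Bool,
        fstPart (fun q => (y ∘ verEquiv r κ ℓ m) (Fin.castAdd (r * (m + ℓ)) q)) i =
          fun j => y (i, .inl (.inl j)) := fun y => by
      ext j; simp [fstPart, verEquiv]
    have e2 : ∀ y : Fin r × ((Fin κ ⊕ Fin ℓ) ⊕ (Fin m ⊕ Fin ℓ)) → Bool,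
        sndPart (fun q => (y ∘ verEquiv r κ ℓ m) (Fin.castAdd (r * (m + ℓ)) q)) i =
          fun j => y (i, .inl (.inr j)) := fun y => by
      ext j; simp [sndPart, verEquiv]
    have e3 : ∀ y : Fin r × ((Fin κ ⊕ Fin ℓ) ⊕ (Fin m ⊕ Fin ℓ)) → Bool,
        fstPart (fun q => (y ∘ verEquiv r κ ℓ m) (Fin.natAdd (r * (κ + ℓ)) q)) i =
          fun j => y (i, .inr (.inl j)) := fun y => by
      ext j; simp [fstPart, verEquiv]
    have e4 : ∀ y : Fin r × ((Fin κ ⊕ Fin ℓ) ⊕ (Fin m ⊕ Fin ℓ)) → Bool,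
        sndPart (fun q => (y ∘ verEquiv r κ ℓ m) (Fin.natAdd (r * (κ + ℓ)) q)) i =
          fun j => y (i, .inr (.inr j)) := fun y => by
      ext j; simp [sndPart, verEquiv]
    rw [e1, e1, e2, e2, e3, e3, e4, e4]
    rfl
  rw [verNet, Net.run_glue _ _ _ _ (fun _ => rfl), run_andNet, Net.run_restrict, hprep,
    Net.run_power _ (List.nodup_finRange r) (List.mem_finRange), ptr_equiv, tens]
  · exact Finset.prod_congr rfl fun i _ => run_decNet dec _ _ _ _
  · rintro (j | j) hj
    · exact absurd ⟨j, rfl⟩ hj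
    · rintro ⟨i, hi⟩
      simp [verEmb] at hi

end

section

/-! ### Polynomial bounds -/

theorem PolyBounded.mono {f g : ℕ → ℕ} (hg : PolyBounded g) (h : ∀ n, f n ≤ g n) :
    PolyBounded f := by
  obtain ⟨p, hp⟩ := hg
  exact ⟨p, fun n => (h n).trans (hp n)⟩

theorem PolyBounded.add {f g : ℕ → ℕ} (hf : PolyBounded f) (hg : PolyBounded g) :
    PolyBounded fun n => f n + g n := by
  obtain ⟨p, hp⟩ := hf
  obtain ⟨q, hq⟩ := hg
  exact ⟨p + q, fun n => by simpa using add_le_add (hp n) (hq n)⟩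

theorem PolyBounded.mul {f g : ℕ → ℕ} (hf : PolyBounded f) (hg : PolyBounded g) :
    PolyBounded fun n => f n * g n := by
  obtain ⟨p, hp⟩ := hf
  obtain ⟨q, hq⟩ := hg
  exact ⟨p * q, fun n => by simpa using Nat.mul_le_mul (hp n) (hq n)⟩

theorem polyBounded_const (c : ℕ) : PolyBounded fun _ => c := ⟨.C c, fun n => by simp⟩

theorem polyBounded_id : PolyBounded fun n => n := ⟨.X, fun n => by simp⟩

theorem polyBounded_eval (p : Polynomial ℕ) : PolyBounded fun n => p.eval n :=
  ⟨p, fun _ => le_rfl⟩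

theorem Circuit.width_le_size {a b : ℕ} (C : Circuit a b) : C.width ≤ C.size :=
  Nat.le_add_right _ _

theorem Circuit.gates_le_size {a b : ℕ} (C : Circuit a b) : C.gates.length ≤ C.size :=
  Nat.le_add_left _ _

theorem Circuit.in_le_size {a b : ℕ} (C : Circuit a b) : a ≤ C.size :=
  C.in_le.trans C.width_le_size

theorem Circuit.out_le_size {a b : ℕ} (C : Circuit a b) : b ≤ C.size :=
  C.out_le.trans C.width_le_size

theorem Gate.length_encode {w : ℕ} (g : Gate (Fin w)) : g.encode.length = 4 := by
  cases g <;> rfl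

theorem Circuit.length_encode {a b : ℕ} (C : Circuit a b) :
    C.encode.length = 3 + 4 * C.gates.length := by
  simp [Circuit.encode, List.length_flatMap, Gate.length_encode]
  omega

theorem Circuit.mem_encode_le {a b : ℕ} (C : Circuit a b) {x : ℕ} (hx : x ∈ C.encode) :
    x ≤ C.size + 4 := by
  have hw := C.width_le_size
  simp only [Circuit.encode, List.mem_cons, List.mem_flatMap] at hx
  rcases hx with rfl | rfl | rfl | ⟨g, -, hg⟩
  · exact C.in_le_size.trans (Nat.le_add_right _ _)
  · exact C.out_le_size.trans (Nat.le_add_right _ _)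
  · omega
  · cases g <;> simp only [Gate.encode, List.mem_cons, List.not_mem_nil, or_false] at hg <;>
      omega

/-! ### Generators for circuits -/

/-- The generator of the empty list. -/
def Gen.nil : Gen := .rep 0 (.const 0) (.emit (.const 0))

def Gen.emits : List Ex → Gen
  | [] => .nil
  | e :: l => .seq (.emit e) (Gen.emits l)

theorem Gen.eval_nil (F : ℕ → List ℕ) (env : ℕ → ℕ) : Gen.nil.eval F env = [] := rfl

theorem Gen.eval_emits (F : ℕ → List ℕ) (env : ℕ → ℕ) (l : List Ex) :
    (Gen.emits l).eval F env = l.map fun e => e.eval F env := by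
  induction l with
  | nil => rfl
  | cons e l ih => rw [Gen.emits, Gen.eval, ih]; rfl

def Gen.swap (p q : Ex) : Gen :=
  .emits [.const 3, p, q, .const 0, .const 3, q, p, .const 0, .const 3, p, q, .const 0]

theorem Gen.eval_swap (F : ℕ → List ℕ) (env : ℕ → ℕ) (p q : Ex) :
    (Gen.swap p q).eval F env = swapCode (p.eval F env) (q.eval F env) := by
  rw [Gen.swap, Gen.eval_emits]
  rfl

/-- The gates of the circuit in file `k`, all wires being shifted by `o`; variable `v` is used as
a counter. -/
def Gen.shift (k v : ℕ) (o : Ex) : Gen :=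
  let fld : ℕ → Ex := fun s => .look k (.add (.const (3 + s)) (.mul (.const 4) (.var v)))
  .rep v (.len k) (.ite (.sub (.len k) (.add (.const 6) (.mul (.const 4) (.var v))))
    (.seq (.emits [fld 0, .add o (fld 1)])
      (.seq (.ite (.sub (fld 0) (.const 2)) (.emit (.add o (fld 2))) (.emit (.const 0)))
        (.ite (.sub (fld 0) (.const 3)) (.emit (.add o (fld 3))) (.emit (.const 0))))) .nil)

theorem flatMap_range_blocks {A : Type} (enc : A → List ℕ) (henc : ∀ a, (enc a).length = 4)
    (H : (ℕ → ℕ) → List ℕ) (hH : ∀ f g : ℕ → ℕ, (∀ s < 4, f s = g s) → H f = H g)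
    (gs : List A) (n : ℕ) (hn : gs.length ≤ n) :
    ((List.range n).flatMap fun q => if q < gs.length then
      H (fun s => (gs.flatMap enc).getD (4 * q + s) 0) else []) =
      gs.flatMap fun g => H fun s => (enc g).getD s 0 := by
  induction gs generalizing n with
  | nil => simp
  | cons g gs ih =>
    obtain ⟨n, rfl⟩ : ∃ m, n = m + 1 := ⟨n - 1, by simp at hn; omega⟩
    rw [List.range_succ_eq_map, List.flatMap_cons, List.flatMap_cons (xs := gs) (f := fun g => H _),
      List.flatMap_map, ← ih n (by simpa using hn)]
    congr 1
    · rw [if_pos (by simp)]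
      refine hH _ _ fun s hs => ?_
      rw [mul_zero, zero_add, List.flatMap_cons, List.getD_append _ _ _ _ (by rw [henc]; exact hs)]
    · congr 1
      ext1 q
      simp only [List.length_cons, Nat.succ_eq_add_one, Nat.add_lt_add_iff_right]
      congr 2
      ext1 s
      rw [List.flatMap_cons, List.getD_append_right _ _ _ _ (by rw [henc]; omega), henc]
      congr 1
      omega

theorem Gen.eval_shift {a b : ℕ} (C : Circuit a b) (F : ℕ → List ℕ) (env : ℕ → ℕ) (k v : ℕ)
    (o : Ex) (o' : ℕ) (hF : F k = C.encode)
    (ho : ∀ q, o.eval F (Function.update env v q) = o') :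
    (Gen.shift k v o).eval F env = C.gates.flatMap (Gate.code fun i => o' + i.val) := by
  have h := flatMap_range_blocks (Gate.encode (w := C.width)) Gate.length_encode
    (fun f => [f 0, o' + f 1] ++ ((if f 0 - 2 ≠ 0 then [o' + f 2] else [0]) ++
      if f 0 - 3 ≠ 0 then [o' + f 3] else [0])) (fun f g hfg => by
        simp [hfg 0, hfg 1, hfg 2, hfg 3]) C.gates (F k).length (by
        rw [hF, C.length_encode]; omega)
  have hcode : ∀ g : Gate (Fin C.width),
      ([g.encode.getD 0 0, o' + g.encode.getD 1 0] ++
        ((if g.encode.getD 0 0 - 2 ≠ 0 then [o' + g.encode.getD 2 0] else [0]) ++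
          if g.encode.getD 0 0 - 3 ≠ 0 then [o' + g.encode.getD 3 0] else [0])) =
      g.code fun i => o' + i.val := fun g => by
    cases g <;> rfl
  simp only [hcode] at h
  rw [← h]
  simp only [Gen.shift, Gen.eval, Gen.eval_emits, Ex.eval, ho, Function.update_self, Gen.eval_nil,
    List.map_cons, List.map_nil]
  congr 1
  ext1 q
  have hlen : (F k).length - (6 + 4 * q) ≠ 0 ↔ q < C.gates.length := by
    rw [hF, C.length_encode]
    omega
  have hget : ∀ s, (F k).getD (3 + s + 4 * q) 0 =
      (C.gates.flatMap Gate.encode).getD (4 * q + s) 0 := by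
    intro s
    rw [hF, Circuit.encode, show 3 + s + 4 * q = (4 * q + s) + 1 + 1 + 1 by omega]
    simp only [List.getD_cons_succ]
  simp only [hlen, hget]

theorem flatMap_range_eq {β : Type} (n : ℕ) (f : ℕ → List β) :
    (List.range n).flatMap f = (List.finRange n).flatMap fun i => f i.val := by
  rw [← List.map_coe_finRange_eq_range, List.flatMap_map]

theorem flatMap_finRange_add {β : Type} (a b : ℕ) (f : Fin (a + b) → List β) :
    (List.finRange (a + b)).flatMap f = ((List.finRange a).flatMap fun i => f (Fin.castAdd b i)) ++
      (List.finRange b).flatMap fun j => f (Fin.natAdd a j) := by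
  have : List.finRange (a + b) =
      (List.finRange a).map (Fin.castAdd b) ++ (List.finRange b).map (Fin.natAdd a) := by
    rw [← List.ofFn_id, List.ofFn_add, List.ofFn_eq_map, List.ofFn_eq_map]
    rfl
  rw [this, List.flatMap_append, List.flatMap_map, List.flatMap_map]

theorem flatMap_finRange_mul {β : Type} (a b : ℕ) (f : Fin (a * b) → List β) :
    (List.finRange (a * b)).flatMap f = (List.finRange a).flatMap fun i =>
      (List.finRange b).flatMap fun j => f (finProdFinEquiv (i, j)) := by
  have : List.finRange (a * b) = (List.finRange a).flatMap fun i =>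
      (List.finRange b).map fun j => finProdFinEquiv (i, j) := by
    rw [← List.ofFn_id, List.ofFn_mul, List.ofFn_eq_map, ← List.flatMap_def]
    congr 1
    ext1 i
    rw [List.ofFn_eq_map]
    congr 1
    ext1 j
    ext
    simp [finProdFinEquiv]
    ring
  rw [this, List.flatMap_assoc]
  simp only [List.flatMap_map]

theorem flatMap_finRange_pair {β : Type} (r a b : ℕ) (f : Fin (r * (a + b)) → List β) :
    (List.finRange (r * (a + b))).flatMap f = (List.finRange r).flatMap fun i =>
      ((List.finRange a).flatMap fun j => f ((pairEquiv r a b).symm (i, .inl j))) ++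
      (List.finRange b).flatMap fun j => f ((pairEquiv r a b).symm (i, .inr j)) := by
  rw [flatMap_finRange_mul]
  congr 1
  ext1 i
  rw [flatMap_finRange_add]
  rfl

end

section

/-! ### Descriptions of the circuits of the state generator -/

instance : Add Ex := ⟨.add⟩

instance : Mul Ex := ⟨.mul⟩

instance (c : ℕ) : OfNat Ex c := ⟨.const c⟩

@[simp] theorem Ex.eval_add (F : ℕ → List ℕ) (env : ℕ → ℕ) (a b : Ex) :
    (a + b).eval F env = a.eval F env + b.eval F env := rfl

@[simp] theorem Ex.eval_mul (F : ℕ → List ℕ) (env : ℕ → ℕ) (a b : Ex) :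
    (a * b).eval F env = a.eval F env * b.eval F env := rfl

@[simp] theorem Ex.eval_zero (F : ℕ → List ℕ) (env : ℕ → ℕ) : Ex.eval F env 0 = 0 := rfl

@[simp] theorem Ex.eval_one (F : ℕ → List ℕ) (env : ℕ → ℕ) : Ex.eval F env 1 = 1 := rfl

@[simp] theorem Ex.eval_const (F : ℕ → List ℕ) (env : ℕ → ℕ) (c : ℕ) :
    (Ex.const c).eval F env = c := rfl

@[simp] theorem Ex.eval_var (F : ℕ → List ℕ) (env : ℕ → ℕ) (v : ℕ) :
    (Ex.var v).eval F env = env v := rfl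

theorem Gen.eval_rep_eq {F : ℕ → List ℕ} {env : ℕ → ℕ} {v n : ℕ} {a : Ex} {G : Gen}
    {f : Fin n → List ℕ} (h : a.eval F env = n)
    (hG : ∀ i : Fin n, G.eval F (Function.update env v i) = f i) :
    (Gen.rep v a G).eval F env = (List.finRange n).flatMap f := by
  rw [Gen.eval, h, flatMap_range_eq]
  exact List.flatMap_congr fun i _ => hG i

theorem Gen.eval_seq_eq {F : ℕ → List ℕ} {env : ℕ → ℕ} {G H : Gen} {l l' : List ℕ}
    (hG : G.eval F env = l) (hH : H.eval F env = l') :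
    (Gen.seq G H).eval F env = l ++ l' := by
  rw [Gen.eval, hG, hH]

theorem Gen.eval_swap_eq {F : ℕ → List ℕ} {env : ℕ → ℕ} {p q : Ex} {p' q' : ℕ}
    (hp : p.eval F env = p') (hq : q.eval F env = q') :
    (Gen.swap p q).eval F env = swapCode p' q' := by
  rw [Gen.eval_swap, hp, hq]

theorem pairEquiv_symm_inl (r a b : ℕ) (i : Fin r) (j : Fin a) :
    ((pairEquiv r a b).symm (i, .inl j)).val = j + (a + b) * i := by
  simp [pairEquiv]

theorem pairEquiv_symm_inr (r a b : ℕ) (i : Fin r) (j : Fin b) :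
    ((pairEquiv r a b).symm (i, .inr j)).val = a + j + (a + b) * i := by
  simp [pairEquiv]

/-- The files are the descriptions of the circuits of an encryption scheme. -/
structure Describes {κ ℓ m : ℕ} (F : ℕ → List ℕ) (kg : Circuit 0 κ) (enc : Circuit (κ + ℓ) m)
    (dec : Circuit (κ + m) ℓ) : Prop where
  key : F 0 = kg.encode
  enc : F 1 = enc.encode
  dec : F 2 = dec.encode

def keyLen : Ex := .look 0 1

def keyWidth : Ex := .look 0 2

def ctLen : Ex := .look 1 1

def encWidth : Ex := .look 1 2

def msgLen : Ex := .look 2 1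

def decWidth : Ex := .look 2 2

def reps : Ex := .var 0 + 1

section

variable {κ ℓ m r : ℕ} {F : ℕ → List ℕ} {kg : Circuit 0 κ} {enc : Circuit (κ + ℓ) m}
  {dec : Circuit (κ + m) ℓ} {env : ℕ → ℕ}

theorem Describes.keyLen (h : Describes F kg enc dec) : keyLen.eval F env = κ := by
  simp [QCrypto.keyLen, Ex.eval, h.key, Circuit.encode]

theorem Describes.keyWidth (h : Describes F kg enc dec) : keyWidth.eval F env = kg.width := by
  simp [QCrypto.keyWidth, Ex.eval, h.key, Circuit.encode]

theorem Describes.ctLen (h : Describes F kg enc dec) : ctLen.eval F env = m := by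
  simp [QCrypto.ctLen, Ex.eval, h.enc, Circuit.encode]

theorem Describes.encWidth (h : Describes F kg enc dec) : encWidth.eval F env = enc.width := by
  simp [QCrypto.encWidth, Ex.eval, h.enc, Circuit.encode]

theorem Describes.msgLen (h : Describes F kg enc dec) : msgLen.eval F env = ℓ := by
  simp [QCrypto.msgLen, Ex.eval, h.dec, Circuit.encode]

theorem Describes.decWidth (h : Describes F kg enc dec) : decWidth.eval F env = dec.width := by
  simp [QCrypto.decWidth, Ex.eval, h.dec, Circuit.encode]

/-- The wires of the circuit that generates keys. -/
def keyWires (kg : Circuit 0 κ) (r ℓ : ℕ) :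
    Fin r × (Fin kg.width ⊕ Fin ℓ × Unit) ↪ Fin (r * (kg.width + ℓ)) :=
  ((Equiv.prodCongr (Equiv.refl _) (Equiv.sumCongr (Equiv.refl _) (Equiv.prodPUnit _))).trans
    (pairEquiv r kg.width ℓ).symm).toEmbedding

theorem keyWires_inl (kg : Circuit 0 κ) (r ℓ : ℕ) (i : Fin r) (q : Fin kg.width) :
    (keyWires kg r ℓ (i, .inl q)).val = q + (kg.width + ℓ) * i := pairEquiv_symm_inl ..

theorem keyWires_inr (kg : Circuit 0 κ) (r ℓ : ℕ) (i : Fin r) (j : Fin ℓ) (u : Unit) :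
    (keyWires kg r ℓ (i, .inr (j, u))).val = kg.width + j + (kg.width + ℓ) * i :=
  pairEquiv_symm_inr ..

def keyCircuit (kg : Circuit 0 κ) (r ℓ : ℕ) : Circuit 0 (r * (κ + ℓ)) :=
  (keyNet kg r ℓ).realize (keyWires kg r ℓ)

def keyGenerator : Gen :=
  let M : Ex := reps * (keyLen + msgLen)
  let o : Ex := M + (keyWidth + msgLen) * .var 1
  let p : Ex := (keyLen + msgLen) * .var 1
  .seq (.emits [0, M, M + reps * (keyWidth + msgLen)]) <| .seq
    (.rep 1 reps (.seq (.shift 0 3 o)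
      (.rep 2 msgLen (.emits [0, o + (keyWidth + .var 2), 0, 0]))))
    (.rep 1 reps (.seq (.rep 2 keyLen (.swap (.var 2 + p) (o + .var 2)))
      (.rep 2 msgLen (.swap (keyLen + .var 2 + p) (o + (keyWidth + .var 2))))))

theorem sectR_apply {G ι : Type} (g : G) (i : ι) : Function.Embedding.sectR g ι i = (g, i) := rfl

theorem eval_keyGenerator (h : Describes F kg enc dec) (hr : env 0 + 1 = r) :
    keyGenerator.eval F env = (keyCircuit kg r ℓ).encode := by
  subst hr
  rw [keyCircuit, Net.encode_realize, flatMap_finRange_pair]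
  refine Gen.eval_seq_eq (l := [0, _, _])
    ?_ (Gen.eval_seq_eq ?_ (Gen.eval_rep_eq rfl fun i => Gen.eval_seq_eq
      (Gen.eval_rep_eq h.keyLen fun j => Gen.eval_swap_eq ?_ ?_)
      (Gen.eval_rep_eq h.msgLen fun j => Gen.eval_swap_eq ?_ ?_)))
  · simp [Gen.eval_emits, reps, h.keyLen, h.msgLen, h.keyWidth]
  · simp only [keyNet, Net.restrict, Net.power, List.finRange_zero, List.flatMap_nil,
      List.nil_append, List.flatMap_assoc, List.flatMap_map, Gate.code_map]
    refine Gen.eval_rep_eq rfl fun i => ?_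
    simp only [Net.par, List.flatMap_append, List.flatMap_map, Gate.code_map]
    refine Gen.eval_seq_eq ((Gen.eval_shift kg F _ 0 3 _
      ((env 0 + 1) * (κ + ℓ) + (kg.width + ℓ) * i) h.key fun q => ?_).trans ?_) ?_
    · simp [reps, h.keyLen, h.msgLen, h.keyWidth]
    · refine List.flatMap_congr fun g _ => congrArg (Gate.code · g) (funext fun q => ?_)
      simp only [sectR_apply, Function.Embedding.inl_apply, keyWires_inl]
      ring
    · simp only [coinsNet, Net.restrict, Net.power, List.flatMap_assoc, List.flatMap_map,
        Gate.code_map]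
      refine Gen.eval_rep_eq h.msgLen fun j => ?_
      simp [Gen.eval_emits, coinNet, Gate.code, reps, h.keyLen, h.msgLen, h.keyWidth,
        keyWires_inr]
      ring
  all_goals simp [reps, h.keyLen, h.msgLen, h.keyWidth, pairEquiv_symm_inr,
    pairEquiv_symm_inl, keyNet, Net.restrict, Net.power, prodEmb_apply, Net.par, keyWires_inl,
    Circuit.net, coinsNet, Equiv.prodPUnit, keyWires_inr]
  all_goals ring

def stateCircuit (enc : Circuit (κ + ℓ) m) (r : ℕ) : Circuit (r * (κ + ℓ)) (r * (m + ℓ)) :=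
  (stateNet enc r).realize (pairEquiv r enc.width ℓ).symm.toEmbedding

def stateGenerator : Gen :=
  let a : Ex := reps * (keyLen + msgLen)
  let b : Ex := reps * (ctLen + msgLen)
  let o : Ex := a + b + (encWidth + msgLen) * .var 1
  let p : Ex := (ctLen + msgLen) * .var 1
  .seq (.emits [a, b, a + b + reps * (encWidth + msgLen)]) <| .seq (.seq
    (.rep 1 reps (.rep 2 (keyLen + msgLen)
      (.swap (.var 2 + (keyLen + msgLen) * .var 1) (o + .var 2))))
    (.rep 1 reps (.seq
      (.rep 2 msgLen (.emits [.const 3, o + (keyLen + .var 2), o + (encWidth + .var 2), 0]))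
      (.shift 1 3 o))))
    (.rep 1 reps (.seq (.rep 2 ctLen (.swap (.var 2 + p) (o + .var 2)))
      (.rep 2 msgLen (.swap (ctLen + .var 2 + p) (o + (encWidth + .var 2))))))

theorem eval_stateGenerator (h : Describes F kg enc dec) (hr : env 0 + 1 = r) :
    stateGenerator.eval F env = (stateCircuit enc r).encode := by
  subst hr
  rw [stateCircuit, Net.encode_realize, flatMap_finRange_pair (env 0 + 1) m ℓ,
    flatMap_finRange_mul]
  refine Gen.eval_seq_eq (l := [_, _, _])
    ?_ (Gen.eval_seq_eq (Gen.eval_seq_eq (Gen.eval_rep_eq rfl fun i => Gen.eval_rep_eq ?_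
      fun j => Gen.eval_swap_eq ?_ ?_) ?_) (Gen.eval_rep_eq rfl fun i => Gen.eval_seq_eq
      (Gen.eval_rep_eq h.ctLen fun j => Gen.eval_swap_eq ?_ ?_)
      (Gen.eval_rep_eq h.msgLen fun j => Gen.eval_swap_eq ?_ ?_)))
  · simp [Gen.eval_emits, reps, h.keyLen, h.msgLen, h.encWidth, h.ctLen]
  rotate_left 3
  · simp only [stateNet, Net.restrict, Net.power, List.flatMap_assoc, List.flatMap_map,
      Gate.code_map]
    refine Gen.eval_rep_eq rfl fun i => ?_
    simp only [encNet, List.flatMap_append, List.flatMap_map, Gate.code_map]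
    refine Gen.eval_seq_eq (Gen.eval_rep_eq h.msgLen fun j => ?_)
      ((Gen.eval_shift enc F _ 1 3 _ ((env 0 + 1) * (κ + ℓ) + (env 0 + 1) * (m + ℓ) +
        (enc.width + ℓ) * i) h.enc fun q => ?_).trans ?_)
    · simp [Gen.eval_emits, Gate.code, reps, h.keyLen, h.msgLen, h.encWidth, h.ctLen,
        pairEquiv_symm_inr, pairEquiv_symm_inl]
      constructor <;> ring
    · simp [reps, h.keyLen, h.msgLen, h.encWidth, h.ctLen]
    · refine List.flatMap_congr fun g _ => congrArg (Gate.code · g) (funext fun q => ?_)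
      simp only [sectR_apply, Function.Embedding.inl_apply, Equiv.coe_toEmbedding,
        pairEquiv_symm_inl]
      ring
  all_goals simp [reps, h.keyLen, h.msgLen, h.encWidth, h.ctLen, pairEquiv_symm_inr,
    pairEquiv_symm_inl, stateNet, Net.restrict, Net.power, prodEmb_apply, encNet]
  all_goals ring

/-- The wires of the circuit that verifies. -/
def verWires (dec : Circuit (κ + m) ℓ) (r : ℕ) :
    Fin r × (Fin dec.width ⊕ (Fin ℓ ⊕ Fin ℓ)) ⊕ Fin (r * ℓ + 1) ↪
      Fin (r * (dec.width + (ℓ + ℓ)) + (r * ℓ + 1)) :=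
  ((Equiv.sumCongr ((Equiv.prodCongr (Equiv.refl _) (Equiv.sumCongr (Equiv.refl _)
    finSumFinEquiv)).trans (pairEquiv r dec.width (ℓ + ℓ)).symm) (Equiv.refl _)).trans
      finSumFinEquiv).toEmbedding

theorem verWires_dec (dec : Circuit (κ + m) ℓ) (r : ℕ) (i : Fin r) (q : Fin dec.width) :
    (verWires dec r (.inl (i, .inl q))).val = q + (dec.width + (ℓ + ℓ)) * i :=
  pairEquiv_symm_inl ..

theorem verWires_inl (dec : Circuit (κ + m) ℓ) (r : ℕ) (i : Fin r) (q : Fin ℓ) :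
    (verWires dec r (.inl (i, .inr (.inl q)))).val =
      dec.width + q + (dec.width + (ℓ + ℓ)) * i :=
  pairEquiv_symm_inr ..

theorem verWires_inr (dec : Circuit (κ + m) ℓ) (r : ℕ) (i : Fin r) (q : Fin ℓ) :
    (verWires dec r (.inl (i, .inr (.inr q)))).val =
      dec.width + (ℓ + q) + (dec.width + (ℓ + ℓ)) * i :=
  pairEquiv_symm_inr ..

theorem verWires_and (dec : Circuit (κ + m) ℓ) (r : ℕ) (q : Fin (r * ℓ + 1)) :
    (verWires dec r (.inr q)).val = r * (dec.width + (ℓ + ℓ)) + q := rfl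

theorem decNet_inp_key (dec : Circuit (κ + m) ℓ) (j : Fin κ) : (decNet dec).inp (.inl (.inl j)) =
    .inl (Fin.castLE dec.in_le (Fin.castAdd m j)) := rfl

theorem decNet_inp_msg (dec : Circuit (κ + m) ℓ) (j : Fin ℓ) :
    (decNet dec).inp (.inl (.inr j)) = .inr (.inr j) := rfl

theorem decNet_inp_ct (dec : Circuit (κ + m) ℓ) (j : Fin m) : (decNet dec).inp (.inr (.inl j)) =
    .inl (Fin.castLE dec.in_le (Fin.natAdd κ j)) := rfl

theorem decNet_inp_copy (dec : Circuit (κ + m) ℓ) (j : Fin ℓ) :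
    (decNet dec).inp (.inr (.inr j)) = .inr (.inl j) := rfl

theorem decNet_out (dec : Circuit (κ + m) ℓ) (j : Fin ℓ) : (decNet dec).out j = .inr (.inl j) :=
  rfl

theorem verNet_out (dec : Circuit (κ + m) ℓ) (r : ℕ) (j : Fin 1) :
    (verNet dec r).out j = .inr (Fin.last (r * ℓ)) := rfl

def verCircuit (dec : Circuit (κ + m) ℓ) (r : ℕ) :
    Circuit (r * (κ + ℓ) + r * (m + ℓ)) 1 :=
  (verNet dec r).realize (verWires dec r)

def verGenerator : Gen :=
  let a : Ex := reps * (keyLen + msgLen)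
  let M : Ex := a + reps * (ctLen + msgLen) + 1
  let B : Ex := decWidth + (msgLen + msgLen)
  let o : Ex := M + B * .var 1
  let k : Ex := (keyLen + msgLen) * .var 1
  let s : Ex := a + (ctLen + msgLen) * .var 1
  let c : Ex := M + reps * B
  .seq (.emits [a + reps * (ctLen + msgLen), 1, M + (reps * B + (reps * msgLen + 1))]) <| .seq
    (.seq
      (.seq
        (.rep 1 reps (.seq
          (.rep 2 keyLen (.swap (.var 2 + k) (o + .var 2)))
          (.rep 2 msgLen (.swap (keyLen + .var 2 + k) (o + (decWidth + (msgLen + .var 2)))))))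
        (.rep 1 reps (.seq
          (.rep 2 ctLen (.swap (.var 2 + s) (o + (keyLen + .var 2))))
          (.rep 2 msgLen (.swap (ctLen + .var 2 + s) (o + (decWidth + .var 2)))))))
      (.seq
        (.rep 1 reps (.seq (.shift 2 3 o)
          (.rep 2 msgLen (.emits [.const 3, o + .var 2, o + (decWidth + .var 2), 0,
            .const 2, o + (decWidth + .var 2), 0, 0]))))
        (.seq (.emits [.const 2, c, 0, 0])
          (.rep 1 reps (.rep 2 msgLen (.emits [.const 4, o + (decWidth + .var 2),
            c + (.var 2 + msgLen * .var 1), c + (.var 2 + msgLen * .var 1) + 1]))))))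
    (.swap 0 (c + reps * msgLen))

theorem eval_verGenerator (h : Describes F kg enc dec) (hr : env 0 + 1 = r) :
    verGenerator.eval F env = (verCircuit dec r).encode := by
  subst hr
  rw [verCircuit, Net.encode_realize, flatMap_finRange_add, flatMap_finRange_pair,
    flatMap_finRange_pair]
  refine Gen.eval_seq_eq (l := [_, _, _])
    ?_ (Gen.eval_seq_eq (Gen.eval_seq_eq (Gen.eval_seq_eq
      (Gen.eval_rep_eq rfl fun i => Gen.eval_seq_eq
        (Gen.eval_rep_eq h.keyLen fun j => Gen.eval_swap_eq ?_ ?_)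
        (Gen.eval_rep_eq h.msgLen fun j => Gen.eval_swap_eq ?_ ?_))
      (Gen.eval_rep_eq rfl fun i => Gen.eval_seq_eq
        (Gen.eval_rep_eq h.ctLen fun j => Gen.eval_swap_eq ?_ ?_)
        (Gen.eval_rep_eq h.msgLen fun j => Gen.eval_swap_eq ?_ ?_)))
      ?_) ?_)
  · simp [Gen.eval_emits, reps, h.keyLen, h.msgLen, h.decWidth, h.ctLen]
  rotate_left 8
  · simp only [verNet, Net.glue, Net.restrict, Net.power, List.flatMap_append, List.flatMap_assoc,
      List.flatMap_map, Gate.code_map]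
    refine Gen.eval_seq_eq (Gen.eval_rep_eq rfl fun i => ?_) ?_
    · simp only [decNet, List.flatMap_append, List.flatMap_assoc, List.flatMap_map, Gate.code_map]
      refine Gen.eval_seq_eq ((Gen.eval_shift dec F _ 2 3 _ ((env 0 + 1) * (κ + ℓ) +
        (env 0 + 1) * (m + ℓ) + 1 + (dec.width + (ℓ + ℓ)) * i) h.dec fun q => ?_).trans ?_)
        (Gen.eval_rep_eq h.msgLen fun j => ?_)
      · simp [reps, h.keyLen, h.msgLen, h.decWidth, h.ctLen]
      · refine List.flatMap_congr fun g _ => congrArg (Gate.code · g) (funext fun q => ?_)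
        simp only [sectR_apply, Function.Embedding.inl_apply, verWires_dec]
        ring
      · simp [Gen.eval_emits, Gate.code, reps, h.keyLen, h.msgLen, h.decWidth, h.ctLen,
          verWires_dec, verWires_inl]
        constructor <;> ring
    · simp only [andNet, List.flatMap_cons, List.flatMap_map, Gate.code,
        flatMap_finRange_mul]
      refine Gen.eval_seq_eq ?_ (Gen.eval_rep_eq rfl fun i => Gen.eval_rep_eq h.msgLen fun j => ?_)
      · simp [Gen.eval_emits, reps, h.keyLen, h.msgLen, h.decWidth, h.ctLen, verEmb,
          verWires_and]
      · simp [Gen.eval_emits, reps, h.keyLen, h.msgLen, h.decWidth, h.ctLen, verEmb,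
          verWires_and, verWires_inl, prodEmb_apply, decNet_out]
        refine ⟨?_, ?_, ?_⟩ <;> ring
  · simp only [verNet_out, List.finRange_succ, List.finRange_zero, List.map_nil,
      List.flatMap_singleton]
    refine Gen.eval_swap_eq ?_ ?_
    all_goals simp [reps, h.keyLen, h.msgLen, h.decWidth, h.ctLen, verWires_and]
    all_goals ring
  all_goals simp [reps, h.keyLen, h.msgLen, h.decWidth, h.ctLen, pairEquiv_symm_inr,
    pairEquiv_symm_inl, verNet, Net.glue, Net.restrict, Net.power, prodEmb_apply, verEquiv,
    decNet_inp_key, decNet_inp_msg, decNet_inp_ct, decNet_inp_copy, verWires_dec, verWires_inl, verWires_inr]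
  all_goals ring

end

end

section

/-! ### The state generator -/

theorem size_keyCircuit {κ : ℕ} (kg : Circuit 0 κ) (r ℓ : ℕ) : (keyCircuit kg r ℓ).size =
    4 * (r * (κ + ℓ)) + r * (kg.width + ℓ) + r * (kg.gates.length + ℓ) := by
  simp [keyCircuit, Net.size_realize, keyNet, Net.restrict, Net.power, List.length_flatMap,
    Net.par, coinsNet, coinNet, Circuit.net]

theorem size_stateCircuit {κ ℓ m : ℕ} (enc : Circuit (κ + ℓ) m) (r : ℕ) :
    (stateCircuit enc r).size = 4 * (r * (κ + ℓ)) + 4 * (r * (m + ℓ)) + r * (enc.width + ℓ) +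
      r * (ℓ + enc.gates.length) := by
  simp [stateCircuit, Net.size_realize, stateNet, Net.restrict, Net.power, List.length_flatMap,
    encNet]

theorem size_verCircuit {κ ℓ m : ℕ} (dec : Circuit (κ + m) ℓ) (r : ℕ) :
    (verCircuit dec r).size = 4 * (r * (κ + ℓ) + r * (m + ℓ)) + 4 +
      (r * (dec.width + (ℓ + ℓ)) + (r * ℓ + 1)) +
        (r * (dec.gates.length + ℓ * 2) + (r * ℓ + 1)) := by
  simp [verCircuit, Net.size_realize, verNet, Net.glue, Net.restrict, Net.power,
    List.length_flatMap, decNet, andNet]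

namespace PseudoPad

variable (S : PseudoPad)

/-- The descriptions of the circuits of a pseudo one-time pad. -/
def files (k n : ℕ) : List ℕ :=
  match k with
  | 0 => (S.keyGen n).encode
  | 1 => (S.enc n).encode
  | 2 => (S.dec n).encode
  | _ => []

theorem describes (n : ℕ) :
    Describes (fun k => S.files k n) (S.keyGen n) (S.enc n) (S.dec n) := ⟨rfl, rfl, rfl⟩

/-- A common bound for all sizes. -/
def bound (n : ℕ) : ℕ := (S.keyGen n).size + (S.enc n).size + (S.dec n).size + (n + 1)

theorem polyBounded_bound : PolyBounded S.bound :=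
  ((S.keyGen_qpt.1.add S.enc_qpt.1).add S.dec_qpt.1).add (polyBounded_id.add (polyBounded_const 1))

theorem polyTime_gen (G : Gen) :
    PolyTime fun n => G.eval (fun k => S.files k n) (initEnv n) := by
  obtain ⟨p, hp⟩ := S.polyBounded_bound
  have h : ∀ {n a b} (C : Circuit a b), C.size ≤ S.bound n →
      C.encode.length ≤ (4 * p + 4).eval n ∧ ∀ x ∈ C.encode, x ≤ (4 * p + 4).eval n := by
    intro n a b C hC
    have h1 := hp n
    have h2 := C.gates_le_size
    have h3 : (4 * p + 4).eval n = 4 * p.eval n + 4 := by simp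
    refine ⟨?_, fun x hx => ?_⟩
    · rw [C.length_encode]
      omega
    · have := C.mem_encode_le hx
      omega
  have hall : ∀ k n, (S.files k n).length ≤ (4 * p + 4).eval n ∧
      ∀ x ∈ S.files k n, x ≤ (4 * p + 4).eval n := by
    intro k n
    match k with
    | 0 => exact h _ (by rw [bound]; omega)
    | 1 => exact h _ (by rw [bound]; omega)
    | 2 => exact h _ (by rw [bound]; omega)
    | k + 3 => simp [files]
  refine G.polyTime S.files 3 (fun k hk => ?_) (fun k hk n => ?_) (4 * p + 4)
    (fun k n => (hall k n).1) fun k n => (hall k n).2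
  · match k with
    | 0 => exact S.keyGen_qpt.2
    | 1 => exact S.enc_qpt.2
    | 2 => exact S.dec_qpt.2
  · match k with
    | k + 3 => rfl

theorem key_le_bound (n : ℕ) : S.κ n ≤ S.bound n := by
  have := (S.keyGen n).out_le_size
  rw [bound]
  omega

theorem message_le_bound (n : ℕ) : S.ℓ n ≤ S.bound n := by
  have := (S.dec n).out_le_size
  rw [bound]
  omega

theorem ct_le_bound (n : ℕ) : S.ℓ n * S.w n ≤ S.bound n := by
  have := (S.enc n).out_le_size
  rw [bound]
  omega

theorem polyBounded_κ : PolyBounded S.κ := S.polyBounded_bound.mono S.key_le_bound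

theorem polyBounded_ℓ : PolyBounded S.ℓ := S.polyBounded_bound.mono S.message_le_bound

theorem polyBounded_ct : PolyBounded fun n => S.ℓ n * S.w n :=
  S.polyBounded_bound.mono S.ct_le_bound

theorem polyBounded_reps : PolyBounded fun n => n + 1 :=
  polyBounded_id.add (polyBounded_const 1)

/-- The state generator obtained from `n + 1` independent encryptions of random messages; the
key consists of the keys and the messages, the state of the ciphertexts and the messages. -/
def generator : StateGenerator where
  κ n := (n + 1) * (S.κ n + S.ℓ n)
  m n := (n + 1) * (S.ℓ n * S.w n + S.ℓ n)
  keyGen n := keyCircuit (S.keyGen n) (n + 1) (S.ℓ n)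
  stateGen n := stateCircuit (S.enc n) (n + 1)
  ver n := verCircuit (S.dec n) (n + 1)
  keyGen_qpt := by
    constructor
    · simp only [size_keyCircuit]
      exact (((polyBounded_const 4).mul (polyBounded_reps.mul
        (S.polyBounded_κ.add S.polyBounded_ℓ))).add (polyBounded_reps.mul
          ((S.keyGen_qpt.1.mono fun n => (S.keyGen n).width_le_size).add S.polyBounded_ℓ))).add
        (polyBounded_reps.mul ((S.keyGen_qpt.1.mono fun n =>
          (S.keyGen n).gates_le_size).add S.polyBounded_ℓ))
    · have := S.polyTime_gen keyGenerator
      simp only [eval_keyGenerator (S.describes _) (show initEnv _ 0 + 1 = _ from rfl)] at this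
      exact this
  stateGen_qpt := by
    constructor
    · simp only [size_stateCircuit]
      exact ((((polyBounded_const 4).mul (polyBounded_reps.mul
        (S.polyBounded_κ.add S.polyBounded_ℓ))).add ((polyBounded_const 4).mul
          (polyBounded_reps.mul (S.polyBounded_ct.add S.polyBounded_ℓ)))).add
        (polyBounded_reps.mul ((S.enc_qpt.1.mono fun n =>
          (S.enc n).width_le_size).add S.polyBounded_ℓ))).add
        (polyBounded_reps.mul (S.polyBounded_ℓ.add (S.enc_qpt.1.mono fun n =>
          (S.enc n).gates_le_size)))
    · have := S.polyTime_gen stateGenerator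
      simp only [eval_stateGenerator (S.describes _) (show initEnv _ 0 + 1 = _ from rfl)] at this
      exact this
  ver_qpt := by
    constructor
    · simp only [size_verCircuit]
      have hℓ := S.polyBounded_ℓ
      exact ((((polyBounded_const 4).mul ((polyBounded_reps.mul (S.polyBounded_κ.add hℓ)).add
        (polyBounded_reps.mul (S.polyBounded_ct.add hℓ)))).add (polyBounded_const 4)).add
        ((polyBounded_reps.mul ((S.dec_qpt.1.mono fun n => (S.dec n).width_le_size).add
          (hℓ.add hℓ))).add ((polyBounded_reps.mul hℓ).add (polyBounded_const 1)))).add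
        ((polyBounded_reps.mul ((S.dec_qpt.1.mono fun n => (S.dec n).gates_le_size).add
          (hℓ.mul (polyBounded_const 2)))).add
          ((polyBounded_reps.mul hℓ).add (polyBounded_const 1)))
    · have := S.polyTime_gen verGenerator
      simp only [eval_verGenerator (S.describes _) (show initEnv _ 0 + 1 = _ from rfl)] at this
      exact this

end PseudoPad

end

/-! ### Composition of networks -/

section

variable {ι κ μ α β γ δ G : Type} [Fintype ι] [DecidableEq ι] [Fintype κ] [DecidableEq κ]
  [Fintype μ] [DecidableEq μ] [Fintype α] [DecidableEq α] [Fintype β] [DecidableEq β]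
  [Fintype γ] [DecidableEq γ] [Fintype δ] [DecidableEq δ] [Fintype G] [DecidableEq G]

/-- The embedding of the wires of the second of two networks that are composed. -/
def compEmb (f : β ↪ κ) (g : β ↪ μ) : μ ↪ κ ⊕ μ where
  toFun := Function.extend g (fun k => Sum.inl (f k)) Sum.inr
  inj' := by
    have h1 : ∀ k, Function.extend g (fun k => Sum.inl (f k)) (Sum.inr : μ → κ ⊕ μ) (g k) =
        .inl (f k) := g.injective.extend_apply _ _
    have h2 : ∀ j, j ∉ Set.range g →
        Function.extend g (fun k => Sum.inl (f k)) (Sum.inr : μ → κ ⊕ μ) j = .inr j :=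
      fun j hj => Function.extend_apply' _ _ _ hj
    intro a b hab
    by_cases ha : a ∈ Set.range g <;> by_cases hb : b ∈ Set.range g
    · obtain ⟨a, rfl⟩ := ha
      obtain ⟨b, rfl⟩ := hb
      rw [h1, h1] at hab
      rw [f.injective (Sum.inl_injective hab)]
    · obtain ⟨a, rfl⟩ := ha
      rw [h1, h2 b hb] at hab
      exact absurd hab Sum.inl_ne_inr
    · obtain ⟨b, rfl⟩ := hb
      rw [h1, h2 a ha] at hab
      exact absurd hab Sum.inr_ne_inl
    · rw [h2 a ha, h2 b hb] at hab
      exact Sum.inr_injective hab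

/-- Run one network after the other. -/
def Net.comp (P : Net κ α β) (Q : Net μ β γ) : Net (κ ⊕ μ) α γ :=
  P.glue Q .inl (compEmb P.out Q.inp)

theorem Net.run_comp (P : Net κ α β) (Q : Net μ β γ) (ρ : QOp α) :
    (P.comp Q).run ρ = Q.run (P.run ρ) := by
  have h : ∀ k, compEmb P.out Q.inp (Q.inp k) = .inl (P.out k) := fun k =>
    Q.inp.injective.extend_apply (fun k => Sum.inl (P.out k)) Sum.inr k
  refine Net.run_glue P Q _ _ h (fun j hj => ?_) ρ
  have : compEmb P.out Q.inp j = .inr j :=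
    Function.extend_apply' (fun k => Sum.inl (P.out k)) Sum.inr j hj
  rw [this]
  rintro ⟨i, hi⟩
  exact Sum.inl_ne_inr hi

theorem Net.length_comp (P : Net κ α β) (Q : Net μ β γ) :
    (P.comp Q).gates.length = P.gates.length + Q.gates.length := by
  simp [Net.comp, Net.glue]

theorem Net.length_par (N : Net ι α β) (M : Net κ γ δ) :
    (N.par M).gates.length = N.gates.length + M.gates.length := by
  simp [Net.par]

theorem Net.length_restrict (N : Net ι α β) (f : γ ↪ α) (g : δ ↪ β) :
    (N.restrict f g).gates.length = N.gates.length := rfl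

theorem Net.length_power_le (l : List G) (N : G → Net ι α β) {B : ℕ}
    (h : ∀ g, (N g).gates.length ≤ B) : (Net.power l N).gates.length ≤ l.length * B := by
  rw [Net.power, List.length_flatMap]
  simp only [List.length_map]
  refine (List.sum_le_card_nsmul _ B ?_).trans (by simp)
  intro x hx
  obtain ⟨g, -, rfl⟩ := List.mem_map.mp hx
  exact h g

/-- The network that does nothing. -/
def Net.idle (α : Type) : Net α α α := ⟨[], .refl _, .refl _⟩

theorem Net.run_idle (ρ : QOp α) : (Net.idle α).run ρ = ρ := by
  rw [Net.run, Net.idle, evo_nil, prep_refl, ptr_refl]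

theorem Net.run_sum {J : Type*} (N : Net ι α β) (s : Finset J) (c : J → ℂ) (ρ : J → QOp α)
    (u v : β → Bool) :
    N.run (∑ k ∈ s, c k • ρ k) u v = ∑ k ∈ s, c k * N.run (ρ k) u v := by
  have hprep : prep N.inp (∑ k ∈ s, c k • ρ k) = ∑ k ∈ s, c k • prep N.inp (ρ k) := by
    ext x y
    simp only [prep, Matrix.sum_apply, Matrix.smul_apply]
    split_ifs <;> simp
  simp only [Net.run, hprep, evo_sum, evo_smul, ptr_apply, Matrix.sum_apply, Matrix.smul_apply,
    smul_eq_mul, Finset.mul_sum]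
  exact Finset.sum_comm

theorem ptr_empty {σ : QOp β} (h : IsQState σ) (u v : Empty → Bool) :
    ptr .ofIsEmpty σ u v = 1 := by
  rw [Subsingleton.elim u Empty.elim, Subsingleton.elim v Empty.elim, ← trace_eq_ptr, h.2]

theorem ptr_inl (ρ : QOp α) {σ : QOp β} (h : IsQState σ) :
    ptr Function.Embedding.inl (tens₂ ρ σ) = ρ := by
  have : (Function.Embedding.inl : α ↪ α ⊕ β) = (Equiv.sumEmpty α Empty).symm.toEmbedding.trans
      ((Function.Embedding.refl α).sumMap .ofIsEmpty) := rfl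
  rw [this, ptr_trans, ptr_tens₂, ptr_refl]
  ext u v
  rw [ptr_equiv]
  exact (congrArg _ (ptr_empty h _ _)).trans (mul_one _)

theorem ptr_inr (σ : QOp β) {ρ : QOp α} (h : IsQState ρ) :
    ptr Function.Embedding.inr (tens₂ ρ σ) = σ := by
  have : (Function.Embedding.inr : β ↪ α ⊕ β) = (Equiv.emptySum Empty β).symm.toEmbedding.trans
      (Function.Embedding.sumMap .ofIsEmpty (Function.Embedding.refl β)) := rfl
  rw [this, ptr_trans, ptr_tens₂, ptr_refl]
  ext u v
  rw [ptr_equiv]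
  exact (congrArg (· * _) (ptr_empty h _ _)).trans (one_mul _)

theorem prep_inl (ρ : QOp α) :
    prep Function.Embedding.inl ρ = tens₂ ρ (oneOp Empty) := by
  ext x y
  rw [prep, if_pos, tens₂, oneOp, mul_one]
  · rfl
  · rintro (i | i) hi
    · exact absurd ⟨i, rfl⟩ hi
    · exact i.elim

/-- Write a given string. -/
def Net.write {a : ℕ} (z : Bits a) : Net (Fin a) Empty (Fin a) :=
  ⟨(List.finRange a).flatMap fun i => if z i then [.X i] else [], .ofIsEmpty, .refl _⟩

theorem Net.length_write_le {a : ℕ} (z : Bits a) : (Net.write z).gates.length ≤ a := by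
  rw [Net.write, List.length_flatMap]
  refine (List.sum_le_card_nsmul _ 1 ?_).trans (by simp)
  intro x hx
  obtain ⟨i, -, rfl⟩ := List.mem_map.mp hx
  split_ifs <;> simp

theorem Net.run_write {a : ℕ} (z : Bits a) : (Net.write z).run (oneOp Empty) = ketbra z := by
  have h1 : oneOp Empty = Matrix.single Empty.elim Empty.elim 1 := by
    ext x y
    rw [Matrix.single_apply, if_pos ⟨Subsingleton.elim _ _, Subsingleton.elim _ _⟩, oneOp]
  have hfold : ∀ l : List (Fin a), l.Nodup →
      (l.flatMap fun i => if z i then [Gate.X i] else []).foldr Gate.act z =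
        fun i => if i ∈ l then false else z i := by
    intro l hl
    induction l with
    | nil => simp
    | cons i l ih =>
      rw [List.nodup_cons] at hl
      rw [List.flatMap_cons, List.foldr_append, ih hl.2]
      ext k
      by_cases hk : k = i
      · subst hk
        cases hz : z k <;> simp [Gate.act, hl.1, hz]
      · cases hz : z i <;> simp [Gate.act, hk]
  rw [Net.run, Net.write, h1, prep_single, ptr_refl, evo_classical_single _ ?_ _ z]
  · rfl
  · rw [hfold _ (List.nodup_finRange a)]
    ext i
    simp only [List.mem_finRange, if_true]
    exact (extend_off .ofIsEmpty _ (fun _ => false) (by rintro ⟨k, _⟩; exact k.elim)).symm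
  · intro g hg
    obtain ⟨i, -, hi⟩ := List.mem_flatMap.mp hg
    split_ifs at hi
    · rw [List.mem_singleton.mp hi]
      trivial
    · simp at hi

/-- Measure all qubits in the computational basis. -/
def Net.measure (a : ℕ) : Net (Fin a ⊕ Fin a) (Fin a) (Fin a) :=
  ⟨(List.finRange a).map fun i => .CNOT (.inl i) (.inr i) Sum.inl_ne_inr, .inl, .inl⟩

theorem Net.run_measure {a : ℕ} (ρ : Op a) :
    (Net.measure a).run ρ = ∑ k, ρ k k • ketbra k := by
  classical
  have hcl : ∀ g ∈ (Net.measure a).gates, g.IsClassical := by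
    simp [Net.measure, Gate.IsClassical]
  have hfold : ∀ (l : List (Fin a)), l.Nodup → ∀ z : Fin a ⊕ Fin a → Bool,
      (l.map fun i => (.CNOT (.inl i) (.inr i) Sum.inl_ne_inr : Gate (Fin a ⊕ Fin a))).foldr
        Gate.act z = Sum.elim (z ∘ Sum.inl) fun i =>
          if i ∈ l then xor (z (.inr i)) (z (.inl i)) else z (.inr i) := by
    intro l hl z
    induction l with
    | nil => ext (i | i) <;> simp
    | cons j l ih =>
      rw [List.nodup_cons] at hl
      rw [List.map_cons, List.foldr_cons, ih hl.2]
      ext (i | i)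
      · simp [Gate.act]
      · by_cases hi : i = j
        · subst hi
          simp [Gate.act, hl.1]
        · simp [Gate.act, hi]
  have hz : ∀ z : Fin a ⊕ Fin a → Bool, (Net.measure a).gates.foldr Gate.act z =
      Sum.elim (z ∘ Sum.inl) fun i => xor (z (.inr i)) (z (.inl i)) := fun z => by
    rw [Net.measure, hfold _ (List.nodup_finRange a)]
    simp
  have hprep : ∀ y z : Fin a ⊕ Fin a → Bool, prep (Net.measure a).inp ρ
      ((Net.measure a).gates.foldr Gate.act y) ((Net.measure a).gates.foldr Gate.act z) =
      if y ∘ Sum.inr = y ∘ Sum.inl ∧ z ∘ Sum.inr = z ∘ Sum.inl then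
        ρ (y ∘ Sum.inl) (z ∘ Sum.inl) else 0 := by
    intro y z
    rw [hz, hz, prep]
    refine if_congr ?_ rfl rfl
    have this : ∀ b c : Bool, (b ^^ c) = false ↔ b = c := by decide
    constructor
    · intro h
      have h' := fun i => h (.inr i) (by simp [Net.measure])
      exact ⟨funext fun i => (this _ _).mp (h' i).1, funext fun i => (this _ _).mp (h' i).2⟩
    · rintro ⟨h1, h2⟩ (i | i) hi
      · exact absurd ⟨i, rfl⟩ hi
      · simp only [Sum.elim_inr]
        exact ⟨(this _ _).mpr (congrFun h1 i), (this _ _).mpr (congrFun h2 i)⟩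
  ext u v
  rw [Net.run, ptr_apply]
  simp only [evo_classical _ hcl, hprep]
  rw [Matrix.sum_apply]
  simp only [Matrix.smul_apply, ketbra, Matrix.single_apply, smul_eq_mul, mul_ite, mul_one,
    mul_zero]
  rw [Finset.sum_eq_single_of_mem (Sum.elim (fun _ => false) u)
    (by simp [Net.measure])]
  · have h : ∀ u w : Bits a, Function.extend (Net.measure a).out u
        (Sum.elim (fun _ => false) w) = Sum.elim u w := by
      intro u w
      ext (i | i)
      · exact (Net.measure a).out.injective.extend_apply _ _ i
      · exact extend_off _ _ _ (by simp [Net.measure])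
    rw [h, h]
    simp only [Sum.elim_comp_inl, Sum.elim_comp_inr, true_and]
    by_cases huv : u = v
    · subst huv
      simp
    · rw [if_neg huv, Finset.sum_eq_zero]
      intro k _
      rw [if_neg]
      rintro ⟨rfl, rfl⟩
      exact huv rfl
  · intro g hg hne
    rw [if_neg]
    rintro ⟨h1, -⟩
    refine hne ?_
    ext (i | i)
    · simp only [Finset.mem_filter] at hg
      exact hg.2 i
    · have h := congrFun h1 i
      simp only [Function.comp_apply] at h
      rw [extend_off (Net.measure a).out _ _ (by simp [Net.measure])] at h
      rw [h]
      exact (Net.measure a).out.injective.extend_apply _ _ i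

theorem prep_sectR (j : G) (ρ : QOp α) :
    prep (Function.Embedding.sectR j α) ρ =
      tens (Function.update (fun _ => Matrix.single (fun _ => false) (fun _ => false) 1) j ρ) := by
  classical
  ext x y
  have hr : ∀ g a, (g, a) ∈ Set.range (Function.Embedding.sectR j α) ↔ g = j := by
    intro g a
    constructor
    · rintro ⟨b, hb⟩
      exact (congrArg Prod.fst hb).symm
    · rintro rfl
      exact ⟨a, rfl⟩
  rw [tens, ← Finset.mul_prod_erase _ _ (Finset.mem_univ j), Function.update_self]
  have : ∏ g ∈ Finset.univ.erase j, Function.update (fun _ : G =>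
      (Matrix.single (fun _ => false) (fun _ => false) 1 : QOp α)) j ρ g (fun a => x (g, a))
        (fun a => y (g, a)) = if ∀ g ∈ Finset.univ.erase j, (∀ a, x (g, a) = false) ∧
          ∀ a, y (g, a) = false then 1 else 0 := by
    refine Eq.trans (Finset.prod_congr rfl fun g hg => ?_)
      ((Finset.prod_ite_zero (f := fun _ => 1) (p := fun g => (∀ a, x (g, a) = false) ∧
        ∀ a, y (g, a) = false)).trans (by
        rw [Finset.prod_const_one]; congr))
    rw [Function.update_of_ne (Finset.ne_of_mem_erase hg), Matrix.single_apply]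
    refine if_congr ?_ rfl rfl
    simp only [funext_iff, eq_comm (a := false)]
  rw [this, mul_ite, mul_one, mul_zero, prep]
  refine if_congr ?_ rfl rfl
  simp only [Prod.forall, hr, Finset.mem_erase, Finset.mem_univ, and_true, forall_and]
  constructor
  · exact fun h => ⟨fun g hg a => h.1 g a hg, fun g hg a => h.2 g a hg⟩
  · exact fun h => ⟨fun g a hg => h.1 g hg a, fun g a hg => h.2 g hg a⟩

end

/-! ### The reduction -/

section

variable {κ ℓ m r t adv : ℕ}

/-- Prepare a known string and encrypt it. -/
def encryptNet (enc : Circuit (κ + ℓ) m) (z : Bits (κ + ℓ)) :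
    Net (Fin (κ + ℓ) ⊕ Fin enc.width) Empty (Fin m) := (Net.write z).comp enc.net

theorem run_encryptNet (enc : Circuit (κ + ℓ) m) (z : Bits (κ + ℓ)) :
    (encryptNet enc z).run (oneOp Empty) = enc.run (ketbra z) := by
  rw [encryptNet, Net.run_comp, Net.run_write, enc.run_eq]

/-- One instance of a state in which either the input or an encryption of `z` is used, next to
the message `x`. -/
def slotNet (enc : Circuit (κ + ℓ) m) (own : Bool) (z : Bits (κ + ℓ)) (x : Bits ℓ) :
    Net ((Fin m ⊕ (Fin (κ + ℓ) ⊕ Fin enc.width)) ⊕ Fin ℓ) (Fin m) (Fin m ⊕ Fin ℓ) :=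
  (((Net.idle (Fin m)).par (encryptNet enc z)).par (Net.write x)).restrict
    (Function.Embedding.inl.trans Function.Embedding.inl)
    (Function.Embedding.sumMap (if own then Function.Embedding.inl else Function.Embedding.inr)
      (.refl _))

theorem run_slotNet (enc : Circuit (κ + ℓ) m) (own : Bool) (z : Bits (κ + ℓ)) (x : Bits ℓ)
    {ρ : Op m} (hρ : IsQState ρ) : (slotNet enc own z x).run ρ =
      tens₂ (if own then ρ else enc.run (ketbra z)) (ketbra x) := by
  rw [slotNet, Net.run_restrict, prep_trans, prep_inl, prep_inl, Net.run_par, Net.run_par,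
    Net.run_idle, run_encryptNet, Net.run_write, ptr_tens₂, ptr_refl]
  cases own
  · simp only [Bool.false_eq_true, if_false, ptr_inr _ hρ]
  · simp only [if_true, ptr_inl _ ((isQState_ketbra z).circuit enc)]

/-- The state of the generator with the input as ciphertext at position `j`. -/
def copyNet (enc : Circuit (κ + ℓ) m) (j : Fin r) (z : Fin r → Bits (κ + ℓ))
    (X : Fin r → Bits ℓ) :
    Net (Fin r × ((Fin m ⊕ (Fin (κ + ℓ) ⊕ Fin enc.width)) ⊕ Fin ℓ)) (Fin m)
      (Fin (r * (m + ℓ))) :=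
  (Net.power (List.finRange r) fun i => slotNet enc (decide (i = j)) (z i) (X i)).restrict
    (Function.Embedding.sectR j _) (pairEquiv r m ℓ).toEmbedding

theorem run_copyNet (enc : Circuit (κ + ℓ) m) (j : Fin r) (z : Fin r → Bits (κ + ℓ))
    (X : Fin r → Bits ℓ) {ρ : Op m} (hρ : IsQState ρ) : (copyNet enc j z X).run ρ =
      pairState (Function.update (fun i => enc.run (ketbra (z i))) j ρ) X := by
  rw [copyNet, Net.run_restrict, prep_sectR, Net.run_power _ (List.nodup_finRange r)
    (List.mem_finRange), pairState_eq_ptr]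
  congr 2
  ext1 i
  rw [run_slotNet]
  · by_cases h : i = j
    · subst h
      simp
    · simp [h]
  · by_cases h : i = j
    · subst h
      simpa using hρ
    · simpa [h] using isQState_single _

/-- `t + 1` blocks and advice, the last block being separated. -/
def splitEquiv (t m adv : ℕ) : Fin ((t + 1) * m + adv) ≃ (Fin t × Fin m ⊕ Fin adv) ⊕ Fin m :=
  finSumFinEquiv.symm.trans <|
    (Equiv.sumCongr (finProdFinEquiv.symm.trans <|
      (Equiv.prodCongr finSumFinEquiv.symm (Equiv.refl _)).trans <|
        (Equiv.sumProdDistrib _ _ _).trans <|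
          Equiv.sumCongr (Equiv.refl _) (Equiv.uniqueProd _ _)) (Equiv.refl _)).trans <|
    (Equiv.sumAssoc _ _ _).trans <| (Equiv.sumCongr (Equiv.refl _) (Equiv.sumComm _ _)).trans <|
    (Equiv.sumAssoc _ _ _).symm

theorem prep_splitEquiv (ρ : Op m) (σ : Op adv) :
    prep (splitEquiv t m adv).toEmbedding (tensor (tensorPow (t + 1) ρ) σ) =
      tens₂ (tens₂ (tens fun _ => ρ) σ) ρ := by
  ext x y
  rw [prep_equiv, tensor, tensorPow, Fin.prod_univ_castSucc, tens₂, tens₂, tens,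
    mul_right_comm]
  have e1 : ∀ (x : (Fin t × Fin m ⊕ Fin adv) ⊕ Fin m → Bool) (i : Fin t), (fun j =>
      (x ∘ splitEquiv t m adv) (Fin.castAdd adv (finProdFinEquiv (i.castSucc, j)))) =
        fun a => (x ∘ Sum.inl) (.inl (i, a)) := fun x i => by
    have : i.castSucc = Fin.castAdd 1 i := rfl
    ext j
    simp [splitEquiv, this]
  have e2 : ∀ (x : (Fin t × Fin m ⊕ Fin adv) ⊕ Fin m → Bool), (fun j =>
      (x ∘ splitEquiv t m adv) (Fin.castAdd adv (finProdFinEquiv (Fin.last t, j)))) =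
        x ∘ Sum.inr := fun x => by
    have : Fin.last t = Fin.natAdd t 0 := rfl
    ext j
    simp [splitEquiv, this]
  have e3 : ∀ (x : (Fin t × Fin m ⊕ Fin adv) ⊕ Fin m → Bool), (fun j =>
      (x ∘ splitEquiv t m adv) (Fin.natAdd ((t + 1) * m) j)) =
        (x ∘ Sum.inl) ∘ Sum.inr := fun x => by
    ext j
    simp [splitEquiv]
  simp only [e1, e2, e3]
  rfl

/-- Prepare `t + 1` states, run the attack on `t` of them, measure the key that it returns, and
verify with the last state. -/
def reductionNet (enc : Circuit (κ + ℓ) m)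
    (A : Circuit (t * (r * (m + ℓ)) + adv) (r * (κ + ℓ)))
    (V : Circuit (r * (κ + ℓ) + r * (m + ℓ)) 1)
    (j : Fin r) (z : Fin r → Bits (κ + ℓ)) (X : Fin r → Bits ℓ) :=
  (((((Net.power (List.finRange t) fun _ => copyNet enc j z X).par (Net.idle (Fin adv))).par
    (copyNet enc j z X)).restrict (splitEquiv t m adv).toEmbedding (.refl _)).comp <|
  ((A.net.restrict (((finProdFinEquiv.symm.sumCongr (Equiv.refl (Fin adv))).symm.trans
    finSumFinEquiv)).toEmbedding (.refl _)).par (Net.idle (Fin (r * (m + ℓ)))))).comp <|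
  ((Net.measure (r * (κ + ℓ))).par (Net.idle (Fin (r * (m + ℓ))))).comp <|
  (V.net.restrict finSumFinEquiv.toEmbedding (.refl (Fin 1)))

theorem run_reductionNet (enc : Circuit (κ + ℓ) m)
    (A : Circuit (t * (r * (m + ℓ)) + adv) (r * (κ + ℓ)))
    (V : Circuit (r * (κ + ℓ) + r * (m + ℓ)) 1)
    (j : Fin r) (z : Fin r → Bits (κ + ℓ)) (X : Fin r → Bits ℓ) {ρ : Op m} (hρ : IsQState ρ)
    (σ : Op adv) {φ : Op (r * (m + ℓ))}
    (hφ : φ = pairState (Function.update (fun i => enc.run (ketbra (z i))) j ρ) X) :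
    (reductionNet enc A V j z X).run (tensor (tensorPow (t + 1) ρ) σ)
      (fun _ => true) (fun _ => true) =
    ∑ k, A.run (tensor (tensorPow t φ) σ) k k *
      V.run (tensor (ketbra k) φ) (fun _ => true) (fun _ => true) := by
  have h1 : prep ((finProdFinEquiv.symm.sumCongr (Equiv.refl (Fin adv))).symm.trans
      finSumFinEquiv).toEmbedding (tens₂ (tens fun _ : Fin t => φ) σ) =
        tensor (tensorPow t φ) σ := by
    ext x y
    rw [prep_equiv]
    rfl
  have h2 : ∀ k, prep finSumFinEquiv.toEmbedding (tens₂ (ketbra k) φ) =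
      tensor (ketbra (a := r * (κ + ℓ)) k) φ := fun k => by
    ext x y
    rw [prep_equiv]
    rfl
  have h3 : ∀ c : Bits (r * (κ + ℓ)) → ℂ, tens₂ (∑ k, c k • ketbra k) φ =
      ∑ k, c k • tens₂ (ketbra k) φ := by
    intro c
    ext x y
    simp only [tens₂, Matrix.sum_apply, Matrix.smul_apply, smul_eq_mul, Finset.sum_mul, mul_assoc]
  rw [reductionNet]
  generalize hR : V.net.restrict finSumFinEquiv.toEmbedding (.refl (Fin 1)) = R
  rw [Net.run_comp, Net.run_comp, Net.run_comp, Net.run_restrict, prep_splitEquiv,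
    Net.run_par, Net.run_par, Net.run_power _ (List.nodup_finRange t) (List.mem_finRange),
    Net.run_idle, run_copyNet enc j z X hρ, ← hφ, ptr_refl, Net.run_par, Net.run_idle,
    Net.run_restrict, h1, ptr_refl, ← A.run_eq, Net.run_par, Net.run_idle, Net.run_measure, h3,
    Net.run_sum]
  refine Finset.sum_congr rfl fun k _ => ?_
  rw [← hR, Net.run_restrict, h2, ptr_refl, ← V.run_eq]

theorem length_reductionNet_le (enc : Circuit (κ + ℓ) m)
    (A : Circuit (t * (r * (m + ℓ)) + adv) (r * (κ + ℓ)))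
    (V : Circuit (r * (κ + ℓ) + r * (m + ℓ)) 1)
    (j : Fin r) (z : Fin r → Bits (κ + ℓ)) (X : Fin r → Bits ℓ) :
    (reductionNet enc A V j z X).gates.length ≤ (t + 1) * (r * (κ + ℓ + enc.gates.length + ℓ)) +
      A.gates.length + (r * (κ + ℓ) + V.gates.length) := by
  have h1 : (copyNet enc j z X).gates.length ≤ r * (κ + ℓ + enc.gates.length + ℓ) := by
    rw [copyNet, Net.length_restrict]
    refine (Net.length_power_le _ _ (B := κ + ℓ + enc.gates.length + ℓ) fun i => ?_).trans
      (by simp)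
    simp only [slotNet, encryptNet, Net.length_restrict, Net.length_par, Net.length_comp]
    have h2 := Net.length_write_le (z i)
    have h3 := Net.length_write_le (X i)
    have h4 : (Net.idle (Fin m)).gates.length = 0 := rfl
    have h5 : enc.net.gates.length = enc.gates.length := rfl
    omega
  have h2 := Net.length_power_le (List.finRange t) (fun _ => copyNet enc j z X) fun _ => h1
  rw [List.length_finRange] at h2
  simp only [reductionNet, Net.length_restrict, Net.length_par, Net.length_comp]
  have h3 : (Net.measure (r * (κ + ℓ))).gates.length = r * (κ + ℓ) := by simp [Net.measure]
  have h4 : ∀ n, (Net.idle (Fin n)).gates.length = 0 := fun n => rfl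
  have h5 : A.net.gates.length = A.gates.length := rfl
  have h6 : V.net.gates.length = V.gates.length := rfl
  rw [add_mul, one_mul, h3, h4, h4, h5, h6]
  omega

/-- The circuit of the reduction. -/
def reductionCircuit (enc : Circuit (κ + ℓ) m)
    (A : Circuit (t * (r * (m + ℓ)) + adv) (r * (κ + ℓ)))
    (V : Circuit (r * (κ + ℓ) + r * (m + ℓ)) 1)
    (j : Fin r) (z : Fin r → Bits (κ + ℓ)) (X : Fin r → Bits ℓ) :
    Circuit ((t + 1) * m + adv) 1 :=
  (reductionNet enc A V j z X).realize (Fintype.equivFin _).toEmbedding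

theorem size_reductionCircuit_le (enc : Circuit (κ + ℓ) m)
    (A : Circuit (t * (r * (m + ℓ)) + adv) (r * (κ + ℓ)))
    (V : Circuit (r * (κ + ℓ) + r * (m + ℓ)) 1)
    (j : Fin r) (z : Fin r → Bits (κ + ℓ)) (X : Fin r → Bits ℓ) {E : ℕ} (hE : enc.size ≤ E)
    {D : ℕ} (hA : A.size ≤ D) (hV : V.size ≤ D) :
    (reductionCircuit enc A V j z X).size ≤ (t + 1) * (r * (20 * E)) + 20 * D + 4 := by
  have h := length_reductionNet_le enc A V j z X
  have hw := enc.width_le_size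
  have hg : enc.width + enc.gates.length ≤ E := hE
  have hi := enc.in_le_size
  have ho := enc.out_le_size
  have hAw : A.width + A.gates.length ≤ D := hA
  have hAi := A.in_le_size
  have hAo := A.out_le_size
  have hVw : V.width + V.gates.length ≤ D := hV
  have hVi := V.in_le_size
  rw [reductionCircuit, Net.size_realize]
  simp only [Fintype.card_sum, Fintype.card_prod, Fintype.card_fin]
  have h1 : (t + 1) * m ≤ (t + 1) * (r * E) := Nat.mul_le_mul_left _ <|
    (ho.trans hE).trans (Nat.le_mul_of_pos_left _ (Fin.pos j))
  have h2 : (t + 1) * (r * (κ + ℓ + enc.gates.length + ℓ)) ≤ (t + 1) * (r * (3 * E)) := by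
    gcongr
    omega
  have h3 : (t + 1) * (r * (m + (κ + ℓ + enc.width) + ℓ)) ≤ (t + 1) * (r * (4 * E)) := by
    gcongr
    omega
  have h4 : (t + 1) * (r * (20 * E)) = 20 * ((t + 1) * (r * E)) := by ring
  have h5 : (t + 1) * (r * (3 * E)) = 3 * ((t + 1) * (r * E)) := by ring
  have h6 : (t + 1) * (r * (4 * E)) = 4 * ((t + 1) * (r * E)) := by ring
  have h7 : (t + 1) * (r * (m + (κ + ℓ + enc.width) + ℓ)) =
    t * (r * (m + (κ + ℓ + enc.width) + ℓ)) + r * (m + (κ + ℓ + enc.width) + ℓ) := by ring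
  omega

end

section

/-! ### Probabilities -/

theorem Circuit.prob_nonneg {a b : ℕ} (C : Circuit a b) {ρ : Op a} (h : IsQState ρ) (y : Bits b) :
    0 ≤ C.prob ρ y := (h.circuit C).re_nonneg y

theorem Circuit.sum_prob {a b : ℕ} (C : Circuit a b) {ρ : Op a} (h : IsQState ρ) :
    ∑ y, C.prob ρ y = 1 := (h.circuit C).sum_re

theorem Circuit.prob_le_one {a b : ℕ} (C : Circuit a b) {ρ : Op a} (h : IsQState ρ) (y : Bits b) :
    C.prob ρ y ≤ 1 := by
  rw [← C.sum_prob h]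
  exact Finset.single_le_sum (fun y _ => C.prob_nonneg h y) (Finset.mem_univ y)

theorem Circuit.run_apply {a b : ℕ} (C : Circuit a b) {ρ : Op a} (h : IsQState ρ) (y : Bits b) :
    C.run ρ y y = (C.prob ρ y : ℂ) := (h.circuit C).apply_self y

theorem AdviceKind.Allows.isQState {K : AdviceKind} {a : ℕ} {ρ : Op a} (h : K.Allows ρ) :
    IsQState ρ := by
  cases K with
  | classical =>
    obtain ⟨x, rfl⟩ := h
    exact isQState_ketbra x
  | quantum => exact h

theorem Negligible.of_le {f g : ℕ → ℝ} (hg : Negligible g) (hf : ∀ n, 0 ≤ f n)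
    (hfg : ∀ n, f n ≤ g n) : Negligible f :=
  Asymptotics.SuperpolynomialDecay.trans_abs_le hg fun n => by
    rw [abs_of_nonneg (hf n)]
    exact (hfg n).trans (le_abs_self _)

theorem Negligible.succ_mul {f : ℕ → ℝ} (hf : Negligible f) :
    Negligible fun n => (n + 1) * f n :=
  ((Asymptotics.SuperpolynomialDecay.param_mul hf).add hf).congr fun n => by
    simp
    ring

/-- Replacing the components of a random vector one after the other. -/
theorem abs_sum_hybrid_le {Ω D : Type*} [Fintype Ω] {p : Ω → ℝ} (hp : ∀ s, 0 ≤ p s)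
    (hp1 : ∑ s, p s = 1) {ε : ℝ} : ∀ {r : ℕ} (F : (Fin r → D) → ℝ) (a b : Fin r → Ω → D),
    (∀ j f, |∑ s, p s * (F (Function.update f j (a j s)) - F (Function.update f j (b j s)))| ≤ ε) →
    |∑ sk : Fin r → Ω, (∏ i, p (sk i)) * (F (fun i => a i (sk i)) - F fun i => b i (sk i))| ≤
      r * ε := by
  intro r
  induction r with
  | zero =>
    intro F a b _
    have : ∀ sk : Fin 0 → Ω, (fun i => a i (sk i)) = fun i => b i (sk i) := fun sk =>
      Subsingleton.elim _ _
    simp [this]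
  | succ r ih =>
    intro F a b h
    have hsplit : ∑ sk : Fin (r + 1) → Ω, (∏ i, p (sk i)) *
        (F (fun i => a i (sk i)) - F fun i => b i (sk i)) =
        ∑ s, p s * ∑ sk : Fin r → Ω, (∏ i, p (sk i)) *
          (F (Fin.cons (a 0 s) fun i => a i.succ (sk i)) -
            F (Fin.cons (a 0 s) fun i => b i.succ (sk i))) +
        ∑ sk : Fin r → Ω, (∏ i, p (sk i)) * ∑ s, p s *
          (F (Fin.cons (a 0 s) fun i => b i.succ (sk i)) -
            F (Fin.cons (b 0 s) fun i => b i.succ (sk i))) := by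
      have hcons : ∀ (c : Fin (r + 1) → Ω → D) (s : Ω) (sk : Fin r → Ω),
          (fun i => c i ((Fin.cons s sk : Fin (r + 1) → Ω) i)) =
            (Fin.cons (c 0 s) fun i => c i.succ (sk i) : Fin (r + 1) → D) := by
        intro c s sk
        ext i
        refine Fin.cases rfl (fun i => rfl) i
      simp only [Finset.mul_sum]
      rw [Finset.sum_comm (s := (Finset.univ : Finset (Fin r → Ω))), ← Finset.sum_add_distrib,
        ← (Fin.consEquiv fun _ => Ω).sum_comp, Fintype.sum_prod_type]
      refine Finset.sum_congr rfl fun s _ => ?_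
      rw [← Finset.sum_add_distrib]
      refine Finset.sum_congr rfl fun sk _ => ?_
      simp only [Fin.consEquiv, Equiv.coe_fn_mk, Fin.prod_univ_succ, Fin.cons_zero, Fin.cons_succ,
        hcons]
      ring
    have hprod : ∑ sk : Fin r → Ω, ∏ i, p (sk i) = 1 := by
      rw [← Fintype.prod_sum fun (_ : Fin r) s => p s]
      simp [hp1]
    rw [hsplit]
    refine (abs_add_le _ _).trans ?_
    rw [Nat.cast_succ, add_mul, one_mul]
    refine add_le_add ?_ ?_
    · refine (Finset.abs_sum_le_sum_abs _ _).trans ?_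
      rw [← one_mul (r * ε), ← hp1, Finset.sum_mul]
      refine Finset.sum_le_sum fun s _ => ?_
      rw [abs_mul, abs_of_nonneg (hp s)]
      refine mul_le_mul_of_nonneg_left ?_ (hp s)
      refine ih (fun f => F (Fin.cons (a 0 s) f)) _ _ fun j f => ?_
      simp only [Fin.cons_update]
      exact h j.succ _
    · refine (Finset.abs_sum_le_sum_abs _ _).trans ?_
      rw [← one_mul ε, ← hprod, Finset.sum_mul]
      refine Finset.sum_le_sum fun sk _ => ?_
      have h0 : 0 ≤ ∏ i, p (sk i) := Finset.prod_nonneg fun i _ => hp _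
      rw [abs_mul, abs_of_nonneg h0]
      refine mul_le_mul_of_nonneg_left ?_ h0
      rcases isEmpty_or_nonempty Ω with hΩ | ⟨⟨s₀⟩⟩
      · simp at hp1
      · have := h 0 (Fin.cons (b 0 s₀) fun i => b i.succ (sk i))
        simpa only [Fin.update_cons_zero] using this

/-- The components of a string of keys and messages. -/
def slotsEquiv (r a b : ℕ) : Bits (r * (a + b)) ≃ (Fin r → Bits a × Bits b) :=
  (partsEquiv r a b).trans (Equiv.arrowProdEquivProdArrow _ _ _).symm

namespace PseudoPad

variable (S : PseudoPad) (n : ℕ)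

theorem isQState_ct (sk : Bits (S.κ n)) (x : Bits (S.ℓ n)) : IsQState (S.ct n sk x) :=
  ((isQState_ketbra sk).tensor (isQState_ketbra x)).circuit _

theorem ct_eq (sk : Bits (S.κ n)) (x : Bits (S.ℓ n)) :
    S.ct n sk x = (S.enc n).run (ketbra (Fin.append sk x)) := by
  rw [← tensor_ketbra (Fin.append sk x)]
  simp [ct]

/-- The probability that the key generation of the scheme returns `sk`. -/
def keyProb (sk : Bits (S.κ n)) : ℝ := (S.keyGen n).sample sk

/-- The probability that decrypting `ρ` with `sk` returns `x`. -/
def decProb (sk : Bits (S.κ n)) (ρ : Op (S.ℓ n * S.w n)) (x : Bits (S.ℓ n)) : ℝ :=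
  (S.dec n).prob (tensor (ketbra sk) ρ) x

theorem keyProb_nonneg (sk : Bits (S.κ n)) : 0 ≤ S.keyProb n sk :=
  Circuit.prob_nonneg _ (isQState_ketbra _) _

theorem sum_keyProb : ∑ sk, S.keyProb n sk = 1 := Circuit.sum_prob _ (isQState_ketbra _)

variable {S n}

theorem decProb_nonneg {ρ : Op (S.ℓ n * S.w n)} (h : IsQState ρ) (sk : Bits (S.κ n))
    (x : Bits (S.ℓ n)) : 0 ≤ S.decProb n sk ρ x :=
  Circuit.prob_nonneg _ ((isQState_ketbra _).tensor h) _

theorem sum_decProb {ρ : Op (S.ℓ n * S.w n)} (h : IsQState ρ) (sk : Bits (S.κ n)) :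
    ∑ x, S.decProb n sk ρ x = 1 := Circuit.sum_prob _ ((isQState_ketbra _).tensor h)

theorem sample_generator (y : Bits ((n + 1) * (S.κ n + S.ℓ n))) :
    (S.generator.keyGen n).sample y = ∏ i, S.keyProb n (fstPart y i) * (1 / 2) ^ S.ℓ n := by
  have h : ((S.generator.keyGen n).sample y : ℝ) =
      ((keyNet (S.keyGen n) (n + 1) (S.ℓ n)).run (ketbra Fin.elim0) y y).re := by
    rw [← Net.run_realize _ (keyWires (S.keyGen n) (n + 1) (S.ℓ n))]
    rfl
  rw [h, run_keyNet, ← Complex.ofReal_re (∏ i, _)]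
  congr 1
  push_cast
  refine Finset.prod_congr rfl fun i _ => ?_
  rw [(S.keyGen n).run_apply (isQState_ketbra _)]
  rfl

theorem state_generator (y : Bits ((n + 1) * (S.κ n + S.ℓ n))) : S.generator.state n y =
    pairState (fun i => S.ct n (fstPart y i) (sndPart y i)) (sndPart y) :=
  (Net.run_realize (stateNet (S.enc n) (n + 1)) (pairEquiv _ _ _).symm.toEmbedding
    (ketbra y)).trans (run_stateNet (S.enc n) (n + 1) y)

theorem accept_generator (k : Bits ((n + 1) * (S.κ n + S.ℓ n)))
    {ρ : Fin (n + 1) → Op (S.ℓ n * S.w n)} (hρ : ∀ i, IsQState (ρ i))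
    (X : Fin (n + 1) → Bits (S.ℓ n)) :
    (S.generator.ver n).accept (tensor (ketbra k) (pairState ρ X)) =
      ∏ i, S.decProb n (fstPart k i) (ρ i) (X i) := by
  have h : (S.generator.ver n).accept (tensor (ketbra k) (pairState ρ X)) =
      ((verNet (S.dec n) (n + 1)).run (tensor (ketbra k) (pairState ρ X))
        (fun _ => true) (fun _ => true)).re := by
    rw [← Net.run_realize _ (verWires (S.dec n) (n + 1))]
    rfl
  rw [h, run_verNet, ← Complex.ofReal_re (∏ i, _)]
  congr 1
  push_cast
  refine Finset.prod_congr rfl fun i _ => ?_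
  rw [(S.dec n).run_apply ((isQState_ketbra _).tensor (hρ i))]
  rfl

theorem verProb_generator (k y : Bits ((n + 1) * (S.κ n + S.ℓ n))) :
    S.generator.verProb n k y = ∏ i, S.decProb n (fstPart k i)
      (S.ct n (fstPart y i) (sndPart y i)) (sndPart y i) :=
  (congrArg (fun φ => (S.generator.ver n).accept (tensor (ketbra k) φ)) (state_generator y)).trans
    (accept_generator k (fun _ => S.isQState_ct n _ _) _)

/-! ### Correctness -/

theorem correctProb_generator : S.generator.correctProb n =
    (∑ x, (1 / 2) ^ S.ℓ n * S.correctProb n x) ^ (n + 1) := by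
  have h1 : ∑ x, (1 / 2) ^ S.ℓ n * S.correctProb n x = ∑ s : Bits (S.κ n) × Bits (S.ℓ n),
      S.keyProb n s.1 * (1 / 2) ^ S.ℓ n * S.decProb n s.1 (S.ct n s.1 s.2) s.2 := by
    rw [Fintype.sum_prod_type_right]
    refine Finset.sum_congr rfl fun x _ => ?_
    rw [correctProb, Finset.mul_sum]
    refine Finset.sum_congr rfl fun sk _ => ?_
    rw [keyProb, decProb]
    ring
  rw [h1, ← Fin.prod_const, Fintype.prod_sum]
  refine Fintype.sum_equiv (slotsEquiv (n + 1) (S.κ n) (S.ℓ n)) _ _ fun y => ?_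
  refine (congrArg₂ (· * ·) (sample_generator y) (verProb_generator y y)).trans ?_
  rw [← Finset.prod_mul_distrib]
  rfl

theorem correct_generator (h : S.Correct) : S.generator.Correct := by
  have hmax : ∀ n, ∃ x, ∀ x', 1 - S.correctProb n x' ≤ 1 - S.correctProb n x := fun n =>
    Finite.exists_max fun x => 1 - S.correctProb n x
  choose x hx using hmax
  have hsum : ∀ n, ∑ _x : Bits (S.ℓ n), (1 / 2 : ℝ) ^ S.ℓ n = 1 := fun n => by
    simp
  have hle : ∀ n x, S.correctProb n x ≤ 1 := fun n x => by
    rw [correctProb, ← S.sum_keyProb n]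
    refine Finset.sum_le_sum fun sk _ => mul_le_of_le_one_right (S.keyProb_nonneg n sk) ?_
    exact Circuit.prob_le_one _ ((isQState_ketbra _).tensor (S.isQState_ct n _ _)) _
  have hge : ∀ n x, 0 ≤ S.correctProb n x := fun n x =>
    Finset.sum_nonneg fun sk _ => mul_nonneg (S.keyProb_nonneg n sk)
      (Circuit.prob_nonneg _ ((isQState_ketbra _).tensor (S.isQState_ct n _ _)) _)
  have hb : ∀ n, 0 ≤ 1 - S.generator.correctProb n ∧ 1 - S.generator.correctProb n ≤
      (n + 1) * (1 - S.correctProb n (x n)) := by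
    intro n
    rw [correctProb_generator]
    set c := ∑ x, (1 / 2) ^ S.ℓ n * S.correctProb n x with hc
    have hc1 : c ≤ 1 := by
      rw [← hsum n]
      exact Finset.sum_le_sum fun x _ => mul_le_of_le_one_right (by positivity) (hle n x)
    have hc0 : 0 ≤ c := Finset.sum_nonneg fun x _ => mul_nonneg (by positivity) (hge n x)
    have hcx : 1 - c ≤ 1 - S.correctProb n (x n) := by
      have : S.correctProb n (x n) ≤ c := by
        rw [← one_mul (S.correctProb n (x n)), ← hsum n, Finset.sum_mul]
        refine Finset.sum_le_sum fun x' _ => mul_le_mul_of_nonneg_left ?_ (by positivity)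
        linarith [hx n x']
      linarith
    refine ⟨sub_nonneg.mpr (pow_le_one₀ hc0 hc1), ?_⟩
    have := one_add_mul_le_pow (a := c - 1) (by linarith) (n + 1)
    push_cast at this
    rw [add_sub_cancel] at this
    have h2 : ((n : ℝ) + 1) * (1 - c) ≤ (n + 1) * (1 - S.correctProb n (x n)) := by gcongr
    linarith
  refine Negligible.of_le (h x).succ_mul (fun n => (hb n).1) fun n => (hb n).2

end PseudoPad

end

section

/-! ### Security -/

/-- A circuit with an equal number of inputs. -/
def Circuit.castIn {a a' b : ℕ} (h : a = a') (C : Circuit a b) : Circuit a' b := h ▸ C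

theorem Circuit.size_castIn {a a' b : ℕ} (h : a = a') (C : Circuit a b) :
    (C.castIn h).size = C.size := by
  subst h
  rfl

theorem Circuit.prob_castIn {T t m s b : ℕ} (h : t + 1 = T)
    (C : Circuit ((t + 1) * m + s) b) (ρ : Op m) (σ : Op s) (y : Bits b) :
    (C.castIn (by rw [h])).prob (tensor (tensorPow T ρ) σ) y =
      C.prob (tensor (tensorPow (t + 1) ρ) σ) y := by
  subst h
  rfl

theorem negligible_half_pow : Negligible fun n => (1 / 2 : ℝ) ^ (n + 1) := by
  intro c
  have := (tendsto_pow_const_mul_const_pow_of_abs_lt_one c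
    (show |(1 / 2 : ℝ)| < 1 by rw [abs_of_pos] <;> norm_num)).mul_const (1 / 2)
  rw [zero_mul] at this
  refine this.congr fun n => ?_
  rw [mul_assoc, ← pow_succ]

namespace PseudoPad

variable {S : PseudoPad} {K : AdviceKind} {t : Polynomial ℕ}
  (A : Adversary K (fun n => t.eval n * S.generator.m n) S.generator.κ) {n : ℕ}

/-- The probability that the attack succeeds for the given ciphertexts and messages. -/
def winProb (n : ℕ) (ρ : Fin (n + 1) → Op (S.ℓ n * S.w n)) (X : Fin (n + 1) → Bits (S.ℓ n)) : ℝ :=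
  ∑ k : Bits ((n + 1) * (S.κ n + S.ℓ n)), A.prob n (tensorPow (t.eval n) (pairState ρ X)) k *
    ∏ i, S.decProb n (fstPart k i) (ρ i) (X i)

theorem isQState_attack {ρ : Fin (n + 1) → Op (S.ℓ n * S.w n)} (hρ : ∀ i, IsQState (ρ i))
    (X : Fin (n + 1) → Bits (S.ℓ n)) :
    IsQState (tensor (tensorPow (t.eval n) (pairState ρ X)) (A.advice n)) :=
  ((isQState_pairState hρ X).tensorPow _).tensor (A.advice_allowed n).isQState

theorem attackProb_generator : S.generator.attackProb t A n =
    ∑ X : Fin (n + 1) → Bits (S.ℓ n), ((1 / 2) ^ S.ℓ n) ^ (n + 1) *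
      ∑ sk : Fin (n + 1) → Bits (S.κ n), (∏ i, S.keyProb n (sk i)) *
        winProb A n (fun i => S.ct n (sk i) (X i)) X := by
  simp only [Finset.mul_sum]
  rw [← Fintype.sum_prod_type_right']
  refine Fintype.sum_equiv (partsEquiv (n + 1) (S.κ n) (S.ℓ n)) _ _ fun y => ?_
  have hk : (∑ k', A.prob n (tensorPow (t.eval n) (S.generator.state n y)) k' *
      S.generator.verProb n k' y) =
        winProb A n (fun i => S.ct n (fstPart y i) (sndPart y i)) (sndPart y) :=
    Finset.sum_congr rfl fun k _ => congrArg₂ (· * ·)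
      (congrArg (fun φ => A.prob n (tensorPow (t.eval n) φ) k) (state_generator y))
      (verProb_generator k y)
  refine (congrArg₂ (· * ·) (sample_generator y) hk).trans ?_
  rw [Finset.prod_mul_distrib, Fin.prod_const, mul_comm (∏ i, _), mul_assoc]
  rfl

theorem winProb_nonneg {ρ : Fin (n + 1) → Op (S.ℓ n * S.w n)} (hρ : ∀ i, IsQState (ρ i))
    (X : Fin (n + 1) → Bits (S.ℓ n)) : 0 ≤ winProb A n ρ X :=
  Finset.sum_nonneg fun _ _ => mul_nonneg (Circuit.prob_nonneg _ (isQState_attack A hρ X) _)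
    (Finset.prod_nonneg fun i _ => decProb_nonneg (hρ i) _ _)

theorem winProb_le {ρ : Fin (n + 1) → Op (S.ℓ n * S.w n)} (hρ : ∀ i, IsQState (ρ i))
    (X : Fin (n + 1) → Bits (S.ℓ n)) :
    winProb A n ρ X ≤ ∑ sk : Fin (n + 1) → Bits (S.κ n), ∏ i, S.decProb n (sk i) (ρ i) (X i) := by
  have h1 : ∑ k, A.prob n (tensorPow (t.eval n) (pairState ρ X)) k = 1 :=
    Circuit.sum_prob _ (isQState_attack A hρ X)
  rw [← one_mul (∑ sk : Fin (n + 1) → Bits (S.κ n), _), ← h1, Finset.sum_mul]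
  refine Finset.sum_le_sum fun k _ => mul_le_mul_of_nonneg_left ?_
    (Circuit.prob_nonneg _ (isQState_attack A hρ X) k)
  exact Finset.single_le_sum (f := fun sk : Fin (n + 1) → Bits (S.κ n) =>
    ∏ i, S.decProb n (sk i) (ρ i) (X i))
    (fun sk _ => Finset.prod_nonneg fun i _ => decProb_nonneg (hρ i) _ _)
    (Finset.mem_univ fun i => fstPart k i)

/-- Ciphertexts that do not depend on the messages are of no use. -/
theorem sum_winProb_le {ρ : Fin (n + 1) → Op (S.ℓ n * S.w n)} (hρ : ∀ i, IsQState (ρ i)) :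
    ∑ X : Fin (n + 1) → Bits (S.ℓ n), winProb A n ρ X ≤ (2 ^ S.κ n) ^ (n + 1) := by
  refine (Finset.sum_le_sum fun X _ => winProb_le A hρ X).trans ?_
  rw [Finset.sum_comm]
  have : ∀ sk : Fin (n + 1) → Bits (S.κ n), ∑ X : Fin (n + 1) → Bits (S.ℓ n),
      ∏ i, S.decProb n (sk i) (ρ i) (X i) = 1 := fun sk => by
    rw [← Fintype.prod_sum fun i x => S.decProb n (sk i) (ρ i) x]
    exact Finset.prod_eq_one fun i _ => sum_decProb (hρ i) (sk i)
  simp [this]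

/-- The advantage of the reduction. -/
def advantage (n : ℕ) (X : Fin (n + 1) → Bits (S.ℓ n)) (j : Fin (n + 1))
    (z : Fin (n + 1) → Bits (S.κ n + S.ℓ n)) : ℝ :=
  |∑ sk, S.keyProb n sk *
    (winProb A n (Function.update (fun i => (S.enc n).run (ketbra (z i))) j (S.ct n sk (X j))) X -
      winProb A n (Function.update (fun i => (S.enc n).run (ketbra (z i))) j
        (S.ct n sk fun _ => false)) X)|

theorem attackProb_le {ε : ℝ} (h : ∀ X j z, advantage A n X j z ≤ ε) :
    S.generator.attackProb t A n ≤ (n + 1) * ε + (1 / 2) ^ (n + 1) := by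
  set c : ℝ := ((1 / 2) ^ S.ℓ n) ^ (n + 1) with hc
  have hc0 : 0 ≤ c := by positivity
  have hsum : ∑ _X : Fin (n + 1) → Bits (S.ℓ n), c = 1 := by
    simp [hc]
  have hprod : ∑ sk : Fin (n + 1) → Bits (S.κ n), ∏ i, S.keyProb n (sk i) = 1 := by
    rw [← Fintype.prod_sum fun (_ : Fin (n + 1)) s => S.keyProb n s]
    simp [S.sum_keyProb]
  have hyb : ∀ X, ∑ sk : Fin (n + 1) → Bits (S.κ n), (∏ i, S.keyProb n (sk i)) *
      winProb A n (fun i => S.ct n (sk i) (X i)) X ≤ (n + 1) * ε +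
      ∑ sk : Fin (n + 1) → Bits (S.κ n), (∏ i, S.keyProb n (sk i)) *
        winProb A n (fun i => S.ct n (sk i) fun _ => false) X := by
    intro X
    have := abs_sum_hybrid_le (S.keyProb_nonneg n) (S.sum_keyProb n)
      (fun z : Fin (n + 1) → Bits (S.κ n + S.ℓ n) =>
        winProb A n (fun i => (S.enc n).run (ketbra (z i))) X)
      (fun i sk => Fin.append sk (X i)) (fun i sk => Fin.append sk fun _ => false) (ε := ε)
      (fun j z => ?_)
    · simp only [← ct_eq, mul_sub, Finset.sum_sub_distrib] at this
      have h2 := (le_abs_self _).trans this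
      push_cast at h2
      linarith
    · refine le_trans (le_of_eq ?_) (h X j z)
      rw [advantage]
      have hup : ∀ w, (fun i => (S.enc n).run (ketbra (Function.update z j w i))) =
          Function.update (fun i => (S.enc n).run (ketbra (z i))) j ((S.enc n).run (ketbra w)) := by
        intro w
        ext1 i
        exact Function.apply_update (fun _ w => (S.enc n).run (ketbra w)) z j w i
      simp only [hup, ct_eq]
  rw [attackProb_generator]
  calc _ ≤ ∑ X : Fin (n + 1) → Bits (S.ℓ n), c * ((n + 1) * ε +
        ∑ sk : Fin (n + 1) → Bits (S.κ n), (∏ i, S.keyProb n (sk i)) *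
          winProb A n (fun i => S.ct n (sk i) fun _ => false) X) :=
      Finset.sum_le_sum fun X _ => mul_le_mul_of_nonneg_left (hyb X) hc0
    _ = (n + 1) * ε + c * ∑ sk : Fin (n + 1) → Bits (S.κ n), (∏ i, S.keyProb n (sk i)) *
          ∑ X, winProb A n (fun i => S.ct n (sk i) fun _ => false) X := by
      simp only [mul_add, Finset.sum_add_distrib, ← Finset.sum_mul, ← Finset.mul_sum, hsum,
        one_mul]
      rw [Finset.sum_comm]
      simp only [Finset.mul_sum]
    _ ≤ (n + 1) * ε + c * ∑ sk : Fin (n + 1) → Bits (S.κ n), (∏ i, S.keyProb n (sk i)) *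
          (2 ^ S.κ n) ^ (n + 1) := by
      gcongr with sk
      · exact Finset.prod_nonneg fun i _ => S.keyProb_nonneg n _
      · exact sum_winProb_le A fun i => S.isQState_ct n _ _
    _ = (n + 1) * ε + ((1 / 2) ^ S.ℓ n * 2 ^ S.κ n) ^ (n + 1) := by
      rw [← Finset.sum_mul, hprod, one_mul, hc, mul_pow]
    _ ≤ (n + 1) * ε + (1 / 2) ^ (n + 1) := by
      gcongr
      obtain ⟨d, hd⟩ := Nat.exists_eq_add_of_lt (S.key_lt_message n)
      rw [hd, show S.κ n + d + 1 = S.κ n + (d + 1) from rfl, pow_add, mul_right_comm, ← mul_pow]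
      norm_num
      rw [pow_succ]
      have : (1 / 2 : ℝ) ^ d ≤ 1 := pow_le_one₀ (by norm_num) (by norm_num)
      linarith

/-- The reduction from distinguishing ciphertexts to attacking the generator; the advice of the
attack is kept, and everything else that the reduction depends on is part of its circuits. -/
def reduction (π : ∀ n, (Fin (n + 1) → Bits (S.ℓ n)) × Fin (n + 1) ×
    (Fin (n + 1) → Bits (S.κ n + S.ℓ n))) :
    Adversary K (fun n => (t + 1).eval n * (S.ℓ n * S.w n)) fun _ => 1 where
  adviceLen := A.adviceLen
  advice := A.advice
  advice_allowed := A.advice_allowed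
  circuit n := (reductionCircuit (t := t.eval n) (S.enc n) (A.circuit n) (S.generator.ver n)
    (π n).2.1 (π n).2.2 (π n).1).castIn (by simp)
  poly := by
    refine PolyBounded.mono ?_ fun n => ((Circuit.size_castIn _ _).trans_le
      (size_reductionCircuit_le (t := t.eval n) (S.enc n) (A.circuit n) (S.generator.ver n)
        (π n).2.1 (π n).2.2 (π n).1 le_rfl (Nat.le_add_right _ (S.generator.ver n).size)
        (Nat.le_add_left _ (A.circuit n).size)))
    exact ((((polyBounded_eval t).add (polyBounded_const 1)).mul
      (polyBounded_reps.mul ((polyBounded_const 20).mul S.enc_qpt.1))).add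
        ((polyBounded_const 20).mul (A.poly.add S.generator.ver_qpt.1))).add (polyBounded_const 4)

theorem prob_reduction (π : ∀ n, (Fin (n + 1) → Bits (S.ℓ n)) × Fin (n + 1) ×
    (Fin (n + 1) → Bits (S.κ n + S.ℓ n))) {ρ : Op (S.ℓ n * S.w n)} (hρ : IsQState ρ) :
    (reduction A π).prob n (tensorPow ((t + 1).eval n) ρ) (fun _ => true) =
      winProb A n (Function.update (fun i => (S.enc n).run (ketbra ((π n).2.2 i))) (π n).2.1 ρ)
        (π n).1 := by
  have hstate : ∀ i, IsQState (Function.update (fun i => (S.enc n).run (ketbra ((π n).2.2 i)))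
      (π n).2.1 ρ i) := by
    intro i
    by_cases h : i = (π n).2.1
    · rw [h, Function.update_self]
      exact hρ
    · rw [Function.update_of_ne h]
      exact (isQState_ketbra _).circuit _
  refine (Circuit.prob_castIn (by simp) _ ρ (A.advice n) _).trans ?_
  refine (congrArg Complex.re ((congrFun (congrFun (Net.run_realize _ _ _) _) _).trans
    (run_reductionNet (t := t.eval n) (S.enc n) (A.circuit n) (S.generator.ver n) _ _ _ hρ _
      rfl))).trans ?_
  rw [Complex.re_sum]
  refine Finset.sum_congr rfl fun k _ => ?_
  rw [← accept_generator k hstate]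
  have h1 := Circuit.run_apply (A.circuit n) (isQState_attack A hstate (π n).1) k
  have h2 := Circuit.run_apply (S.generator.ver n)
    ((isQState_ketbra k).tensor (isQState_pairState hstate (π n).1)) fun _ => true
  refine (congrArg Complex.re (congrArg₂ (· * ·) h1 h2)).trans ?_
  rw [← Complex.ofReal_mul, Complex.ofReal_re]
  rfl

theorem secure_generator (h : S.Secure K) : S.generator.Secure K := by
  intro t A
  have hmax : ∀ n, ∃ π : (Fin (n + 1) → Bits (S.ℓ n)) × Fin (n + 1) ×
      (Fin (n + 1) → Bits (S.κ n + S.ℓ n)), ∀ π' : (Fin (n + 1) → Bits (S.ℓ n)) × Fin (n + 1) ×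
        (Fin (n + 1) → Bits (S.κ n + S.ℓ n)),
      advantage A n π'.1 π'.2.1 π'.2.2 ≤ advantage A n π.1 π.2.1 π.2.2 := fun n =>
    Finite.exists_max fun π : (Fin (n + 1) → Bits (S.ℓ n)) × Fin (n + 1) ×
      (Fin (n + 1) → Bits (S.κ n + S.ℓ n)) => advantage A n π.1 π.2.1 π.2.2
  choose π hπ using hmax
  have hred := h (fun n => (π n).1 (π n).2.1) (fun n _ => false) (t + 1) (reduction A π)
  have heq : ∀ n, |S.acceptProb (t + 1) (reduction A π) n ((π n).1 (π n).2.1) -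
      S.acceptProb (t + 1) (reduction A π) n fun _ => false| =
        advantage A n (π n).1 (π n).2.1 (π n).2.2 := by
    intro n
    simp only [acceptProb, prob_reduction A π (S.isQState_ct n _ _), ← Finset.sum_sub_distrib,
      ← mul_sub]
    rfl
  simp only [heq] at hred
  refine Negligible.of_le (Asymptotics.SuperpolynomialDecay.add hred.succ_mul negligible_half_pow)
    (fun n => ?_) fun n => attackProb_le A fun X j z => hπ n (X, j, z)
  rw [attackProb_generator]
  exact Finset.sum_nonneg fun X _ => mul_nonneg (by positivity) <| Finset.sum_nonneg fun sk _ =>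
    mul_nonneg (Finset.prod_nonneg fun i _ => S.keyProb_nonneg n _)
      (winProb_nonneg A (fun i => S.isQState_ct n _ _) X)

end PseudoPad

end

end

end QCrypto

theorem mainTheorem6 (K : QCrypto.AdviceKind) (h : QCrypto.QPOTPExist K) :
    QCrypto.OWSGExist K := by
  obtain ⟨S, hc, hs⟩ := h
  exact ⟨S.generator, QCrypto.PseudoPad.correct_generator hc,
    QCrypto.PseudoPad.secure_generator hs⟩
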